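/- Let $\mathcal H$ be a $k$-uniform hypergraph with $n$ vertices ($k\ge 2$). Its adjacency tensor $\mathcal A(\mathcal H)$ is the $k$-order $n$-dimensional tensor with entries $a_{i_1\cdots i_k}=\frac1{(k-1)!}$ if $\{i_1,\dots,i_k\}$ is a hyperedge and $0$ otherwise, $\mathcal D(\mathcal H)$ is the diagonal tensor of vertex degrees, and $\mathcal A_\alpha(\mathcal H)=\alpha\mathcal D(\mathcal H)+(1-\alpha)\mathcal A(\mathcal H)$. The $d$-th order trace of a $k$-order $n$-dimensional tensor $\mathcal A$ is $$\mathrm{Tr}_d(\mathcal A)=(k-1)^{n-1}\sum_{d_1+\cdots+d_n=d}\ \prod_{i=1}^n\frac1{(d_i(k-1))!}\Bigl(\sum_{\beta\in[n]^{k-1}}\mathcal A_{i\beta}\frac{\partial}{\partial a_{i\beta}}\Bigr)^{d_i}\mathrm{tr}\bigl(A^{d(k-1)}\bigr),$$ where $A=(a_{ij})$ is an $n\times n$ matrix of indeterminates, the $d_i$ are nonnegative integers, and $\frac{\partial}{\partial a_{i\beta}}=\frac{\partial}{\partial a_{ii_2}}\cdots\frac{\partial}{\partial a_{ii_k}}$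 for $\beta=i_2\cdots i_k$. For two $k$-uniform hypergraphs with $n$ vertices, write $\mathcal H_1\prec_\alpha\mathcal H_2$ if for some integer $s$ with $1\le s\le n(k-1)^{n-1}-1$ we have $\mathrm{Tr}_t(\mathcal A_\alpha(\mathcal H_1))=\mathrm{Tr}_t(\mathcal A_\alpha(\mathcal H_2))$ for $0\le t<s$ and $\mathrm{Tr}_s(\mathcal A_\alpha(\mathcal H_1))<\mathrm{Tr}_s(\mathcal A_\alpha(\mathcal H_2))$; write $\mathcal H_1=_\alpha\mathcal H_2$ if $\mathrm{Tr}_t(\mathcal A_\alpha(\mathcal H_1))=\mathrm{Tr}_t(\mathcal A_\alpha(\mathcal H_2))$ for $0\le t\le n(k-1)^{n-1}-1$; and write $\mathcal H_1\preceq_\alpha\mathcal H_2$ if $\mathcal H_1\prec_\alpha\mathcal H_2$ or $\mathcal H_1=_\alpha\mathcal H_2$. A $k$-uniform hypertree is a connected $k$-uniform hypergraph without cycles (a cycle being an alternating closed sequence of $l\ge2$ distinct vertices and $l$ distinct hyperedges, each hyperedge containing the two vertices next to it). The starlike hypertree $S^{(k)}_{n_1,\dots,n_p}$ is obtained from $p$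 $k$-uniform hyperpaths with $n_1,\dots,n_p$ hyperedges by identifying one end vertex of each of them to a common vertex. **Theorem.** Let $k\ge2$, $0<\alpha<1$ and $2\le d\le m$. Put $t=\lfloor d/2\rfloor$ and let $S=S^{(k)}_{t,d-t,1,\dots,1}$ with $m-d$ ones (that is, the hyperpath with $d$ hyperedges with $m-d$ pendant hyperedges attached at the common vertex of its $t$-th and $(t+1)$-th hyperedges). Then $S$ is a $k$-uniform hypertree with $m$ hyperedges and diameter $d$, and it is the last such hypertree in $S_\alpha$-order: every $k$-uniform hypertree $T$ with $m$ hyperedges and diameter $d$ satisfies $T\preceq_\alpha S$, with $T=_\alpha S$ if and only if $T\cong S$. -/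

import Mathlib

open MvPolynomial in
/-- Partial derivatives of polynomials commute. -/
theorem MvPolynomial.pderiv_commute {σ R : Type*} [CommSemiring R] (i j : σ) :
    Commute ((pderiv i : Derivation R (MvPolynomial σ R) (MvPolynomial σ R)) :
        Module.End R (MvPolynomial σ R))
      ((pderiv j : Derivation R (MvPolynomial σ R) (MvPolynomial σ R)) :
        Module.End R (MvPolynomial σ R)) := by
  classical
  apply LinearMap.ext
  intro p
  ext s
  simp only [Module.End.mul_apply, Derivation.coeFn_coe, coeff_pderiv]
  by_cases h : i = j
  · subst h; rfl
  · simp only [Finsupp.add_apply, Finsupp.single_apply, h, Ne.symm h, if_false, add_zero,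
      add_right_comm s, mul_assoc]
    congr 1
    exact mul_comm _ _

namespace Tensor

/-- A tensor of order `k` and dimension `|V|` over `R`, with index set `V`: the entry
`a_{i i₂ ⋯ i_k}` is `A i β` with `β = (i₂, …, i_k)`. -/
abbrev KTensor (k : ℕ) (V R : Type*) := V → (Fin (k - 1) → V) → R

section
variable {k : ℕ} {V R : Type*}

/-- The differential operator `∂/∂a_{i i₂} ⋯ ∂/∂a_{i i_k}` for `β = (i₂, …, i_k)`, acting on
polynomials in the entries `a_{ij}` of an auxiliary matrix. -/
noncomputable def rowDeriv (R : Type*) [CommSemiring R] (i : V) (β : Fin (k - 1) → V) :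
    Module.End R (MvPolynomial (V × V) R) :=
  (List.ofFn fun j =>
    ((MvPolynomial.pderiv (i, β j) : Derivation R (MvPolynomial (V × V) R)
      (MvPolynomial (V × V) R)) : Module.End R (MvPolynomial (V × V) R))).prod

/-- The differential operator `∑_β A_{iβ} ∂/∂a_{iβ}`. -/
noncomputable def rowOp [Fintype V] [CommSemiring R] (A : KTensor k V R) (i : V) :
    Module.End R (MvPolynomial (V × V) R) :=
  ∑ β : Fin (k - 1) → V, A i β • rowDeriv R i β

theorem rowDeriv_commute [CommSemiring R] (i j : V) (β γ : Fin (k - 1) → V) :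
    Commute (rowDeriv R i β) (rowDeriv R j γ) := by
  unfold rowDeriv
  refine Commute.list_prod_left _ _ fun x hx => Commute.list_prod_right _ _ fun y hy => ?_
  obtain ⟨a, rfl⟩ := (List.mem_ofFn' _ _).1 hx
  obtain ⟨b, rfl⟩ := (List.mem_ofFn' _ _).1 hy
  exact MvPolynomial.pderiv_commute _ _

theorem rowOp_commute [Fintype V] [CommSemiring R] (A : KTensor k V R) (i j : V) :
    Commute (rowOp A i) (rowOp A j) := by
  unfold rowOp
  refine Commute.sum_left _ _ _ fun β _ => Commute.sum_right _ _ _ fun γ _ => ?_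
  exact ((rowDeriv_commute i j β γ).smul_left _).smul_right _

/-- The `d`-th order trace of a tensor `A` of order `k` and dimension `n = |V|`:
`(k-1)^{n-1} ∑_{d₁+⋯+d_n=d} ∏_i (1/(d_i(k-1))!) (∑_β A_{iβ} ∂/∂a_{iβ})^{d_i} tr(X^{d(k-1)})`,
where `X = (a_{ij})` is a matrix of indeterminates. As `tr(X^{d(k-1)})` is homogeneous of degree
`d(k-1)` and as many derivatives are taken, each summand is a constant polynomial;
`constantCoeff` reads off its value. The operators commute (`rowOp_commute`), so the order in
which the elements of `V` are listed does not matter. -/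
noncomputable def trace [Fintype V] [DecidableEq V] [Field R] (A : KTensor k V R) (d : ℕ) : R :=
  ((k - 1 : ℕ) : R) ^ (Fintype.card V - 1) *
    ∑ f ∈ Finset.piAntidiag (Finset.univ : Finset V) d,
      (∏ i, (((f i * (k - 1)).factorial : ℕ) : R)⁻¹) *
        MvPolynomial.constantCoeff
          (((Finset.univ : Finset V).toList.map fun i => rowOp A i ^ f i).prod
            ((Matrix.mvPolynomialX V V R ^ (d * (k - 1))).trace))

end

end Tensor

namespace Hypergraph

section
variable {V W : Type*}

/-- Every hyperedge has exactly `k` vertices. -/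
def IsUniform (k : ℕ) (H : Hypergraph V) : Prop := ∀ e ∈ H.edgeSet, e.ncard = k

/-- The degree of a vertex: the number of hyperedges containing it. -/
noncomputable def degree (H : Hypergraph V) (v : V) : ℕ := {e ∈ H.edgeSet | v ∈ e}.ncard

/-- There is a path of length `l` from `u` to `v`: pairwise distinct vertices
`u = x₀, …, x_l = v` and pairwise distinct hyperedges `e₁, …, e_l` with `x_{i-1}, x_i ∈ e_i`. -/
def HasPath (H : Hypergraph V) (u v : V) (l : ℕ) : Prop :=
  ∃ (x : Fin (l + 1) → V) (e : Fin l → Set V),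
    Function.Injective x ∧ Function.Injective e ∧ x 0 = u ∧ x (Fin.last l) = v ∧
      (∀ i, x i ∈ H.vertexSet) ∧
      ∀ i : Fin l, e i ∈ H.edgeSet ∧ x i.castSucc ∈ e i ∧ x i.succ ∈ e i

/-- Any two vertices are joined by a path (and there is at least one vertex). -/
def IsConnected (H : Hypergraph V) : Prop :=
  H.vertexSet.Nonempty ∧ ∀ u ∈ H.vertexSet, ∀ v ∈ H.vertexSet, ∃ l, H.HasPath u v l

/-- There is a cycle of length `l = p + 2 ≥ 2`: pairwise distinct vertices `x₁, …, x_l` and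
pairwise distinct hyperedges `e₁, …, e_l` with `x_i, x_{i+1} ∈ e_i`, indices modulo `l`. -/
def HasCycle (H : Hypergraph V) : Prop :=
  ∃ (p : ℕ) (x : Fin (p + 2) → V) (e : Fin (p + 2) → Set V),
    Function.Injective x ∧ Function.Injective e ∧
      ∀ i, e i ∈ H.edgeSet ∧ x i ∈ e i ∧ x (i + 1) ∈ e i

/-- A `k`-uniform hypertree: a connected `k`-uniform hypergraph without cycles. -/
def IsHypertree (k : ℕ) (H : Hypergraph V) : Prop :=
  H.IsUniform k ∧ H.IsConnected ∧ ¬ H.HasCycle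

/-- The length of a shortest path from `u` to `v`. -/
noncomputable def dist (H : Hypergraph V) (u v : V) : ℕ := sInf {l | H.HasPath u v l}

/-- `d` is the diameter, the largest distance between two vertices, of the (connected)
hypergraph `H`. -/
def HasDiameter (H : Hypergraph V) (d : ℕ) : Prop :=
  IsGreatest {l | ∃ u ∈ H.vertexSet, ∃ v ∈ H.vertexSet, H.dist u v = l} d

/-- Isomorphism of hypergraphs whose vertex sets are the whole types `V` and `W`. -/
def Iso (H : Hypergraph V) (H' : Hypergraph W) : Prop :=
  ∃ φ : V ≃ W, H.image φ = H'

open Classical in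
/-- The adjacency tensor of a `k`-uniform hypergraph with vertex set `V`. -/
noncomputable def adjTensor (k : ℕ) (H : Hypergraph V) : Tensor.KTensor k V ℝ := fun i β =>
  if insert i (Set.range β) ∈ H.edgeSet then 1 / ((k - 1).factorial : ℝ) else 0

open Classical in
/-- The degree tensor: the diagonal tensor of vertex degrees. -/
noncomputable def degTensor (k : ℕ) (H : Hypergraph V) : Tensor.KTensor k V ℝ := fun i β =>
  if ∀ j, β j = i then (H.degree i : ℝ) else 0

/-- The `A_α`-tensor `α D(H) + (1 - α) A(H)`. -/
noncomputable def alphaTensor (k : ℕ) (α : ℝ) (H : Hypergraph V) : Tensor.KTensor k V ℝ :=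
  fun i β => α * H.degTensor k i β + (1 - α) * H.adjTensor k i β

/-- The `d`-th order `A_α`-spectral moment `Tr_d(A_α(H))` of a `k`-uniform hypergraph with
vertex set `V`. -/
noncomputable def moment [Fintype V] [DecidableEq V] (k : ℕ) (α : ℝ) (H : Hypergraph V) (d : ℕ) :
    ℝ :=
  Tensor.trace (H.alphaTensor k α) d

variable [Fintype V] [DecidableEq V] [Fintype W] [DecidableEq W]

/-- `H ≺_α H'`: both have `n` vertices, and for some `d` with `1 ≤ d ≤ n (k-1)^{n-1} - 1` the
moments of order `0, …, d - 1` agree and the `d`-th moment of `H` is smaller. -/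
def Before (k : ℕ) (α : ℝ) (H : Hypergraph V) (H' : Hypergraph W) : Prop :=
  Fintype.card V = Fintype.card W ∧
    ∃ d, 1 ≤ d ∧ d < Fintype.card V * (k - 1) ^ (Fintype.card V - 1) ∧
      (∀ t < d, H.moment k α t = H'.moment k α t) ∧ H.moment k α d < H'.moment k α d

/-- `H =_α H'`: both have `n` vertices, and the moments of order `0, …, n (k-1)^{n-1} - 1`
agree. -/
def MomentEq (k : ℕ) (α : ℝ) (H : Hypergraph V) (H' : Hypergraph W) : Prop :=
  Fintype.card V = Fintype.card W ∧
    ∀ t < Fintype.card V * (k - 1) ^ (Fintype.card V - 1), H.moment k α t = H'.moment k α t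

/-- `H ⪯_α H'`: `H ≺_α H'` or `H =_α H'`. -/
def BeforeEq (k : ℕ) (α : ℝ) (H : Hypergraph V) (H' : Hypergraph W) : Prop :=
  H.Before k α H' ∨ H.MomentEq k α H'

end

/-- The vertices of the starlike hypertree with arm lengths `L`: the common vertex `none`, and for
each arm `a` and each position `j` on it the `k - 1` new vertices `some ⟨a, j, r⟩` of the
`j`-th hyperedge of that arm. -/
abbrev StarlikeVertex (k : ℕ) (L : List ℕ) : Type :=
  Option (Σ a : Fin L.length, Fin (L.get a) × Fin (k - 1))

/-- The `j`-th hyperedge of arm `a` (counted from `0` at the common vertex): its `k - 1` new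
vertices, together with the common vertex if `j = 0`, and otherwise with the last new vertex
(index `k - 2`) of the preceding hyperedge of the same arm. -/
def starlikeEdge (k : ℕ) (L : List ℕ) (a : Fin L.length) (j : Fin (L.get a)) :
    Set (StarlikeVertex k L) :=
  {v | (v = none ∧ j.val = 0) ∨ (∃ r, v = some ⟨a, j, r⟩) ∨
    ∃ (i : Fin (L.get a)) (r : Fin (k - 1)), v = some ⟨a, i, r⟩ ∧ i.val + 1 = j.val ∧
      r.val + 2 = k}

/-- The `k`-uniform starlike hypertree `S_{n₁,…,n_p}^{(k)}`, `L = [n₁, …, n_p]`: hyperpaths of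
lengths `n₁, …, n_p` sharing a common end vertex. -/
def starlike (k : ℕ) (L : List ℕ) : Hypergraph (StarlikeVertex k L) where
  vertexSet := Set.univ
  edgeSet := {e | ∃ (a : Fin L.length) (j : Fin (L.get a)), e = starlikeEdge k L a j}
  subset_vertexSet_of_mem_edgeSet' := fun _ _ => Set.subset_univ _

/-- The list `t, d - t, 1, …, 1` with `t = ⌊d/2⌋` and `m - d` ones. -/
abbrev armLengths (m d : ℕ) : List ℕ := d / 2 :: (d - d / 2) :: List.replicate (m - d) 1

end Hypergraph

/-!
A monomial of `tr(X^{d(k-1)})` is a closed walk, and the operators in `Tr_d` select the closed walks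
that leave every vertex as often as the chosen tensor entries prescribe; hence `Tr_d` is a sum of
entry products over circuits, which for `A_α(H)` follow the hyperedges of `H` and have nonnegative
weight. The moments of order `0` and `1` depend on the numbers of vertices and hyperedges only, and
the moment of order `2` is, up to such quantities, `α² ∑ deg(v)²` with a positive factor.

In a hypertree with `m` hyperedges and diameter `d` the `m - d` hyperedges off a diametral path
contribute most to `∑ deg(v)²` when all of them are pendant at one inner vertex of the path, so the
maximisers of the second moment are the starlike hypertrees `S_{p, d-p, 1, …, 1}`. For
`p < t ≤ d/2` those of `p` and `t` are compared inside a common spider. Without pendant hyperedges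
both are the same path, so only the contribution of the pendant hyperedges matters, and lengthening
the short arm from `p` to `t` changes it only through circuits that notice both the pendant
hyperedges and the tip of the short arm. There are none of order below `kp + 2`; at this order the
circuit that runs through the `p` hyperedges of the short arm, with a loop at each end, gains weight
because the degree of the tip grows from `1` to `2`.
-/

namespace HypertreeMoment

open Hypergraph Tensor

/-! ### The differential pairing of polynomials -/

section DiffPairing

open MvPolynomial

variable {σ R : Type*} [CommSemiring R]

theorem prod_X_eq_monomial {ι : Type*} [Fintype ι] (a : ι → σ) :
    ∏ q, (X (a q) : MvPolynomial σ R) = monomial (∑ q, Finsupp.single (a q) 1) 1 := by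
  rw [monomial_sum_one]; rfl

theorem sum_single_apply_eq_card {ι : Type*} [Fintype ι] [DecidableEq σ] (a : ι → σ) (s : σ) :
    (∑ q, Finsupp.single (a q) 1 : σ →₀ ℕ) s = Fintype.card {q // a q = s} := by
  rw [Finsupp.finsetSum_apply, Fintype.card_subtype, Finset.card_filter]
  exact Finset.sum_congr rfl fun q _ => by rw [Finsupp.single_apply]

theorem exists_equiv_of_sum_single_eq {ι τ : Type*} [Fintype ι] [Fintype τ] {a : ι → σ} {b : τ → σ}
    (h : (∑ q, Finsupp.single (a q) 1 : σ →₀ ℕ) = ∑ t, Finsupp.single (b t) 1) :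
    ∃ e : ι ≃ τ, ∀ q, a q = b (e q) := by
  have := Classical.decEq σ
  have hcard (s : σ) : Fintype.card {q // a q = s} = Fintype.card {t // b t = s} := by
    rw [← sum_single_apply_eq_card, ← sum_single_apply_eq_card, h]
  exact ⟨(Equiv.sigmaFiberEquiv a).symm.trans
      ((Equiv.sigmaCongrRight fun s => Fintype.equivOfCardEq (hcard s)).trans
        (Equiv.sigmaFiberEquiv b)),
    fun q => (Fintype.equivOfCardEq (hcard (a q)) ⟨q, rfl⟩).2.symm⟩

/-- The number of label-preserving bijections: they are a torsor under the permutations of `τ`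
preserving `b`. -/
theorem card_labelPreserving_equiv [Fintype σ] {ι τ : Type*} [Fintype ι] [Fintype τ]
    [DecidableEq ι] [DecidableEq τ] [DecidableEq σ] (a : ι → σ) (b : τ → σ) :
    Fintype.card {e : ι ≃ τ // ∀ q, a q = b (e q)} =
      if (∑ q, Finsupp.single (a q) 1 : σ →₀ ℕ) = ∑ t, Finsupp.single (b t) 1 then
        ∏ s, (Fintype.card {t // b t = s}).factorial else 0 := by
  split_ifs with h
  · obtain ⟨e₀, he₀⟩ := exists_equiv_of_sum_single_eq h
    rw [← DomMulAct.stabilizer_card b]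
    refine Fintype.card_congr
      { toFun := fun e => ⟨e₀.symm.trans e.1, funext fun t => ?_⟩
        invFun := fun g => ⟨e₀.trans g.1, fun q => (he₀ q).trans (congrFun g.2 (e₀ q)).symm⟩
        left_inv := fun e => Subtype.ext (by ext; simp)
        right_inv := fun g => Subtype.ext (by ext; simp) }
    have ht := e.2 (e₀.symm t)
    rw [he₀, Equiv.apply_symm_apply] at ht
    simpa using ht.symm
  · refine Fintype.card_eq_zero_iff.2 ⟨fun e => h ?_⟩
    rw [← Equiv.sum_comp e.1]
    exact Finset.sum_congr rfl fun q _ => by rw [e.2 q]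

variable [Fintype σ]

/-- The bilinear pairing `(P, Q) ↦ (P(∂) Q)(0) = ∑_M M! P_M Q_M`. -/
noncomputable def diffPairing : MvPolynomial σ R →ₗ[R] MvPolynomial σ R →ₗ[R] R :=
  (basisMonomials σ R).constr R fun M => (∏ i, ((M i).factorial : R)) • lcoeff R M

theorem diffPairing_monomial (M : σ →₀ ℕ) (Q : MvPolynomial σ R) :
    diffPairing (monomial M 1) Q = (∏ i, ((M i).factorial : R)) * coeff M Q := by
  have h := (basisMonomials σ R).constr_basis R
    (fun M => (∏ i, ((M i).factorial : R)) • lcoeff R M) M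
  rw [coe_basisMonomials] at h
  exact LinearMap.congr_fun h Q

theorem diffPairing_one (Q : MvPolynomial σ R) : diffPairing 1 Q = constantCoeff Q := by
  simpa [constantCoeff_eq] using diffPairing_monomial 0 Q

theorem diffPairing_prod_X_prod_X {ι τ : Type*} [Fintype ι] [Fintype τ] [DecidableEq ι]
    [DecidableEq τ] [DecidableEq σ] (a : ι → σ) (b : τ → σ) :
    diffPairing (∏ t, (X (b t) : MvPolynomial σ R)) (∏ q, X (a q)) =
      (Fintype.card {e : ι ≃ τ // ∀ q, a q = b (e q)} : R) := by
  rw [prod_X_eq_monomial, prod_X_eq_monomial, diffPairing_monomial, coeff_monomial,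
    card_labelPreserving_equiv]
  simp only [sum_single_apply_eq_card]
  split_ifs <;> simp

/-- `O` is the differential operator `p(∂)`. It is characterized as the adjoint of multiplication
by `p` for `diffPairing`, which avoids evaluating `p` in the noncommutative ring of operators. -/
def IsDiffAdjoint (p : MvPolynomial σ R) (O : Module.End R (MvPolynomial σ R)) : Prop :=
  ∀ P Q, diffPairing (p * P) Q = diffPairing P (O Q)

theorem isDiffAdjoint_pderiv (s : σ) :
    IsDiffAdjoint (X s : MvPolynomial σ R)
      ((pderiv s : Derivation R (MvPolynomial σ R) (MvPolynomial σ R)) :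
        Module.End R (MvPolynomial σ R)) := by
  classical
  intro P Q
  have hfactorial (M : σ →₀ ℕ) : ∏ i, (((M + Finsupp.single s 1 : σ →₀ ℕ) i).factorial : R) =
      (M s + 1) * ∏ i, ((M i).factorial : R) := by
    rw [← Finset.mul_prod_erase _ _ (Finset.mem_univ s),
      ← Finset.mul_prod_erase _ (fun i => ((M i).factorial : R)) (Finset.mem_univ s), ← mul_assoc]
    congr 1
    · simp [Nat.factorial_succ]
    · refine Finset.prod_congr rfl fun i hi => ?_
      rw [Finsupp.add_apply, Finsupp.single_eq_of_ne (Finset.ne_of_mem_erase hi), add_zero]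
  suffices h : diffPairing.flip Q ∘ₗ LinearMap.mulLeft R (X s) = diffPairing.flip (pderiv s Q) from
    LinearMap.congr_fun h P
  refine (basisMonomials σ R).ext fun M => ?_
  rw [coe_basisMonomials, LinearMap.comp_apply, LinearMap.mulLeft_apply, X, monomial_mul, one_mul,
    add_comm, LinearMap.flip_apply, LinearMap.flip_apply, diffPairing_monomial,
    diffPairing_monomial, coeff_pderiv, hfactorial]
  ring

namespace IsDiffAdjoint

theorem one : IsDiffAdjoint (1 : MvPolynomial σ R) 1 := fun P Q => by
  rw [one_mul, Module.End.one_apply]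

theorem mul {p q : MvPolynomial σ R} {O O' : Module.End R (MvPolynomial σ R)}
    (h : IsDiffAdjoint p O) (h' : IsDiffAdjoint q O') : IsDiffAdjoint (p * q) (O * O') :=
  fun P Q => by rw [mul_comm p q, mul_assoc, h', h, Module.End.mul_apply]

theorem pow {p : MvPolynomial σ R} {O : Module.End R (MvPolynomial σ R)}
    (h : IsDiffAdjoint p O) (n : ℕ) : IsDiffAdjoint (p ^ n) (O ^ n) := by
  induction n with
  | zero => simpa only [pow_zero] using one
  | succ n ih => rw [pow_succ, pow_succ]; exact ih.mul h

theorem list_prod {ι : Type*} (l : List ι) {p : ι → MvPolynomial σ R}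
    {O : ι → Module.End R (MvPolynomial σ R)} (h : ∀ i, IsDiffAdjoint (p i) (O i)) :
    IsDiffAdjoint (l.map p).prod (l.map O).prod := by
  induction l with
  | nil => simpa only [List.map_nil, List.prod_nil] using one
  | cons i l ih => simpa only [List.map_cons, List.prod_cons] using (h i).mul ih

theorem sum_smul {ι : Type*} (s : Finset ι) {p : ι → MvPolynomial σ R}
    {O : ι → Module.End R (MvPolynomial σ R)} (c : ι → R) (h : ∀ i, IsDiffAdjoint (p i) (O i)) :
    IsDiffAdjoint (∑ i ∈ s, c i • p i) (∑ i ∈ s, c i • O i) := fun P Q => by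
  simp only [Finset.sum_mul, smul_mul_assoc, map_sum, map_smul, LinearMap.sum_apply,
    LinearMap.smul_apply, h _ P Q]

end IsDiffAdjoint

end DiffPairing

/-! ### Expansion of the trace of a tensor over closed walks -/

theorem sum_univ_pi_fin_succ {V M : Type*} [Fintype V] [AddCommMonoid M] {n : ℕ}
    (F : (Fin (n + 1) → V) → M) :
    ∑ w, F w = ∑ a, ∑ w : Fin n → V, F (Fin.cons a w) := by
  rw [← Fintype.sum_prod_type']
  exact (Fintype.sum_equiv (Fin.consEquiv fun _ => V) _ _ fun _ => rfl).symm

theorem matrix_pow_succ_apply {V R : Type*} [Fintype V] [DecidableEq V] [CommSemiring R]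
    (M : Matrix V V R) (n : ℕ) (i j : V) :
    (M ^ (n + 1)) i j = ∑ w : Fin n → V, ∏ t : Fin (n + 1),
      M ((Fin.cons i w : Fin (n + 1) → V) t) ((Fin.snoc w j : Fin (n + 1) → V) t) := by
  induction n generalizing i with
  | zero => simp [Fin.snoc]
  | succ n ih =>
    rw [pow_succ', Matrix.mul_apply, sum_univ_pi_fin_succ]
    refine Finset.sum_congr rfl fun a _ => ?_
    rw [ih, Finset.mul_sum]
    refine Finset.sum_congr rfl fun w _ => ?_
    rw [Fin.prod_univ_succ (n := n + 1), ← Fin.cons_snoc_eq_snoc_cons]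
    simp

theorem trace_matrix_pow {V R : Type*} [Fintype V] [DecidableEq V] [CommSemiring R]
    (M : Matrix V V R) {N : ℕ} (hN : 0 < N) :
    (M ^ N).trace = ∑ w : Fin N → V, ∏ t, M (w t) (w (finRotate N t)) := by
  obtain ⟨n, rfl⟩ := Nat.exists_eq_succ_of_ne_zero hN.ne'
  rw [sum_univ_pi_fin_succ]
  refine Finset.sum_congr rfl fun i _ => ?_
  simp only [Matrix.diag_apply, Nat.succ_eq_add_one, matrix_pow_succ_apply,
    Fin.snoc_eq_cons_rotate]

section TraceExpansion

variable {V R : Type*}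

/-- The number of terms of a sequence of roots that are equal to `i`. -/
def rootCount [DecidableEq V] {d : ℕ} (u : Fin d → V) (i : V) : ℕ := Fintype.card {r // u r = i}

/-- The number of rearrangements of a sequence of roots. -/
def arrangementCount [Fintype V] [DecidableEq V] {d : ℕ} (u : Fin d → V) : ℕ :=
  Fintype.card {u' : Fin d → V // rootCount u' = rootCount u}

/-- `σ` enumerates the arcs `u_r → β_{r,q}` as a closed walk. The pairs `(u_r, β_r)` are the
indices of the tensor entries multiplied in one term of the trace. -/
def IsCircuit {d κ : ℕ} (u : Fin d → V) (β : Fin d → Fin κ → V)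
    (σ : Fin (d * κ) ≃ Fin d × Fin κ) : Prop :=
  ∀ t, β (σ t).1 (σ t).2 = u (σ (finRotate _ t)).1

open Classical in
/-- The number of ways to enumerate the arcs `u_r → β_{r,q}` as a closed walk. -/
noncomputable def circuitCount {d κ : ℕ} (u : Fin d → V) (β : Fin d → Fin κ → V) : ℕ :=
  Fintype.card {σ : Fin (d * κ) ≃ Fin d × Fin κ // IsCircuit u β σ}

/-- The coefficient of `∏_r A_{u_r β_r}` in the trace of order `d` divided by `(k-1)^{n-1}`. The
trace sums over the multiset of roots, hence the division by the number of arrangements. -/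
noncomputable def circuitCoeff (R : Type*) [Field R] [Fintype V] [DecidableEq V] {d κ : ℕ}
    (u : Fin d → V) (β : Fin d → Fin κ → V) : R :=
  (arrangementCount u : R)⁻¹ * (∏ i, (((rootCount u i * κ).factorial : ℕ) : R)⁻¹) *
    (circuitCount u β : R)

/-- The trace of order `d` divided by `(k-1)^{n-1}`, as a sum over closed walks. -/
noncomputable def circuitSum {k : ℕ} [Field R] [Fintype V] [DecidableEq V] (A : KTensor k V R)
    (d : ℕ) : R :=
  ∑ u : Fin d → V, ∑ β : Fin d → Fin (k - 1) → V, circuitCoeff R u β * ∏ r, A (u r) (β r)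

theorem sum_rootCount [DecidableEq V] [Fintype V] {d : ℕ} (u : Fin d → V) :
    ∑ i, rootCount u i = d := by
  simp only [rootCount]
  rw [← Fintype.card_sigma, Fintype.card_congr (Equiv.sigmaFiberEquiv u), Fintype.card_fin]

theorem exists_rootCount_eq [DecidableEq V] [Fintype V] {d : ℕ} {f : V → ℕ} (hf : ∑ i, f i = d) :
    ∃ u : Fin d → V, rootCount u = f := by
  have e : Fin d ≃ Σ i, Fin (f i) := Fintype.equivOfCardEq (by simp [hf])
  refine ⟨fun r => (e r).1, funext fun i => ?_⟩
  rw [rootCount, ← Fintype.card_fin (f i)]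
  exact Fintype.card_congr ((e.subtypeEquiv (q := fun x => x.1 = i) fun _ => Iff.rfl).trans
    (Equiv.sigmaSubtype i))

theorem prod_comp_eq_prod_pow_rootCount [DecidableEq V] [Fintype V] [CommMonoid R] {d : ℕ}
    (u : Fin d → V) (g : V → R) : ∏ r, g (u r) = ∏ i, g i ^ rootCount u i := by
  rw [← Finset.prod_fiberwise_of_maps_to (g := u) (t := Finset.univ) (fun _ _ => Finset.mem_univ _)]
  refine Finset.prod_congr rfl fun i _ => ?_
  rw [Finset.prod_congr rfl (g := fun _ => g i) (fun r hr => by rw [(Finset.mem_filter.1 hr).2]),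
    Finset.prod_const, rootCount, Fintype.card_subtype]

theorem arrangementCount_pos [DecidableEq V] [Fintype V] {d : ℕ} (u : Fin d → V) :
    0 < arrangementCount u :=
  Fintype.card_pos_iff.2 ⟨⟨u, rfl⟩⟩

open MvPolynomial

/-- The polynomial whose differential operator is `rowOp A i`. -/
noncomputable def rowPoly {k : ℕ} [CommSemiring R] [Fintype V] (A : KTensor k V R) (i : V) :
    MvPolynomial (V × V) R :=
  ∑ β : Fin (k - 1) → V, A i β • ∏ q, X (i, β q)

theorem isDiffAdjoint_rowOp {k : ℕ} [CommSemiring R] [Fintype V] (A : KTensor k V R) (i : V) :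
    IsDiffAdjoint (rowPoly A i) (rowOp A i) := by
  refine IsDiffAdjoint.sum_smul _ _ fun β => ?_
  have h := IsDiffAdjoint.list_prod (List.finRange (k - 1))
    (fun q => isDiffAdjoint_pderiv (R := R) (i, β q))
  unfold rowDeriv
  rwa [← List.ofFn_eq_map, ← List.ofFn_eq_map, List.prod_ofFn] at h

theorem constantCoeff_prod_rowOp_pow {k : ℕ} [CommSemiring R] [Fintype V] (A : KTensor k V R)
    (f : V → ℕ) (Q : MvPolynomial (V × V) R) :
    constantCoeff (((Finset.univ : Finset V).toList.map fun i => rowOp A i ^ f i).prod Q) =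
      diffPairing (∏ i, rowPoly A i ^ f i) Q := by
  have h := IsDiffAdjoint.list_prod (Finset.univ : Finset V).toList
    (fun i => (isDiffAdjoint_rowOp A i).pow (f i)) 1 Q
  rw [mul_one, diffPairing_one, Finset.prod_map_toList] at h
  exact h.symm

theorem prod_rowPoly {k : ℕ} [CommSemiring R] [Fintype V] (A : KTensor k V R) {d : ℕ}
    (u : Fin d → V) :
    ∏ r, rowPoly A (u r) = ∑ β : Fin d → Fin (k - 1) → V,
      (∏ r, A (u r) (β r)) • ∏ r, ∏ q, X (u r, β r q) := by
  classical
  simp only [rowPoly, Fintype.prod_sum, Finset.prod_smul]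

/-- A monomial of `tr (X ^ N)` is a closed walk, and it pairs with a product of variables to the
number of ways to match its arcs with these variables. -/
theorem diffPairing_trace_pow [CommSemiring R] [DecidableEq V] [Fintype V] {d κ : ℕ}
    (hN : 0 < d * κ) (u : Fin d → V) (β : Fin d → Fin κ → V) :
    diffPairing (∏ r, ∏ q, X (u r, β r q)) (Matrix.mvPolynomialX V V R ^ (d * κ)).trace =
      (circuitCount u β : R) := by
  classical
  rw [trace_matrix_pow _ hN, map_sum,
    ← Fintype.prod_prod_type' (f := fun r q => (X (u r, β r q) : MvPolynomial (V × V) R))]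
  simp only [Matrix.mvPolynomialX_apply]
  have hpair (w : Fin (d * κ) → V) :
      diffPairing (∏ x : Fin d × Fin κ, X (u x.1, β x.1 x.2))
        (∏ t, (X (w t, w (finRotate _ t)) : MvPolynomial (V × V) R)) =
      (Fintype.card {σ : Fin (d * κ) ≃ Fin d × Fin κ //
        ∀ t, (w t, w (finRotate _ t)) = (u (σ t).1, β (σ t).1 (σ t).2)} : R) := by
    convert diffPairing_prod_X_prod_X (R := R) (fun t => (w t, w (finRotate _ t)))
      (fun x : Fin d × Fin κ => (u x.1, β x.1 x.2))
  rw [Finset.sum_congr rfl fun w _ => hpair w, ← Nat.cast_sum, ← Fintype.card_sigma]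
  congr 1
  refine Fintype.card_congr
    { toFun := fun x => ⟨x.2.1, fun t => ?_⟩
      invFun := fun σ => ⟨fun t => u (σ.1 t).1, σ.1, fun t => Prod.ext rfl (σ.2 t).symm⟩
      left_inv := ?_
      right_inv := fun _ => rfl }
  · exact (Prod.ext_iff.1 (x.2.2 t)).2.symm.trans (Prod.ext_iff.1 (x.2.2 (finRotate _ t))).1
  · rintro ⟨w, σ, h⟩
    obtain rfl : w = fun t => u (σ t).1 := funext fun t => (Prod.ext_iff.1 (h t)).1
    rfl

section

variable [Field R] [Fintype V] [DecidableEq V] {k : ℕ}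

theorem sum_circuitCoeff_mul_prod (hk : 2 ≤ k) (A : KTensor k V R) {d : ℕ} (hd : 0 < d)
    (u : Fin d → V) :
    ∑ β : Fin d → Fin (k - 1) → V, circuitCoeff R u β * ∏ r, A (u r) (β r) =
      (arrangementCount u : R)⁻¹ * ((∏ i, (((rootCount u i * (k - 1)).factorial : ℕ) : R)⁻¹) *
        diffPairing (∏ i, rowPoly A i ^ rootCount u i)
          (Matrix.mvPolynomialX V V R ^ (d * (k - 1))).trace) := by
  rw [← prod_comp_eq_prod_pow_rootCount u (rowPoly A), prod_rowPoly, map_sum, LinearMap.sum_apply,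
    Finset.mul_sum, Finset.mul_sum]
  refine Finset.sum_congr rfl fun β _ => ?_
  rw [map_smul, LinearMap.smul_apply, diffPairing_trace_pow (Nat.mul_pos hd (by omega)),
    circuitCoeff, smul_eq_mul]
  ring

theorem trace_eq_circuitSum [CharZero R] (hk : 2 ≤ k) (A : KTensor k V R) {d : ℕ} (hd : 0 < d) :
    trace A d = ((k - 1 : ℕ) : R) ^ (Fintype.card V - 1) * circuitSum A d := by
  unfold trace circuitSum
  congr 1
  rw [← Finset.sum_fiberwise_of_maps_to (g := rootCount) (t := Finset.piAntidiag Finset.univ d)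
    (s := (Finset.univ : Finset (Fin d → V)))
    (fun u _ => by simp [Finset.mem_piAntidiag, sum_rootCount])]
  refine Finset.sum_congr rfl fun f hf => ?_
  obtain ⟨u₀, rfl⟩ := exists_rootCount_eq (by simpa using (Finset.mem_piAntidiag.1 hf).1)
  have hcard : (Finset.univ.filter fun u : Fin d → V => rootCount u = rootCount u₀).card =
      arrangementCount u₀ := by
    rw [arrangementCount, Fintype.card_subtype]
  have hconst : ∀ u ∈ Finset.univ.filter fun u : Fin d → V => rootCount u = rootCount u₀,
      ∑ β, circuitCoeff R u β * ∏ r, A (u r) (β r) =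
        ∑ β, circuitCoeff R u₀ β * ∏ r, A (u₀ r) (β r) := fun u hu => by
    rw [sum_circuitCoeff_mul_prod hk A hd, sum_circuitCoeff_mul_prod hk A hd, arrangementCount,
      (Finset.mem_filter.1 hu).2, ← arrangementCount]
  rw [Finset.sum_congr rfl hconst, Finset.sum_const, hcard, nsmul_eq_mul,
    sum_circuitCoeff_mul_prod hk A hd, constantCoeff_prod_rowOp_pow,
    mul_inv_cancel_left₀ (Nat.cast_ne_zero.2 (arrangementCount_pos u₀).ne')]

theorem trace_zero (A : KTensor k V R) :
    trace A 0 = ((k - 1 : ℕ) : R) ^ (Fintype.card V - 1) * (Fintype.card V : R) := by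
  simp [trace, constantCoeff_prod_rowOp_pow, diffPairing_one]

end

end TraceExpansion

/-! ### Properties of the circuit coefficients -/

section Circuit

variable {V : Type*} {d κ : ℕ} {u : Fin d → V} {β : Fin d → Fin κ → V}
  {σ : Fin (d * κ) ≃ Fin d × Fin κ}

namespace IsCircuit

theorem head_mem_range (h : IsCircuit u β σ) (r : Fin d) (q : Fin κ) : β r q ∈ Set.range u := by
  have hnext := h (σ.symm (r, q))
  rw [Equiv.apply_symm_apply] at hnext
  exact ⟨_, hnext.symm⟩

theorem root_mem_of_closed (h : IsCircuit u β σ) (hκ : 0 < κ) {U : Set V}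
    (hU : ∀ r, u r ∈ U → ∀ q, β r q ∈ U) {r₀ : Fin d} (h₀ : u r₀ ∈ U) (r : Fin d) : u r ∈ U := by
  have hnext (t : Fin (d * κ)) (ht : u (σ t).1 ∈ U) : u (σ (finRotate _ t)).1 ∈ U := by
    rw [← h t]; exact hU _ ht _
  have : NeZero (d * κ) := ⟨Nat.mul_ne_zero (Nat.ne_zero_of_lt r.isLt) hκ.ne'⟩
  let t₀ := σ.symm (r₀, ⟨0, hκ⟩)
  have hlater (j : ℕ) : u (σ (t₀ + Fin.ofNat (d * κ) j)).1 ∈ U := by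
    induction j with
    | zero => simpa [t₀] using h₀
    | succ j ih =>
      have hj := hnext _ ih
      rw [finRotate_apply, add_assoc] at hj
      convert hj using 5
      apply Fin.ext
      simp [Fin.val_add]
  simpa using hlater (σ.symm (r, ⟨0, hκ⟩) - t₀).val

theorem sum_heads_eq_sum_roots {M : Type*} [AddCommMonoid M] (h : IsCircuit u β σ) (f : V → M) :
    ∑ r, ∑ q, f (β r q) = ∑ r, κ • f (u r) :=
  calc ∑ r, ∑ q, f (β r q) = ∑ t, f (β (σ t).1 (σ t).2) := by
        rw [← Fintype.sum_prod_type', ← σ.sum_comp]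
    _ = ∑ t, f (u (σ (finRotate _ t)).1) := Finset.sum_congr rfl fun t _ => by rw [h t]
    _ = ∑ t, f (u (σ t).1) := Equiv.sum_comp (finRotate (d * κ)) fun t => f (u (σ t).1)
    _ = ∑ r, κ • f (u r) := by
        rw [σ.sum_comp fun x => f (u x.1), Fintype.sum_prod_type]
        simp

end IsCircuit

theorem circuitCount_comp {W : Type*} {φ : V → W} (hφ : Function.Injective φ) (u : Fin d → V)
    (β : Fin d → Fin κ → V) : circuitCount (φ ∘ u) (fun r => φ ∘ β r) = circuitCount u β := by
  classical
  unfold circuitCount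
  refine Fintype.card_congr (Equiv.subtypeEquivRight fun σ => ?_)
  simp only [IsCircuit, Function.comp, hφ.eq_iff]

theorem circuitCount_pos_iff : 0 < circuitCount u β ↔ ∃ σ, IsCircuit u β σ := by
  classical
  rw [circuitCount, Fintype.card_pos_iff, nonempty_subtype]

theorem circuitCount_const (i : V) :
    circuitCount (fun _ : Fin d => i) (fun _ (_ : Fin κ) => i) = (d * κ).factorial := by
  classical
  unfold circuitCount
  rw [Fintype.card_congr (Equiv.subtypeUnivEquiv
    (p := IsCircuit (fun _ : Fin d => i) (fun _ (_ : Fin κ) => i)) fun σ t => rfl),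
    Fintype.card_equiv finProdFinEquiv.symm, Fintype.card_fin]

end Circuit

section CircuitCoeff

variable {V W : Type*} [DecidableEq W] {d κ : ℕ} {φ : V → W}

theorem rootCount_eq_zero_iff (w : Fin d → W) (j : W) : rootCount w j = 0 ↔ j ∉ Set.range w := by
  rw [rootCount, Fintype.card_eq_zero_iff, isEmpty_subtype]
  simp

theorem rootCount_comp_of_notMem_range (u : Fin d → V) {j : W} (hj : j ∉ Set.range φ) :
    rootCount (φ ∘ u) j = 0 :=
  (rootCount_eq_zero_iff _ _).2 fun ⟨r, hr⟩ => hj ⟨u r, hr⟩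

theorem exists_comp_eq_of_rootCount_eq {u : Fin d → V} {w : Fin d → W}
    (h : rootCount w = rootCount (φ ∘ u)) : ∃ v, φ ∘ v = w := by
  have hr (r : Fin d) : ∃ v, φ v = w r := by
    by_contra hn
    have hw : rootCount w (w r) = 0 := by
      rw [h, rootCount_comp_of_notMem_range u fun ⟨v, hv⟩ => hn ⟨v, hv⟩]
    exact (rootCount_eq_zero_iff _ _).1 hw ⟨r, rfl⟩
  choose v hv using hr
  exact ⟨v, funext hv⟩

variable [DecidableEq V]

theorem rootCount_comp (hφ : Function.Injective φ) (u : Fin d → V) (i : V) :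
    rootCount (φ ∘ u) (φ i) = rootCount u i :=
  Fintype.card_congr (Equiv.subtypeEquivRight fun _ => hφ.eq_iff)

theorem rootCount_comp_eq_iff (hφ : Function.Injective φ) (u u' : Fin d → V) :
    rootCount (φ ∘ u) = rootCount (φ ∘ u') ↔ rootCount u = rootCount u' := by
  refine ⟨fun h => funext fun i => ?_, fun h => funext fun j => ?_⟩
  · rw [← rootCount_comp hφ, h, rootCount_comp hφ]
  · by_cases hj : j ∈ Set.range φ
    · obtain ⟨i, rfl⟩ := hj
      rw [rootCount_comp hφ, rootCount_comp hφ, h]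
    · rw [rootCount_comp_of_notMem_range u hj, rootCount_comp_of_notMem_range u' hj]

theorem rootCount_const (i j : V) : rootCount (fun _ : Fin d => i) j = if j = i then d else 0 := by
  split_ifs with h
  · subst h
    rw [rootCount, Fintype.card_congr (Equiv.subtypeUnivEquiv fun _ => rfl), Fintype.card_fin]
  · exact (rootCount_eq_zero_iff _ _).2 fun ⟨_, hr⟩ => h hr.symm

variable [Fintype V]

theorem arrangementCount_const (i : V) : arrangementCount (fun _ : Fin d => i) = 1 := by
  refine Fintype.card_eq_one_iff.2 ⟨⟨_, rfl⟩, fun u' => Subtype.ext (funext fun r => ?_)⟩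
  by_contra hne
  have h := congrFun u'.2 (u'.1 r)
  rw [rootCount_const, if_neg hne, rootCount_eq_zero_iff] at h
  exact h ⟨r, rfl⟩

theorem arrangementCount_comp [Fintype W] (hφ : Function.Injective φ) (u : Fin d → V) :
    arrangementCount (φ ∘ u) = arrangementCount u := by
  refine (Fintype.card_congr (Equiv.ofBijective (fun u' : {u' : Fin d → V //
    rootCount u' = rootCount u} => (⟨φ ∘ u'.1, (rootCount_comp_eq_iff hφ _ _).2 u'.2⟩ :
      {w : Fin d → W // rootCount w = rootCount (φ ∘ u)})) ⟨?_, ?_⟩)).symm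
  · exact fun a b hab => Subtype.ext (hφ.comp_left (Subtype.ext_iff.1 hab))
  · rintro ⟨w, hw⟩
    obtain ⟨v, rfl⟩ := exists_comp_eq_of_rootCount_eq hw
    exact ⟨⟨v, (rootCount_comp_eq_iff hφ _ _).1 hw⟩, rfl⟩

section Ordered

variable {R : Type*} [Field R] [LinearOrder R] [IsStrictOrderedRing R]

theorem circuitCoeff_nonneg (u : Fin d → V) (β : Fin d → Fin κ → V) : 0 ≤ circuitCoeff R u β := by
  unfold circuitCoeff; positivity

theorem IsCircuit.circuitCoeff_pos {u : Fin d → V} {β : Fin d → Fin κ → V}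
    {σ : Fin (d * κ) ≃ Fin d × Fin κ} (h : IsCircuit u β σ) : 0 < circuitCoeff R u β := by
  have hcircuit : 0 < circuitCount u β := circuitCount_pos_iff.2 ⟨σ, h⟩
  have harr := arrangementCount_pos u
  unfold circuitCoeff
  refine mul_pos (mul_pos (by positivity) (Finset.prod_pos fun i _ => ?_)) (by positivity)
  exact inv_pos.2 (Nat.cast_pos.2 (Nat.factorial_pos _))

end Ordered

variable {R : Type*} [Field R]

theorem exists_isCircuit_of_circuitCoeff_ne_zero {u : Fin d → V} {β : Fin d → Fin κ → V}
    (h : circuitCoeff R u β ≠ 0) : ∃ σ, IsCircuit u β σ := by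
  refine circuitCount_pos_iff.1 (Nat.pos_of_ne_zero fun h0 => h ?_)
  rw [circuitCoeff, h0, Nat.cast_zero, mul_zero]

theorem circuitCoeff_const [CharZero R] (i : V) :
    circuitCoeff R (fun _ : Fin d => i) (fun _ (_ : Fin κ) => i) = 1 := by
  rw [circuitCoeff, circuitCount_const, arrangementCount_const, Finset.prod_eq_single i]
  · rw [rootCount_const, if_pos rfl, Nat.cast_one, inv_one, one_mul]
    exact inv_mul_cancel₀ (Nat.cast_ne_zero.2 (Nat.factorial_ne_zero _))
  · intro j _ hj
    rw [rootCount_const, if_neg hj, zero_mul, Nat.factorial_zero, Nat.cast_one, inv_one]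
  · exact fun hi => absurd (Finset.mem_univ i) hi

theorem circuitCoeff_comp [Fintype W] (hφ : Function.Injective φ) (u : Fin d → V)
    (β : Fin d → Fin κ → V) :
    circuitCoeff R (φ ∘ u) (fun r => φ ∘ β r) = circuitCoeff R u β := by
  unfold circuitCoeff
  rw [circuitCount_comp hφ, arrangementCount_comp hφ]
  congr 2
  refine (Fintype.prod_of_injective φ hφ _ _ (fun j hj => ?_) fun i => ?_).symm
  · rw [rootCount_comp_of_notMem_range u hj, zero_mul, Nat.factorial_zero, Nat.cast_one, inv_one]
  · rw [rootCount_comp hφ]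

theorem circuitSum_eq_of_injective [Fintype W] {k : ℕ} (hφ : Function.Injective φ)
    (A : KTensor k V R) (B : KTensor k W R) (hAB : ∀ i β, B (φ i) (φ ∘ β) = A i β)
    (hB : ∀ i β, B i β ≠ 0 → i ∈ Set.range φ ∧ ∀ q, β q ∈ Set.range φ) (d : ℕ) :
    circuitSum A d = circuitSum B d := by
  unfold circuitSum
  rw [← Fintype.sum_prod_type', ← Fintype.sum_prod_type']
  refine Fintype.sum_of_injective
    (fun x : (Fin d → V) × (Fin d → Fin (k - 1) → V) => (φ ∘ x.1, fun r => φ ∘ x.2 r))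
    ?_ _ _ ?_ ?_
  · rintro ⟨u, β⟩ ⟨u', β'⟩ h
    obtain ⟨hu, hβ⟩ := Prod.ext_iff.1 h
    exact Prod.ext (hφ.comp_left hu) (funext fun r => hφ.comp_left (congrFun hβ r))
  · rintro ⟨u, β⟩ h
    by_contra hne
    have hentry (r : Fin d) : B (u r) (β r) ≠ 0 := fun hr =>
      hne (mul_eq_zero_of_right _ (Finset.prod_eq_zero (Finset.mem_univ r) hr))
    choose v hv using fun r => (hB _ _ (hentry r)).1
    choose γ hγ using fun r => (hB _ _ (hentry r)).2
    exact h ⟨(v, γ), Prod.ext (funext hv) (funext fun r => funext fun q => hγ r q)⟩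
  · rintro ⟨u, β⟩
    simp only [circuitCoeff_comp hφ]
    congr 1
    exact Finset.prod_congr rfl fun r _ => (hAB _ _).symm

theorem sum_circuitCoeff_mul_prod_const [CharZero R] {k : ℕ} (A : KTensor k V R) (i : V) :
    ∑ β : Fin d → Fin (k - 1) → V, circuitCoeff R (fun _ : Fin d => i) β * ∏ r, A i (β r) =
      A i (fun _ => i) ^ d := by
  rw [Finset.sum_eq_single fun _ _ => i]
  · rw [circuitCoeff_const i, one_mul, Finset.prod_const, Finset.card_univ, Fintype.card_fin]
  · intro β _ hβ
    by_contra hne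
    obtain ⟨σ, hσ⟩ := exists_isCircuit_of_circuitCoeff_ne_zero (left_ne_zero_of_mul hne)
    refine hβ (funext fun r => funext fun q => ?_)
    obtain ⟨_, h⟩ := hσ.head_mem_range r q
    exact h.symm
  · exact fun h => absurd (Finset.mem_univ _) h

theorem circuitSum_eq_add [CharZero R] {k : ℕ} (A : KTensor k V R) (hd : 0 < d) :
    circuitSum A d = ∑ i, A i (fun _ => i) ^ d +
      ∑ u : Fin d → V with ∀ i, u ≠ fun _ => i, ∑ β : Fin d → Fin (k - 1) → V,
        circuitCoeff R u β * ∏ r, A (u r) (β r) := by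
  classical
  have hinj : Function.Injective fun (i : V) (_ : Fin d) => i := fun i j h => congrFun h ⟨0, hd⟩
  have himg : (Finset.univ.filter fun u : Fin d → V => ∃ i, u = fun _ => i) =
      Finset.univ.image fun (i : V) (_ : Fin d) => i := by
    ext u; simp [eq_comm]
  unfold circuitSum
  rw [← Finset.sum_filter_add_sum_filter_not Finset.univ (fun u : Fin d → V => ∃ i, u = fun _ => i)]
  congr 1
  · rw [himg, Finset.sum_image hinj.injOn]
    exact Finset.sum_congr rfl fun i _ => sum_circuitCoeff_mul_prod_const A i
  · exact Finset.sum_congr (Finset.filter_congr fun u _ => by push Not; rfl) fun _ _ => rfl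

end CircuitCoeff

/-! ### Moments of low order -/

section AlphaTensor

variable {V W : Type*} {k : ℕ} {α : ℝ} {H : Hypergraph V} {H' : Hypergraph W}

theorem not_forall_eq_of_insert_range_mem (hk : 2 ≤ k) (hH : H.IsUniform k) {i : V}
    {β : Fin (k - 1) → V} (he : insert i (Set.range β) ∈ H.edgeSet) : ¬ ∀ q, β q = i := by
  intro hloop
  have hsub : insert i (Set.range β) ⊆ {i} := by
    rintro x (rfl | ⟨q, rfl⟩)
    exacts [rfl, hloop q]
  have hcard := Set.ncard_le_ncard hsub
  rw [hH _ he, Set.ncard_singleton] at hcard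
  omega

theorem alphaTensor_of_insert_range_mem (hk : 2 ≤ k) (hH : H.IsUniform k) {i : V}
    {β : Fin (k - 1) → V} (he : insert i (Set.range β) ∈ H.edgeSet) :
    H.alphaTensor k α i β = (1 - α) * (1 / ((k - 1).factorial : ℝ)) := by
  rw [alphaTensor, degTensor, adjTensor, if_neg (not_forall_eq_of_insert_range_mem hk hH he),
    if_pos he, mul_zero, zero_add]

theorem alphaTensor_of_forall_eq (hk : 2 ≤ k) (hH : H.IsUniform k) {i : V} {β : Fin (k - 1) → V}
    (hloop : ∀ q, β q = i) : H.alphaTensor k α i β = α * H.degree i := by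
  rw [alphaTensor, degTensor, adjTensor, if_pos hloop,
    if_neg fun he => not_forall_eq_of_insert_range_mem hk hH he hloop, mul_zero, add_zero]

theorem alphaTensor_eq_zero {i : V} {β : Fin (k - 1) → V} (hloop : ¬ ∀ q, β q = i)
    (he : insert i (Set.range β) ∉ H.edgeSet) : H.alphaTensor k α i β = 0 := by
  rw [alphaTensor, degTensor, adjTensor, if_neg hloop, if_neg he, mul_zero, mul_zero, add_zero]

theorem exists_mem_edgeSet_of_alphaTensor_ne_zero {i : V} {β : Fin (k - 1) → V}
    (h : H.alphaTensor k α i β ≠ 0) : ∃ e ∈ H.edgeSet, insert i (Set.range β) ⊆ e := by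
  by_cases he : insert i (Set.range β) ∈ H.edgeSet
  · exact ⟨_, he, subset_rfl⟩
  have hloop : ∀ q, β q = i := by
    by_contra hloop
    exact h (alphaTensor_eq_zero hloop he)
  have hdeg : H.degree i ≠ 0 := fun h0 => h (by simp [alphaTensor, degTensor, adjTensor, he, h0])
  obtain ⟨e, he, hi⟩ := Set.nonempty_of_ncard_ne_zero hdeg
  exact ⟨e, he, Set.insert_subset hi (Set.range_subset_iff.2 fun q => (hloop q).symm ▸ hi)⟩

theorem degree_eq_of_injective {φ : V → W} (hφ : Function.Injective φ)
    (hE : H'.edgeSet = Set.image φ '' H.edgeSet) (v : V) : H'.degree (φ v) = H.degree v := by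
  unfold degree
  rw [← Set.ncard_image_of_injective _ (Set.image_injective.2 hφ)]
  congr 1
  ext e'
  simp only [hE, Set.mem_ofPred_eq, Set.mem_image]
  constructor
  · rintro ⟨⟨e, he, rfl⟩, hv⟩
    exact ⟨e, ⟨he, (hφ.mem_set_image).1 hv⟩, rfl⟩
  · rintro ⟨e, ⟨he, hv⟩, rfl⟩
    exact ⟨⟨e, he, rfl⟩, v, hv, rfl⟩

theorem alphaTensor_comp {φ : V → W} (hφ : Function.Injective φ)
    (hE : H'.edgeSet = Set.image φ '' H.edgeSet) (i : V) (β : Fin (k - 1) → V) :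
    H'.alphaTensor k α (φ i) (φ ∘ β) = H.alphaTensor k α i β := by
  classical
  have himage : insert (φ i) (Set.range (φ ∘ β)) = φ '' insert i (Set.range β) := by
    rw [Set.image_insert_eq, Set.range_comp]
  have hadj : H'.adjTensor k (φ i) (φ ∘ β) = H.adjTensor k i β := by
    simp only [adjTensor, himage, hE, (Set.image_injective.2 hφ).mem_set_image]
  have hdeg : H'.degTensor k (φ i) (φ ∘ β) = H.degTensor k i β := by
    simp only [degTensor, Function.comp_apply, hφ.eq_iff, degree_eq_of_injective hφ hE]
  rw [alphaTensor, hadj, hdeg, alphaTensor]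

theorem circuitSum_alphaTensor_eq_of_injective [Fintype V] [DecidableEq V] [Fintype W]
    [DecidableEq W] {φ : V → W} (hφ : Function.Injective φ)
    (hE : H'.edgeSet = Set.image φ '' H.edgeSet) (k : ℕ) (α : ℝ) (d : ℕ) :
    circuitSum (H.alphaTensor k α) d = circuitSum (H'.alphaTensor k α) d := by
  refine circuitSum_eq_of_injective hφ _ _ (alphaTensor_comp hφ hE) (fun i β h => ?_) d
  obtain ⟨e', he', hsub⟩ := exists_mem_edgeSet_of_alphaTensor_ne_zero h
  rw [hE] at he'
  obtain ⟨e, -, rfl⟩ := he'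
  have hrange := hsub.trans (Set.image_subset_range _ _)
  exact ⟨hrange (Set.mem_insert _ _), fun q => hrange (Set.mem_insert_of_mem _ ⟨q, rfl⟩)⟩

section Moment

variable [Fintype V] [DecidableEq V]

theorem moment_zero (k : ℕ) (α : ℝ) (H : Hypergraph V) :
    H.moment k α 0 = ((k - 1 : ℕ) : ℝ) ^ (Fintype.card V - 1) * (Fintype.card V : ℝ) :=
  trace_zero _

theorem moment_eq_circuitSum (hk : 2 ≤ k) (α : ℝ) (H : Hypergraph V) {d : ℕ} (hd : 0 < d) :
    H.moment k α d =
      ((k - 1 : ℕ) : ℝ) ^ (Fintype.card V - 1) * circuitSum (H.alphaTensor k α) d :=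
  trace_eq_circuitSum hk _ hd

variable [Fintype W] [DecidableEq W]

theorem momentEq_of_iso (h : H.Iso H') (hk : 2 ≤ k) (α : ℝ) : H.MomentEq k α H' := by
  obtain ⟨φ, rfl⟩ := h
  have hcard := Fintype.card_congr φ
  refine ⟨hcard, fun d _ => ?_⟩
  rcases Nat.eq_zero_or_pos d with rfl | hd
  · rw [moment_zero, moment_zero, hcard]
  · rw [moment_eq_circuitSum hk α _ hd, moment_eq_circuitSum hk α _ hd, hcard,
      circuitSum_alphaTensor_eq_of_injective (H' := H.image φ) φ.injective rfl]

end Moment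

theorem sum_degree [Fintype V] (hH : H.IsUniform k) :
    ∑ v, H.degree v = k * H.edgeSet.ncard := by
  classical
  have hdegree (v : V) : H.degree v = ∑ e : Set V with e ∈ H.edgeSet, if v ∈ e then 1 else 0 := by
    rw [← Finset.card_filter, Finset.filter_filter, degree, ← Set.ncard_coe_finset]
    simp
  have hncard : H.edgeSet.ncard = ({e | e ∈ H.edgeSet} : Finset (Set V)).card := by
    rw [← Set.ncard_coe_finset]; simp
  simp only [hdegree]
  rw [Finset.sum_comm, hncard, mul_comm, ← smul_eq_mul, ← Finset.sum_const]
  refine Finset.sum_congr rfl fun e he => ?_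
  rw [← hH e (by simpa using he), ← Finset.card_filter, ← Set.ncard_coe_finset]
  simp

theorem degree_eq_card_filter [Fintype V] (hH : H.IsUniform 2) (v : V)
    [DecidablePred fun w => v ≠ w ∧ {v, w} ∈ H.edgeSet] :
    H.degree v = (Finset.univ.filter fun w => v ≠ w ∧ {v, w} ∈ H.edgeSet).card := by
  rw [degree, ← Set.ncard_coe_finset, ← Set.InjOn.ncard_image (f := fun w => ({v, w} : Set V))]
  · congr 1
    ext e
    simp only [Set.mem_ofPred_eq, Finset.coe_filter, Finset.mem_univ, true_and, Set.mem_image]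
    constructor
    · rintro ⟨he, hv⟩
      obtain ⟨x, y, hxy, rfl⟩ := Set.ncard_eq_two.1 (hH e he)
      rcases hv with rfl | rfl
      · exact ⟨y, ⟨hxy, he⟩, rfl⟩
      · exact ⟨x, ⟨hxy.symm, Set.pair_comm x v ▸ he⟩, Set.pair_comm v x⟩
    · rintro ⟨w, ⟨_, h⟩, rfl⟩
      exact ⟨h, Set.mem_insert _ _⟩
  · intro w hw w' _ (h : ({v, w} : Set V) = {v, w'})
    have hw' : w ∈ ({v, w'} : Set V) := h ▸ Set.mem_insert_of_mem _ rfl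
    simp only [Finset.coe_filter, Set.mem_ofPred_eq] at hw
    exact hw'.resolve_left fun h => hw.2.1 h.symm

theorem circuitSum_alphaTensor_one [Fintype V] [DecidableEq V] (hk : 2 ≤ k) (α : ℝ)
    (hH : H.IsUniform k) :
    circuitSum (H.alphaTensor k α) 1 = α * (k * H.edgeSet.ncard : ℕ) := by
  rw [circuitSum_eq_add _ Nat.one_pos, Finset.filter_false_of_mem, Finset.sum_empty, add_zero,
    ← sum_degree hH, Nat.cast_sum, Finset.mul_sum]
  · exact Finset.sum_congr rfl fun i _ => by
      rw [pow_one, alphaTensor_of_forall_eq hk hH fun _ => rfl]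
  · intro u _ h
    exact h (u 0) (funext fun r => by rw [Subsingleton.elim r 0])

end AlphaTensor

section Digon

variable {V : Type*} {u : Fin 2 → V}

theorem forall_ne_const_iff : (∀ i, u ≠ fun _ => i) ↔ u 0 ≠ u 1 := by
  constructor
  · exact fun h h01 => h (u 0) (funext fun r => by fin_cases r <;> simp [h01])
  · rintro h i rfl
    exact h rfl

theorem IsCircuit.exists_head_eq {κ : ℕ} (hκ : 0 < κ) (hu : u 0 ≠ u 1) {β : Fin 2 → Fin κ → V}
    {σ : Fin (2 * κ) ≃ Fin 2 × Fin κ} (h : IsCircuit u β σ) (r : Fin 2) :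
    ∃ q, β r q = u (finRotate 2 r) := by
  have hne : u (finRotate 2 r) ≠ u r := by fin_cases r <;> simp [hu, hu.symm]
  have hcases : ∀ s : Fin 2, s = r ∨ s = finRotate 2 r := by fin_cases r <;> decide
  by_contra! hq
  have hr (q : Fin κ) : β r q = u r := by
    obtain ⟨s, hs⟩ := h.head_mem_range r q
    rcases hcases s with rfl | rfl
    · exact hs.symm
    · exact absurd hs.symm (hq q)
  refine hne (h.root_mem_of_closed hκ (U := {u r}) (fun s hs q => ?_) (r₀ := r) rfl _)
  rcases hcases s with rfl | rfl
  · exact hr q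
  · exact absurd hs hne

/-- The circuit coefficient of a pair of opposite arcs. -/
noncomputable def digonCoeff (R : Type*) [Field R] : R :=
  circuitCoeff R (fun r : Fin 2 => r) (fun r (_ : Fin 1) => finRotate 2 r)

variable [Fintype V] [DecidableEq V]

theorem circuitCoeff_digon (R : Type*) [Field R] (hu : u 0 ≠ u 1) :
    circuitCoeff R u (fun r (_ : Fin 1) => u (finRotate 2 r)) = digonCoeff R := by
  have hinj : Function.Injective u := by
    intro a b h
    fin_cases a <;> fin_cases b <;> simp_all
  exact circuitCoeff_comp hinj (fun r : Fin 2 => r) (fun r (_ : Fin 1) => finRotate 2 r)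

theorem sum_circuitCoeff_mul_prod_digon {R : Type*} [Field R] (A : KTensor 2 V R)
    (hu : u 0 ≠ u 1) :
    ∑ β : Fin 2 → Fin (2 - 1) → V, circuitCoeff R u β * ∏ r, A (u r) (β r) =
      digonCoeff R * (A (u 0) (fun _ => u 1) * A (u 1) (fun _ => u 0)) := by
  rw [Finset.sum_eq_single fun r _ => u (finRotate 2 r), Fin.prod_univ_two]
  · exact congrArg (· * _) (circuitCoeff_digon R hu)
  · intro β _ hβ
    by_contra hne
    obtain ⟨σ, hσ⟩ := exists_isCircuit_of_circuitCoeff_ne_zero (left_ne_zero_of_mul hne)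
    refine hβ (funext fun r => funext fun q => ?_)
    obtain ⟨q', hq'⟩ := hσ.exists_head_eq Nat.one_pos hu r
    rw [← hq', Fin.ext (by omega : q.val = q'.val)]
  · exact fun h => absurd (Finset.mem_univ _) h

variable {k : ℕ} {H : Hypergraph V}

/-- The heads of the arcs leaving `u 0` lie in `{u 0, u 1}`, which is too small for a hyperedge. -/
theorem circuitCoeff_mul_prod_alphaTensor_eq_zero (hk : 3 ≤ k) (α : ℝ) (hH : H.IsUniform k)
    (hu : u 0 ≠ u 1) (β : Fin 2 → Fin (k - 1) → V) :
    circuitCoeff ℝ u β * ∏ r, H.alphaTensor k α (u r) (β r) = 0 := by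
  by_contra hne
  obtain ⟨σ, hσ⟩ := exists_isCircuit_of_circuitCoeff_ne_zero (left_ne_zero_of_mul hne)
  obtain ⟨q, hq⟩ := hσ.exists_head_eq (by omega) hu 0
  have hloop : ¬ ∀ q, β 0 q = u 0 := fun h => by
    rw [h q] at hq
    exact hu (by simpa using hq)
  have hedge : insert (u 0) (Set.range (β 0)) ∈ H.edgeSet := by
    by_contra hn
    exact Finset.prod_ne_zero_iff.1 (right_ne_zero_of_mul hne) 0 (Finset.mem_univ _)
      (alphaTensor_eq_zero hloop hn)
  have hsub : insert (u 0) (Set.range (β 0)) ⊆ {u 0, u 1} := by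
    rintro x (rfl | ⟨q, rfl⟩)
    · exact Set.mem_insert _ _
    · obtain ⟨s, hs⟩ := hσ.head_mem_range 0 q
      rw [← hs]
      fin_cases s <;> simp
  have hcard := Set.ncard_le_ncard hsub
  rw [hH _ hedge, Set.ncard_pair hu] at hcard
  omega

theorem sum_nonconst_circuitCoeff_mul_prod_graph (α : ℝ) (hH : H.IsUniform 2) :
    ∑ u : Fin 2 → V with ∀ i, u ≠ fun _ => i, ∑ β : Fin 2 → Fin (2 - 1) → V,
        circuitCoeff ℝ u β * ∏ r, H.alphaTensor 2 α (u r) (β r) =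
      digonCoeff ℝ * (1 - α) ^ 2 * (2 * H.edgeSet.ncard : ℕ) := by
  classical
  have hentry (v w : V) (hvw : v ≠ w) :
      H.alphaTensor 2 α v (fun _ => w) = if {v, w} ∈ H.edgeSet then 1 - α else 0 := by
    have hrange : insert v (Set.range fun _ : Fin (2 - 1) => w) = {v, w} := by
      rw [Set.range_const]
    split_ifs with he
    · rw [alphaTensor_of_insert_range_mem le_rfl hH (hrange.symm ▸ he)]
      simp
    · exact alphaTensor_eq_zero (fun h => hvw (h 0).symm) (hrange.symm ▸ he)
  have hdigon (u : Fin 2 → V) (hu : u 0 ≠ u 1) : ∑ β : Fin 2 → Fin (2 - 1) → V,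
      circuitCoeff ℝ u β * ∏ r, H.alphaTensor 2 α (u r) (β r) =
        if {u 0, u 1} ∈ H.edgeSet then digonCoeff ℝ * (1 - α) ^ 2 else 0 := by
    rw [sum_circuitCoeff_mul_prod_digon _ hu, hentry _ _ hu, hentry _ _ hu.symm,
      Set.pair_comm (u 1) (u 0)]
    split_ifs <;> simp [sq]
  simp only [forall_ne_const_iff]
  rw [Finset.sum_congr rfl fun u hu => hdigon u (Finset.mem_filter.1 hu).2, Finset.sum_filter,
    ← (finTwoArrowEquiv V).symm.sum_comp, Fintype.sum_prod_type, ← sum_degree hH,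
    Nat.cast_sum, Finset.mul_sum]
  refine Finset.sum_congr rfl fun v _ => ?_
  rw [degree_eq_card_filter hH, Finset.card_filter, Nat.cast_sum, Finset.mul_sum]
  refine Finset.sum_congr rfl fun w _ => ?_
  by_cases hvw : v = w <;> by_cases he : {v, w} ∈ H.edgeSet <;> simp [hvw, he]

theorem circuitSum_alphaTensor_two (hk : 2 ≤ k) (α : ℝ) (hH : H.IsUniform k) :
    circuitSum (H.alphaTensor k α) 2 = α ^ 2 * (∑ v, H.degree v ^ 2 : ℕ) +
      if k = 2 then digonCoeff ℝ * (1 - α) ^ 2 * (k * H.edgeSet.ncard : ℕ) else 0 := by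
  rw [circuitSum_eq_add _ Nat.two_pos]
  congr 1
  · push_cast
    rw [Finset.mul_sum]
    exact Finset.sum_congr rfl fun i _ => by
      rw [alphaTensor_of_forall_eq hk hH fun _ => rfl, mul_pow]
  · split_ifs with hk2
    · subst hk2
      exact sum_nonconst_circuitCoeff_mul_prod_graph α hH
    · refine Finset.sum_eq_zero fun u hu => Finset.sum_eq_zero fun β _ => ?_
      exact circuitCoeff_mul_prod_alphaTensor_eq_zero (by omega) α hH
        (forall_ne_const_iff.1 (Finset.mem_filter.1 hu).2) β

end Digon

/-! ### Spiders: starlike hypertrees inside a common vertex set -/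

/-- The vertices of `r` arms with `D` hyperedges each, all starting at the vertex `none`. The
starlike hypertrees to be compared are drawn on this one vertex set, so that their trace expansions
can be compared term by term. -/
abbrev SpiderVertex (k r D : ℕ) : Type := Option (Fin r × Fin D × Fin (k - 1))

section Spider

variable {k r D : ℕ}

/-- The `j`-th hyperedge of arm `a`, with the conventions of `Hypergraph.starlikeEdge`. -/
def spiderEdge (k : ℕ) {r D : ℕ} (a : Fin r) (j : Fin D) : Set (SpiderVertex k r D) :=
  {v | (v = none ∧ j.val = 0) ∨ (∃ x, v = some (a, j, x)) ∨
    ∃ (i : Fin D) (x : Fin (k - 1)), v = some (a, i, x) ∧ i.val + 1 = j.val ∧ x.val + 2 = k}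

/-- The starlike hypergraph in which arm `a` has `len a` hyperedges; the remaining vertices are
isolated. -/
def spider (k : ℕ) {r D : ℕ} (len : Fin r → ℕ) : Hypergraph (SpiderVertex k r D) where
  vertexSet := Set.univ
  edgeSet := {e | ∃ (a : Fin r) (j : Fin D), j.val < len a ∧ e = spiderEdge k a j}
  subset_vertexSet_of_mem_edgeSet' := fun _ _ => Set.subset_univ _

theorem none_mem_spiderEdge {a : Fin r} {j : Fin D} :
    (none : SpiderVertex k r D) ∈ spiderEdge k a j ↔ j.val = 0 := by
  simp [spiderEdge]

theorem some_mem_spiderEdge {a b : Fin r} {i j : Fin D} {x : Fin (k - 1)} :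
    (some (b, i, x) : SpiderVertex k r D) ∈ spiderEdge k a j ↔
      b = a ∧ (i = j ∨ (i.val + 1 = j.val ∧ x.val + 2 = k)) := by
  simp only [spiderEdge, Set.mem_ofPred_eq, reduceCtorEq, false_and, false_or, Option.some.injEq,
    Prod.mk.injEq]
  constructor
  · rintro (⟨y, rfl, rfl, rfl⟩ | ⟨i', y, ⟨rfl, rfl, rfl⟩, h⟩)
    · exact ⟨rfl, Or.inl rfl⟩
    · exact ⟨rfl, Or.inr h⟩
  · rintro ⟨rfl, rfl | h⟩
    · exact Or.inl ⟨x, rfl, rfl, rfl⟩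
    · exact Or.inr ⟨i, x, ⟨rfl, rfl, rfl⟩, h⟩

theorem some_mem_spiderEdge_self (a : Fin r) (j : Fin D) (x : Fin (k - 1)) :
    (some (a, j, x) : SpiderVertex k r D) ∈ spiderEdge k a j :=
  some_mem_spiderEdge.2 ⟨rfl, Or.inl rfl⟩

theorem exists_mem_spiderEdge_of_succ_eq (hk : 2 ≤ k) (a : Fin r) {i j : Fin D}
    (hij : i.val + 1 = j.val) :
    ∃ v : SpiderVertex k r D, v ∈ spiderEdge k a i ∧ v ∈ spiderEdge k a j :=
  ⟨some (a, i, ⟨k - 2, by omega⟩), some_mem_spiderEdge_self a i _,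
    some_mem_spiderEdge.2 ⟨rfl, Or.inr ⟨hij, Nat.sub_add_cancel hk⟩⟩⟩

theorem spiderEdge_inj (hk : 2 ≤ k) {a b : Fin r} {i j : Fin D} :
    (spiderEdge k a i : Set (SpiderVertex k r D)) = spiderEdge k b j ↔ a = b ∧ i = j := by
  refine ⟨fun h => ?_, fun h => by rw [h.1, h.2]⟩
  have hij := some_mem_spiderEdge.1 (h ▸ some_mem_spiderEdge_self a i ⟨0, by omega⟩)
  have hji := some_mem_spiderEdge.1 (h.symm ▸ some_mem_spiderEdge_self b j ⟨0, by omega⟩)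
  refine ⟨hij.1, Fin.ext ?_⟩
  simp only [Fin.ext_iff] at hij hji
  omega

theorem spiderEdge_mem_edgeSet_iff (hk : 2 ≤ k) {len : Fin r → ℕ} {a : Fin r} {j : Fin D} :
    spiderEdge k a j ∈ (spider k len).edgeSet ↔ j.val < len a := by
  constructor
  · rintro ⟨b, i, hi, h⟩
    obtain ⟨rfl, rfl⟩ := (spiderEdge_inj hk).1 h
    exact hi
  · exact fun h => ⟨a, j, h, rfl⟩

theorem exists_spiderEdge_eq_insert (hk : 2 ≤ k) (a : Fin r) (j : Fin D) :
    ∃ b : SpiderVertex k r D, (∀ x, b ≠ some (a, j, x)) ∧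
      spiderEdge k a j = insert b (Set.range fun x => some (a, j, x)) := by
  by_cases hj : j.val = 0
  · refine ⟨none, fun x => by simp, Set.ext fun v => ?_⟩
    rcases v with _ | ⟨b, i, x⟩
    · simp [none_mem_spiderEdge, hj]
    · simp only [some_mem_spiderEdge, Set.mem_insert_iff, reduceCtorEq, Set.mem_range,
        Option.some.injEq, Prod.mk.injEq, false_or]
      constructor
      · rintro ⟨rfl, rfl | h⟩
        · exact ⟨x, rfl, rfl, rfl⟩
        · omega
      · rintro ⟨_, rfl, rfl, _⟩
        exact ⟨rfl, Or.inl rfl⟩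
  · refine ⟨some (a, ⟨j.val - 1, by omega⟩, ⟨k - 2, by omega⟩), fun x => ?_, Set.ext fun v => ?_⟩
    · simp only [ne_eq, Option.some.injEq, Prod.mk.injEq, Fin.ext_iff]
      omega
    · rcases v with _ | ⟨b, i, x⟩
      · simp [none_mem_spiderEdge, hj]
      · simp only [some_mem_spiderEdge, Set.mem_insert_iff, Set.mem_range,
          Option.some.injEq, Prod.mk.injEq, Fin.ext_iff]
        constructor
        · rintro ⟨h, hi | hi⟩
          · exact Or.inr ⟨x, h.symm, hi.symm, rfl⟩
          · exact Or.inl ⟨h, by omega, by omega⟩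
        · rintro (⟨h, hi, hx⟩ | ⟨_, h, hi, _⟩)
          · exact ⟨h, Or.inr ⟨by omega, by omega⟩⟩
          · exact ⟨h.symm, Or.inl hi.symm⟩

theorem ncard_spiderEdge (hk : 2 ≤ k) (a : Fin r) (j : Fin D) : (spiderEdge k a j).ncard = k := by
  obtain ⟨b, hb, h⟩ := exists_spiderEdge_eq_insert hk a j
  rw [h, Set.ncard_insert_of_notMem (by rintro ⟨x, hx⟩; exact hb x hx.symm), ← Set.image_univ,
    Set.ncard_image_of_injective _ (fun x y hxy => by simpa using hxy), Set.ncard_univ,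
    Nat.card_eq_fintype_card, Fintype.card_fin]
  omega

theorem spider_isUniform (hk : 2 ≤ k) (len : Fin r → ℕ) :
    (spider k len : Hypergraph (SpiderVertex k r D)).IsUniform k := by
  rintro e ⟨a, j, _, rfl⟩
  exact ncard_spiderEdge hk a j

section Degree

variable {len len' : Fin r → ℕ} (v : SpiderVertex k r D)

theorem spider_degree_le
    (h : ∀ a (j : Fin D), v ∈ spiderEdge k a j → j.val < len a → j.val < len' a) :
    (spider k len).degree v ≤ (spider k len').degree v := by
  refine Set.ncard_le_ncard ?_ (Set.toFinite _)
  rintro e ⟨⟨a, j, hj, rfl⟩, hv⟩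
  exact ⟨⟨a, j, h a j hv hj, rfl⟩, hv⟩

theorem spider_degree_congr
    (h : ∀ a (j : Fin D), v ∈ spiderEdge k a j → (j.val < len a ↔ j.val < len' a)) :
    (spider k len).degree v = (spider k len').degree v :=
  le_antisymm (spider_degree_le v fun a j hv => (h a j hv).1)
    (spider_degree_le v fun a j hv => (h a j hv).2)

theorem spider_degree_lt (hk : 2 ≤ k)
    (h : ∀ a (j : Fin D), v ∈ spiderEdge k a j → j.val < len a → j.val < len' a)
    {a : Fin r} {j : Fin D} (hv : v ∈ spiderEdge k a j) (hlen : len a ≤ j.val)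
    (hlen' : j.val < len' a) : (spider k len).degree v < (spider k len').degree v := by
  refine Set.ncard_lt_ncard ⟨?_, fun hsub => ?_⟩ (Set.toFinite _)
  · rintro e ⟨⟨a, j, hj, rfl⟩, hv⟩
    exact ⟨⟨a, j, h a j hv hj, rfl⟩, hv⟩
  · exact hlen.not_gt ((spiderEdge_mem_edgeSet_iff hk).1
      (hsub ⟨(spiderEdge_mem_edgeSet_iff hk).2 hlen', hv⟩).1)

theorem spider_degree_pos {a : Fin r} {j : Fin D} (hv : v ∈ spiderEdge k a j) (h : j.val < len a) :
    0 < (spider k len).degree v :=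
  (Set.ncard_pos (Set.toFinite _)).2 ⟨_, ⟨a, j, h, rfl⟩, hv⟩

end Degree

/-- No hyperedge other than `e` crosses `U`. -/
def Separates (e : Set (SpiderVertex k r D)) (U : Set (SpiderVertex k r D)) : Prop :=
  ∀ (b : Fin r) (i : Fin D), spiderEdge k b i ≠ e →
    ∀ v ∈ spiderEdge k b i, ∀ w ∈ spiderEdge k b i, v ∈ U → w ∈ U

theorem Separates.compl {e U : Set (SpiderVertex k r D)} (h : Separates e U) : Separates e Uᶜ :=
  fun b i hne v hv w hw hvU hwU => hvU (h b i hne w hw v hv hwU)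

/-- The vertices of arm `a` beyond the attachment of its `j`-th hyperedge: the side of this
hyperedge away from the common vertex. -/
def beyond (k : ℕ) {r D : ℕ} (a : Fin r) (j : Fin D) : Set (SpiderVertex k r D) :=
  {v | ∃ (i : Fin D) (x : Fin (k - 1)), v = some (a, i, x) ∧ j.val ≤ i.val}

theorem some_mem_beyond {a b : Fin r} {i j : Fin D} {x : Fin (k - 1)} :
    (some (b, i, x) : SpiderVertex k r D) ∈ beyond k a j ↔ b = a ∧ j.val ≤ i.val := by
  simp only [beyond, Set.mem_ofPred_eq, Option.some.injEq, Prod.mk.injEq]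
  constructor
  · rintro ⟨i', x', ⟨rfl, rfl, rfl⟩, h⟩; exact ⟨rfl, h⟩
  · rintro ⟨rfl, h⟩; exact ⟨i, x, ⟨rfl, rfl, rfl⟩, h⟩

theorem separates_beyond (a : Fin r) (j : Fin D) : Separates (spiderEdge k a j) (beyond k a j) := by
  intro b i hne v hv w hw hvU
  obtain ⟨i', x, rfl, hi'⟩ := hvU
  obtain ⟨rfl, hv'⟩ := some_mem_spiderEdge.1 hv
  have hij : i.val ≠ j.val := fun h => hne (by rw [Fin.ext h])
  rcases w with _ | ⟨b', i'', y⟩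
  · rw [none_mem_spiderEdge] at hw
    rcases hv' with rfl | ⟨h, _⟩ <;> omega
  · obtain ⟨rfl, hw'⟩ := some_mem_spiderEdge.1 hw
    rw [some_mem_beyond]
    refine ⟨rfl, ?_⟩
    rcases hv' with rfl | ⟨h, _⟩ <;> rcases hw' with rfl | ⟨h', _⟩ <;> omega

/-- The new vertex `x` of the `j`-th hyperedge of arm `a`, together with everything attached to
it. -/
def branch (a : Fin r) (j : Fin D) (x : Fin (k - 1)) : Set (SpiderVertex k r D) :=
  {v | ∃ (i : Fin D) (y : Fin (k - 1)), v = some (a, i, y) ∧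
    ((i = j ∧ y = x) ∨ (j.val < i.val ∧ x.val + 2 = k))}

theorem separates_branch (a : Fin r) (j : Fin D) (x : Fin (k - 1)) :
    Separates (spiderEdge k a j) (branch a j x) := by
  intro b i hne v hv w hw hvU
  obtain ⟨i', y, rfl, hi'⟩ := hvU
  obtain ⟨rfl, hv'⟩ := some_mem_spiderEdge.1 hv
  have hij : i.val ≠ j.val := fun h => hne (by rw [Fin.ext h])
  rcases w with _ | ⟨b', i'', z⟩
  · rw [none_mem_spiderEdge] at hw
    rcases hv' with rfl | ⟨h, _⟩ <;> rcases hi' with ⟨rfl, _⟩ | ⟨h', _⟩ <;> omega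
  · obtain ⟨rfl, hw'⟩ := some_mem_spiderEdge.1 hw
    refine ⟨i'', z, rfl, ?_⟩
    simp only [Fin.ext_iff] at hv' hw' hi' ⊢
    omega

theorem mem_branch_iff_of_mem_spiderEdge {a : Fin r} {j : Fin D} {x : Fin (k - 1)}
    {w : SpiderVertex k r D} (hw : w ∈ spiderEdge k a j) :
    w ∈ branch a j x ↔ w = some (a, j, x) := by
  constructor
  · rintro ⟨i, y, rfl, ⟨rfl, rfl⟩ | ⟨hi, _⟩⟩
    · rfl
    · rcases (some_mem_spiderEdge.1 hw).2 with rfl | ⟨h, _⟩ <;> omega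
  · rintro rfl
    exact ⟨j, x, rfl, Or.inl ⟨rfl, rfl⟩⟩

theorem exists_separates (hk : 2 ≤ k) {a : Fin r} {j : Fin D} {v : SpiderVertex k r D}
    (hv : v ∈ spiderEdge k a j) :
    ∃ U, Separates (spiderEdge k a j) U ∧ ∀ w ∈ spiderEdge k a j, w ∈ U ↔ w = v := by
  obtain ⟨b, hb, hE⟩ := exists_spiderEdge_eq_insert hk a j
  rcases hE ▸ hv with rfl | ⟨x, rfl⟩
  · refine ⟨(beyond k a j)ᶜ, (separates_beyond a j).compl, fun w hw => ⟨fun hwU => ?_, ?_⟩⟩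
    · rcases hE ▸ hw with rfl | ⟨x, rfl⟩
      · rfl
      · exact absurd (some_mem_beyond.2 ⟨rfl, le_rfl⟩) hwU
    · rintro rfl ⟨i, y, rfl, hi⟩
      rcases (some_mem_spiderEdge.1 hv).2 with rfl | ⟨h, _⟩
      · exact hb y rfl
      · omega
  · exact ⟨branch a j x, separates_branch a j x, fun w hw => mem_branch_iff_of_mem_spiderEdge hw⟩

end Spider

/-! ### Closed walks in spiders -/

section OnEdge

variable {k r D : ℕ} {i : SpiderVertex k r D} {β : Fin (k - 1) → SpiderVertex k r D}
  {a b : Fin r} {j l : Fin D}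

/-- The vertices of the tensor index `(i, β)` are those of the `j`-th hyperedge of arm `a`. -/
def OnEdge (i : SpiderVertex k r D) (β : Fin (k - 1) → SpiderVertex k r D) (a : Fin r)
    (j : Fin D) : Prop :=
  insert i (Set.range β) = spiderEdge k a j

/-- The tensor index `(i, β)` is a loop or belongs to a hyperedge. All other entries of the weighted
tensors of spiders vanish. -/
def IsSpiderIndex (i : SpiderVertex k r D) (β : Fin (k - 1) → SpiderVertex k r D) : Prop :=
  (∀ q, β q = i) ∨ ∃ a j, OnEdge i β a j

theorem OnEdge.root_mem (h : OnEdge i β a j) : i ∈ spiderEdge k a j :=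
  h ▸ Set.mem_insert _ _

theorem OnEdge.head_mem (h : OnEdge i β a j) (q : Fin (k - 1)) : β q ∈ spiderEdge k a j :=
  h ▸ Set.mem_insert_of_mem _ ⟨q, rfl⟩

theorem OnEdge.unique (hk : 2 ≤ k) (h : OnEdge i β a j) (h' : OnEdge i β b l) :
    a = b ∧ j = l :=
  (spiderEdge_inj hk).1 (h.symm.trans h')

theorem OnEdge.not_loop (hk : 2 ≤ k) (h : OnEdge i β a j) : ¬ ∀ q, β q = i :=
  not_forall_eq_of_insert_range_mem hk (spider_isUniform hk fun _ => D) ⟨a, j, j.isLt, h⟩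

end OnEdge

namespace IsCircuit

variable {k r D N : ℕ} {u : Fin N → SpiderVertex k r D}
  {β : Fin N → Fin (k - 1) → SpiderVertex k r D} {σ : Fin (N * (k - 1)) ≃ Fin N × Fin (k - 1)}
  {a : Fin r} {j : Fin D}

/-- Count, with multiplicity, the heads and the roots of the walk in a set `U` that meets the
hyperedge in `v` only and is crossed by no other hyperedge: if `v` were never a root on the
hyperedge, each use of the hyperedge would contribute a head and no root. -/
theorem exists_onEdge_root_eq (h : IsCircuit u β σ) (hk : 2 ≤ k)
    (hspider : ∀ s, IsSpiderIndex (u s) (β s)) {s₀ : Fin N} (hs₀ : OnEdge (u s₀) (β s₀) a j)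
    {v : SpiderVertex k r D} (hv : v ∈ spiderEdge k a j) :
    ∃ s, OnEdge (u s) (β s) a j ∧ u s = v := by
  classical
  by_contra! hno
  obtain ⟨U, hsep, hU⟩ := exists_separates hk hv
  have hroot (s : Fin N) (hs : OnEdge (u s) (β s) a j) : u s ∉ U := fun hsU =>
    hno s hs ((hU _ hs.root_mem).1 hsU)
  refine (Finset.sum_lt_sum (s := Finset.univ) (fun s _ => ?_) ⟨s₀, Finset.mem_univ _, ?_⟩).ne'
    (h.sum_heads_eq_sum_roots fun w => if w ∈ U then 1 else 0)
  · rcases hspider s with hloop | ⟨b, i, hb⟩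
    · simp [hloop]
    · by_cases hbi : spiderEdge k b i = spiderEdge k a j
      · simp [hroot s (hb.trans hbi)]
      · have hhead (q : Fin (k - 1)) : β s q ∈ U ↔ u s ∈ U :=
          ⟨hsep b i hbi _ (hb.head_mem q) _ hb.root_mem,
            hsep b i hbi _ hb.root_mem _ (hb.head_mem q)⟩
        simp [hhead]
  · rw [if_neg (hroot s₀ hs₀), smul_zero, Finset.sum_pos_iff]
    obtain rfl | ⟨q, hq⟩ : v ∈ insert (u s₀) (Set.range (β s₀)) := hs₀.symm ▸ hv
    · exact absurd rfl (hno s₀ hs₀)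
    · exact ⟨q, Finset.mem_univ _, by simp [hq, (hU v hv).2 rfl]⟩

theorem exists_onEdge_of_mem_beyond (h : IsCircuit u β σ) (hk : 2 ≤ k)
    (hspider : ∀ s, IsSpiderIndex (u s) (β s)) {s₀ s₁ : Fin N} (h₀ : u s₀ ∉ beyond k a j)
    (h₁ : u s₁ ∈ beyond k a j) : ∃ s, OnEdge (u s) (β s) a j := by
  by_contra! hno
  refine h₀ (h.root_mem_of_closed (by omega) (fun s hs q => ?_) h₁ s₀)
  rcases hspider s with hloop | ⟨b, i, hb⟩
  · rwa [hloop q]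
  · exact separates_beyond a j b i (fun hE => hno s (hb.trans hE)) _ hb.root_mem _
      (hb.head_mem q) hs

theorem le_ncard_onEdge (h : IsCircuit u β σ) (hk : 2 ≤ k)
    (hspider : ∀ s, IsSpiderIndex (u s) (β s)) (huse : ∃ s, OnEdge (u s) (β s) a j) :
    k ≤ {s | OnEdge (u s) (β s) a j}.ncard := by
  obtain ⟨s₀, hs₀⟩ := huse
  calc k = (spiderEdge k a j : Set (SpiderVertex k r D)).ncard := (ncard_spiderEdge hk a j).symm
    _ ≤ (u '' {s | OnEdge (u s) (β s) a j}).ncard :=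
        Set.ncard_le_ncard (fun _ hv => h.exists_onEdge_root_eq hk hspider hs₀ hv) (Set.toFinite _)
    _ ≤ {s | OnEdge (u s) (β s) a j}.ncard := Set.ncard_image_le (Set.toFinite _)

theorem card_add_mul_le (h : IsCircuit u β σ) (hk : 2 ≤ k)
    (hspider : ∀ s, IsSpiderIndex (u s) (β s)) (huse : ∀ i ≤ j, ∃ s, OnEdge (u s) (β s) a i)
    (X : Finset (Fin N)) (hX : ∀ s ∈ X, ∀ i ≤ j, ¬ OnEdge (u s) (β s) a i) :
    X.card + k * (j.val + 1) ≤ N := by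
  classical
  let uses (i : Fin D) : Finset (Fin N) := {s | OnEdge (u s) (β s) a i}
  have hdisj : (Finset.Iic j : Set (Fin D)).PairwiseDisjoint uses := fun i _ i' _ hne =>
    Finset.disjoint_left.2 fun s hs hs' =>
      hne (OnEdge.unique hk (Finset.mem_filter.1 hs).2 (Finset.mem_filter.1 hs').2).2
  have hXuses : Disjoint X ((Finset.Iic j).biUnion uses) := by
    rw [Finset.disjoint_left]
    intro s hs hs'
    obtain ⟨i, hi, hsi⟩ := Finset.mem_biUnion.1 hs'
    exact hX s hs i (Finset.mem_Iic.1 hi) (Finset.mem_filter.1 hsi).2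
  have hcount : k * (j.val + 1) ≤ ((Finset.Iic j).biUnion uses).card := by
    rw [Finset.card_biUnion hdisj, mul_comm, ← Fin.card_Iic, ← smul_eq_mul]
    refine Finset.card_nsmul_le_sum _ _ _ fun i hi => ?_
    simpa [uses, Set.ncard_eq_toFinset_card'] using
      h.le_ncard_onEdge hk hspider (huse i (Finset.mem_Iic.1 hi))
  calc X.card + k * (j.val + 1) ≤ X.card + ((Finset.Iic j).biUnion uses).card := by gcongr
    _ = (X ∪ (Finset.Iic j).biUnion uses).card := (Finset.card_union_of_disjoint hXuses).symm
    _ ≤ N := by simpa using Finset.card_le_univ (X ∪ (Finset.Iic j).biUnion uses)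

end IsCircuit

section Weights

variable {k r D : ℕ} {α : ℝ} {len len' : Fin r → ℕ} {i : SpiderVertex k r D}
  {β : Fin (k - 1) → SpiderVertex k r D}

theorem alphaTensor_spider_of_onEdge (hk : 2 ≤ k) {a : Fin r} {j : Fin D} (h : OnEdge i β a j) :
    (spider k len).alphaTensor k α i β =
      if j.val < len a then (1 - α) * (1 / ((k - 1).factorial : ℝ)) else 0 := by
  have hmem : insert i (Set.range β) ∈ (spider k len).edgeSet ↔ j.val < len a := by
    rw [show insert i (Set.range β) = _ from h, spiderEdge_mem_edgeSet_iff hk]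
  split_ifs with hj
  · exact alphaTensor_of_insert_range_mem hk (spider_isUniform hk len) (hmem.2 hj)
  · exact alphaTensor_eq_zero (h.not_loop hk) fun he => hj (hmem.1 he)

theorem alphaTensor_spider_eq_zero (h : ¬ IsSpiderIndex i β) :
    (spider k len).alphaTensor k α i β = 0 :=
  alphaTensor_eq_zero (fun hloop => h (Or.inl hloop)) fun ⟨a, j, _, he⟩ => h (Or.inr ⟨a, j, he⟩)

theorem alphaTensor_spider_congr
    (h : ∀ a (j : Fin D), i ∈ spiderEdge k a j → (j.val < len a ↔ j.val < len' a)) :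
    (spider k len).alphaTensor k α i β = (spider k len').alphaTensor k α i β := by
  have hmem : insert i (Set.range β) ∈ (spider k len).edgeSet ↔
      insert i (Set.range β) ∈ (spider k len').edgeSet :=
    exists₂_congr fun a j => and_congr_left fun he => h a j (he ▸ Set.mem_insert _ _)
  rw [alphaTensor, alphaTensor, degTensor, degTensor, spider_degree_congr i h, adjTensor, adjTensor]
  by_cases he : insert i (Set.range β) ∈ (spider k len).edgeSet
  · rw [if_pos he, if_pos (hmem.1 he)]
  · rw [if_neg he, if_neg (mt hmem.2 he)]

theorem alphaTensor_spider_le (h0 : 0 ≤ α) (h1 : α ≤ 1)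
    (h : ∀ a (j : Fin D), i ∈ spiderEdge k a j → j.val < len a → j.val < len' a) :
    (spider k len).alphaTensor k α i β ≤ (spider k len').alphaTensor k α i β := by
  have hdeg : ((spider k len).degree i : ℝ) ≤ (spider k len').degree i :=
    Nat.cast_le.2 (spider_degree_le i h)
  have hmem : insert i (Set.range β) ∈ (spider k len).edgeSet →
      insert i (Set.range β) ∈ (spider k len').edgeSet :=
    fun ⟨a, j, hj, he⟩ => ⟨a, j, h a j (he ▸ Set.mem_insert _ _) hj, he⟩
  have h1' : 0 ≤ 1 - α := sub_nonneg.2 h1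
  unfold alphaTensor degTensor adjTensor
  gcongr ?_ + ?_
  · split_ifs <;> gcongr
  · refine mul_le_mul_of_nonneg_left ?_ h1'
    split_ifs with he he'
    exacts [le_rfl, absurd (hmem he) he', by positivity, le_rfl]

theorem alphaTensor_nonneg {V : Type*} (H : Hypergraph V) (h0 : 0 ≤ α) (h1 : α ≤ 1) (i : V)
    (β : Fin (k - 1) → V) : 0 ≤ H.alphaTensor k α i β := by
  have h1' : 0 ≤ 1 - α := sub_nonneg.2 h1
  unfold alphaTensor degTensor adjTensor
  refine add_nonneg (mul_nonneg h0 ?_) (mul_nonneg h1' ?_) <;> split_ifs <;> positivity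

end Weights

/-! ### The weights of closed walks in spiders -/

section ArmWeight

variable {k r d : ℕ} {α : ℝ} {p t x y ε ε' : ℕ} {i : SpiderVertex k r d}
  {β : Fin (k - 1) → SpiderVertex k r d} {a : Fin r} {j : Fin d}

/-- The arm lengths `x, y, ε, …, ε`. The trees to be compared are those with `ε = 1`; they contain
the path `ε = 0`, whose circuit sums do not depend on `x` as long as `x + y` is fixed. -/
def armLen {r : ℕ} (x y ε : ℕ) (a : Fin r) : ℕ :=
  if a.val = 0 then x else if a.val = 1 then y else ε

/-- The tensor entry at `(i, β)` of the spider with arm lengths `x, d - x, ε, …, ε`. -/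
noncomputable def armWeight (α : ℝ) (x ε : ℕ) (i : SpiderVertex k r d)
    (β : Fin (k - 1) → SpiderVertex k r d) : ℝ :=
  (spider k (armLen x (d - x) ε)).alphaTensor k α i β

/-- No vertex of the tensor index `(i, β)` lies on the first two arms, the common vertex
excepted. -/
def OffArms (i : SpiderVertex k r d) (β : Fin (k - 1) → SpiderVertex k r d) : Prop :=
  ∀ a j z, some (a, j, z) ∈ insert i (Set.range β) → 2 ≤ a.val

theorem armLen_eq_of_lt_two (ha : a.val < 2) : armLen x y ε a = armLen x y ε' a := by
  unfold armLen; split_ifs <;> first | rfl | omega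

theorem armLen_of_two_le (ha : 2 ≤ a.val) : armLen x y ε a = ε := by
  unfold armLen; split_ifs <;> first | rfl | omega

theorem armLen_mono (h : ε ≤ ε') (a : Fin r) : armLen x y ε a ≤ armLen x y ε' a := by
  unfold armLen; split_ifs <;> first | rfl | exact h

theorem lt_armLen (ha : a.val < 2) (hx : j.val < x) (hy : j.val < y) : j.val < armLen x y ε a := by
  unfold armLen; split_ifs <;> omega

theorem OffArms.two_le (hk : 2 ≤ k) (h : OffArms i β) (he : OnEdge i β a j) : 2 ≤ a.val :=
  h a j ⟨0, by omega⟩ (he.symm ▸ some_mem_spiderEdge_self a j _)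

theorem OffArms.two_le_of_root {z : Fin (k - 1)} (h : OffArms i β) (hi : i = some (a, j, z)) :
    2 ≤ a.val :=
  h a j z (Or.inl hi.symm)

theorem exists_lt_two_of_not_offArms (hspider : IsSpiderIndex i β) (h : ¬ OffArms i β) :
    (∃ a j z, a.val < 2 ∧ i = some (a, j, z) ∧ ∀ q, β q = i) ∨
      ∃ a j, a.val < 2 ∧ OnEdge i β a j := by
  unfold OffArms at h
  push Not at h
  obtain ⟨a, j, z, hmem, ha⟩ := h
  rcases hspider with hloop | ⟨b, l, he⟩
  · refine Or.inl ⟨a, j, z, ha, ?_, hloop⟩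
    rcases hmem with hi | ⟨q, hi⟩
    exacts [hi.symm, (hloop q).symm.trans hi]
  · obtain ⟨rfl, _⟩ := some_mem_spiderEdge.1 (he ▸ hmem)
    exact Or.inr ⟨a, l, ha, he⟩

theorem armWeight_eq_of_not_offArms (hk : 2 ≤ k) (hspider : IsSpiderIndex i β)
    (h : ¬ OffArms i β) : armWeight α x ε i β = armWeight α x ε' i β := by
  unfold armWeight
  rcases exists_lt_two_of_not_offArms hspider h with ⟨a, j, z, ha, rfl, _⟩ | ⟨a, j, ha, he⟩
  · refine alphaTensor_spider_congr fun b l hb => ?_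
    obtain ⟨rfl, _⟩ := some_mem_spiderEdge.1 hb
    rw [armLen_eq_of_lt_two ha]
  · rw [alphaTensor_spider_of_onEdge hk he, alphaTensor_spider_of_onEdge hk he,
      armLen_eq_of_lt_two ha]

theorem armWeight_eq_of_offArms (hp : 0 < p) (ht : 0 < t) (hpd : p < d) (htd : t < d)
    (h : OffArms i β) : armWeight α p ε i β = armWeight α t ε i β := by
  refine alphaTensor_spider_congr fun a j hj => ?_
  rcases i with _ | ⟨b, l, z⟩
  · rw [none_mem_spiderEdge] at hj
    unfold armLen
    split_ifs <;> omega
  · obtain ⟨rfl, _⟩ := some_mem_spiderEdge.1 hj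
    have hb := h b l z (Set.mem_insert _ _)
    rw [armLen_of_two_le hb, armLen_of_two_le hb]

theorem armWeight_mono (h0 : 0 ≤ α) (h1 : α ≤ 1) (hε : ε ≤ ε') :
    armWeight α x ε i β ≤ armWeight α x ε' i β :=
  alphaTensor_spider_le h0 h1 fun a _ _ hj => hj.trans_le (armLen_mono hε a)

theorem armWeight_loop_le (h0 : 0 ≤ α) (h1 : α ≤ 1) (hpt : p < t) (htd : 2 * t ≤ d) (hj : j.val < p)
    {z : Fin (k - 1)} :
    armWeight α p ε (some (a, j, z)) β ≤ armWeight α t ε (some (a, j, z)) β := by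
  refine alphaTensor_spider_le h0 h1 fun b l hl hlt => ?_
  obtain ⟨rfl, hjl⟩ := some_mem_spiderEdge.1 hl
  have hlj : l.val ≤ j.val + 1 := by rcases hjl with rfl | hjl <;> omega
  unfold armLen at hlt ⊢
  split_ifs at hlt ⊢ <;> omega

theorem armWeight_loop_eq (hpt : p < t) (htd : 2 * t ≤ d) (hj : j.val + 1 < p) {z : Fin (k - 1)} :
    armWeight α p ε (some (a, j, z)) β = armWeight α t ε (some (a, j, z)) β := by
  refine alphaTensor_spider_congr fun b l hl => ?_
  obtain ⟨rfl, hjl⟩ := some_mem_spiderEdge.1 hl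
  have hlj : l.val ≤ j.val + 1 := by rcases hjl with rfl | hjl <;> omega
  unfold armLen
  split_ifs <;> omega

theorem armWeight_of_onEdge (hk : 2 ≤ k) (ha : a.val < 2) (hx : j.val < x) (hxd : j.val < d - x)
    (he : OnEdge i β a j) : armWeight α x ε i β = (1 - α) * (1 / ((k - 1).factorial : ℝ)) := by
  rw [armWeight, alphaTensor_spider_of_onEdge hk he, if_pos (lt_armLen ha hx hxd)]

end ArmWeight

namespace IsCircuit

variable {k r d N : ℕ} {u : Fin N → SpiderVertex k r d}
  {β : Fin N → Fin (k - 1) → SpiderVertex k r d} {σ : Fin (N * (k - 1)) ≃ Fin N × Fin (k - 1)}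
  {s₀ s : Fin N} {a : Fin r} {j : Fin d} {z : Fin (k - 1)}

theorem exists_onEdge_of_offArms (h : IsCircuit u β σ) (hk : 2 ≤ k)
    (hspider : ∀ s, IsSpiderIndex (u s) (β s)) (hs₀ : OffArms (u s₀) (β s₀)) (ha : a.val < 2)
    (hs : u s = some (a, j, z)) : ∀ i ≤ j, ∃ s, OnEdge (u s) (β s) a i := by
  refine fun i hi => h.exists_onEdge_of_mem_beyond hk hspider (s₀ := s₀) (s₁ := s) ?_
    (hs ▸ some_mem_beyond.2 ⟨rfl, hi⟩)
  rintro ⟨l, w, hl, _⟩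
  exact ha.not_ge (hs₀.two_le_of_root hl)

theorem mul_add_two_le_of_loop (h : IsCircuit u β σ) (hk : 2 ≤ k)
    (hspider : ∀ s, IsSpiderIndex (u s) (β s)) (hs₀ : OffArms (u s₀) (β s₀)) (ha : a.val < 2)
    (hs : u s = some (a, j, z)) (hloop : ∀ q, β s q = u s) : k * (j.val + 1) + 2 ≤ N := by
  have hne : s₀ ≠ s := fun hss => ha.not_ge (hs₀.two_le_of_root ((congrArg u hss).trans hs))
  have hcard := h.card_add_mul_le hk hspider
    (h.exists_onEdge_of_offArms hk hspider hs₀ ha hs) {s₀, s} fun s' hs' i _ he => by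
      rcases Finset.mem_insert.1 hs' with rfl | hs'
      · exact ha.not_ge (hs₀.two_le hk he)
      · exact he.not_loop hk (Finset.mem_singleton.1 hs' ▸ hloop)
  rwa [Finset.card_pair hne, add_comm] at hcard

theorem mul_add_one_le_of_onEdge (h : IsCircuit u β σ) (hk : 2 ≤ k)
    (hspider : ∀ s, IsSpiderIndex (u s) (β s)) (hs₀ : OffArms (u s₀) (β s₀)) (ha : a.val < 2)
    (he : OnEdge (u s) (β s) a j) : k * (j.val + 1) + 1 ≤ N := by
  obtain ⟨s₁, _, hs₁⟩ :=
    h.exists_onEdge_root_eq hk hspider he (some_mem_spiderEdge_self a j ⟨0, by omega⟩)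
  have hcard := h.card_add_mul_le hk hspider
    (h.exists_onEdge_of_offArms hk hspider hs₀ ha hs₁) {s₀} fun s' hs' i _ he => by
      rw [Finset.mem_singleton.1 hs'] at he
      exact ha.not_ge (hs₀.two_le hk he)
  rwa [Finset.card_singleton, add_comm] at hcard

theorem armWeight_eq_of_onEdge (h : IsCircuit u β σ) (hk : 2 ≤ k)
    (hspider : ∀ s, IsSpiderIndex (u s) (β s)) (hs₀ : OffArms (u s₀) (β s₀)) {α : ℝ} {p t ε : ℕ}
    (hpt : p < t) (htd : 2 * t ≤ d) (hN : N ≤ k * p + 2) (ha : a.val < 2)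
    (he : OnEdge (u s) (β s) a j) :
    armWeight α p ε (u s) (β s) = armWeight α t ε (u s) (β s) := by
  have hj : j.val + 1 < p + 1 := Nat.lt_of_mul_lt_mul_left (a := k) <| by
    have hle := h.mul_add_one_le_of_onEdge hk hspider hs₀ ha he
    rw [mul_add_one k p]
    omega
  rw [armWeight_of_onEdge hk ha (by omega) (by omega) he,
    armWeight_of_onEdge hk ha (by omega) (by omega) he]

theorem armWeight_le (h : IsCircuit u β σ) (hk : 2 ≤ k)
    (hspider : ∀ s, IsSpiderIndex (u s) (β s)) (hs₀ : OffArms (u s₀) (β s₀)) {α : ℝ} (h0 : 0 ≤ α)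
    (h1 : α ≤ 1) {p t ε : ℕ} (hpt : p < t) (htd : 2 * t ≤ d) (hN : N ≤ k * p + 2)
    (hs : ¬ OffArms (u s) (β s)) :
    armWeight α p ε (u s) (β s) ≤ armWeight α t ε (u s) (β s) := by
  rcases exists_lt_two_of_not_offArms (hspider s) hs with ⟨a, j, z, ha, hu, hloop⟩ | ⟨a, j, ha, he⟩
  · have hle := h.mul_add_two_le_of_loop hk hspider hs₀ ha hu hloop
    have hj : j.val + 1 ≤ p := le_of_mul_le_mul_left (a := k) (by omega) (by omega)
    rw [hu]
    exact armWeight_loop_le h0 h1 hpt htd hj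
  · exact (h.armWeight_eq_of_onEdge hk hspider hs₀ hpt htd hN ha he).le

theorem armWeight_eq (h : IsCircuit u β σ) (hk : 2 ≤ k)
    (hspider : ∀ s, IsSpiderIndex (u s) (β s)) (hs₀ : OffArms (u s₀) (β s₀)) {α : ℝ} {p t ε : ℕ}
    (hpt : p < t) (htd : 2 * t ≤ d) (hN : N < k * p + 2) (hs : ¬ OffArms (u s) (β s)) :
    armWeight α p ε (u s) (β s) = armWeight α t ε (u s) (β s) := by
  rcases exists_lt_two_of_not_offArms (hspider s) hs with ⟨a, j, z, ha, hu, hloop⟩ | ⟨a, j, ha, he⟩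
  · have hle := h.mul_add_two_le_of_loop hk hspider hs₀ ha hu hloop
    have hj : j.val + 1 < p := Nat.lt_of_mul_lt_mul_left (a := k) (by omega)
    rw [hu]
    exact armWeight_loop_eq hpt htd hj
  · exact h.armWeight_eq_of_onEdge hk hspider hs₀ hpt htd hN.le ha he

end IsCircuit

section MixedDifference

variable {k r d N : ℕ} {α : ℝ} {p t : ℕ} {u : Fin N → SpiderVertex k r d}
  {β : Fin N → Fin (k - 1) → SpiderVertex k r d} {σ : Fin (N * (k - 1)) ≃ Fin N × Fin (k - 1)}

/-- The mixed second difference of the weight of a sequence of tensor indices, between `ε = 0` and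
`ε = 1` and between the first arm lengths `p` and `t`. -/
noncomputable def mixedDifference (α : ℝ) (p t : ℕ) (u : Fin N → SpiderVertex k r d)
    (β : Fin N → Fin (k - 1) → SpiderVertex k r d) : ℝ :=
  (∏ s, armWeight α t 1 (u s) (β s) - ∏ s, armWeight α t 0 (u s) (β s)) -
    (∏ s, armWeight α p 1 (u s) (β s) - ∏ s, armWeight α p 0 (u s) (β s))

open Classical in
/-- The weights off the first two arms depend on `ε` only, those on them depend on the lengths
only, so the mixed difference is a product of two simple differences. -/
theorem mixedDifference_eq_mul (hk : 2 ≤ k) (hp : 0 < p) (ht : 0 < t) (hpd : p < d) (htd : t < d)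
    (hspider : ∀ s, IsSpiderIndex (u s) (β s)) :
    mixedDifference α p t u β =
      (∏ s with ¬ OffArms (u s) (β s), armWeight α t 1 (u s) (β s) -
        ∏ s with ¬ OffArms (u s) (β s), armWeight α p 1 (u s) (β s)) *
      (∏ s with OffArms (u s) (β s), armWeight α p 1 (u s) (β s) -
        ∏ s with OffArms (u s) (β s), armWeight α p 0 (u s) (β s)) := by
  have hsplit (x ε : ℕ) (hx : 0 < x) (hxd : x < d) : ∏ s, armWeight α x ε (u s) (β s) =
      (∏ s with OffArms (u s) (β s), armWeight α p ε (u s) (β s)) *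
        ∏ s with ¬ OffArms (u s) (β s), armWeight α x 1 (u s) (β s) := by
    rw [← Finset.prod_filter_mul_prod_filter_not Finset.univ (fun s => OffArms (u s) (β s))]
    congr 1
    · exact Finset.prod_congr rfl fun s hs =>
        armWeight_eq_of_offArms hx hp hxd hpd (Finset.mem_filter.1 hs).2
    · exact Finset.prod_congr rfl fun s hs =>
        armWeight_eq_of_not_offArms hk (hspider s) (Finset.mem_filter.1 hs).2
  rw [mixedDifference, hsplit t 1 ht htd, hsplit t 0 ht htd, hsplit p 1 hp hpd, hsplit p 0 hp hpd]
  ring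

theorem mixedDifference_eq_zero_of_forall_not_offArms (hk : 2 ≤ k) (hp : 0 < p) (ht : 0 < t)
    (hpd : p < d) (htd : t < d) (hspider : ∀ s, IsSpiderIndex (u s) (β s))
    (h : ∀ s, ¬ OffArms (u s) (β s)) : mixedDifference α p t u β = 0 := by
  classical
  rw [mixedDifference_eq_mul hk hp ht hpd htd hspider, Finset.filter_false_of_mem fun s _ => h s]
  simp

theorem mixedDifference_eq_zero_of_not_isSpiderIndex {s : Fin N} (h : ¬ IsSpiderIndex (u s) (β s)) :
    mixedDifference α p t u β = 0 := by
  have hprod (x ε : ℕ) : ∏ s, armWeight α x ε (u s) (β s) = 0 :=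
    Finset.prod_eq_zero (Finset.mem_univ s) (alphaTensor_spider_eq_zero h)
  simp [mixedDifference, hprod]

theorem IsCircuit.mixedDifference_nonneg (h : IsCircuit u β σ) (hk : 2 ≤ k) (h0 : 0 ≤ α)
    (h1 : α ≤ 1) (hp : 0 < p) (hpt : p < t) (htd : 2 * t ≤ d) (hN : N ≤ k * p + 2) :
    0 ≤ mixedDifference α p t u β := by
  classical
  by_cases hspider : ∀ s, IsSpiderIndex (u s) (β s)
  · by_cases hoff : ∃ s₀, OffArms (u s₀) (β s₀)
    · obtain ⟨s₀, hs₀⟩ := hoff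
      rw [mixedDifference_eq_mul hk hp (by omega) (by omega) (by omega) hspider]
      refine mul_nonneg (sub_nonneg.2 ?_) (sub_nonneg.2 ?_) <;>
        refine Finset.prod_le_prod (fun s _ => alphaTensor_nonneg _ h0 h1 _ _) fun s hs => ?_
      · exact h.armWeight_le hk hspider hs₀ h0 h1 hpt htd hN (Finset.mem_filter.1 hs).2
      · exact armWeight_mono h0 h1 zero_le_one
    · exact (mixedDifference_eq_zero_of_forall_not_offArms hk hp (by omega) (by omega) (by omega)
        hspider (not_exists.1 hoff)).ge
  · obtain ⟨s, hs⟩ := not_forall.1 hspider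
    exact (mixedDifference_eq_zero_of_not_isSpiderIndex hs).ge

theorem IsCircuit.mixedDifference_eq_zero (h : IsCircuit u β σ) (hk : 2 ≤ k) (hp : 0 < p)
    (hpt : p < t) (htd : 2 * t ≤ d) (hN : N < k * p + 2) : mixedDifference α p t u β = 0 := by
  classical
  by_cases hspider : ∀ s, IsSpiderIndex (u s) (β s)
  · by_cases hoff : ∃ s₀, OffArms (u s₀) (β s₀)
    · obtain ⟨s₀, hs₀⟩ := hoff
      rw [mixedDifference_eq_mul hk hp (by omega) (by omega) (by omega) hspider, mul_eq_zero,
        sub_eq_zero]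
      exact Or.inl (Finset.prod_congr rfl fun s hs =>
        (h.armWeight_eq hk hspider hs₀ hpt htd hN (Finset.mem_filter.1 hs).2).symm)
    · exact mixedDifference_eq_zero_of_forall_not_offArms hk hp (by omega) (by omega) (by omega)
        hspider (not_exists.1 hoff)
  · obtain ⟨s, hs⟩ := not_forall.1 hspider
    exact mixedDifference_eq_zero_of_not_isSpiderIndex hs

end MixedDifference

section ArmTour

variable {k r d N : ℕ} {α : ℝ} {t : ℕ} {a : Fin r} {i j : Fin d} {v : SpiderVertex k r d}
  {u : Fin N → SpiderVertex k r d} {β : Fin N → Fin (k - 1) → SpiderVertex k r d}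

/-- A sequence of tensor indices made of loops at the common vertex, indices of hyperedges of arm
`a` before the `j`-th one and loops at `v`, both kinds of loops being present. When `v` is the
attachment vertex of the `j`-th hyperedge, shortening the arm to `j` hyperedges is detected by the
second kind of loop. -/
structure IsArmTour (a : Fin r) (j : Fin d) (v : SpiderVertex k r d)
    (u : Fin N → SpiderVertex k r d) (β : Fin N → Fin (k - 1) → SpiderVertex k r d) : Prop where
  cases (s : Fin N) : (u s, β s) = (none, fun _ => none) ∨
    (∃ i < j, OnEdge (u s) (β s) a i) ∨ (u s, β s) = (v, fun _ => v)
  exists_loop_none : ∃ s, (u s, β s) = (none, fun _ => none)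
  exists_loop : ∃ s, (u s, β s) = (v, fun _ => v)

theorem armWeight_loop_none_pos (hk : 2 ≤ k) (h0 : 0 < α) {x ε : ℕ} (hx : 0 < x) (hr : 0 < r)
    (hd : 0 < d) :
    0 < armWeight α x ε (none : SpiderVertex k r d) (fun _ => none) := by
  rw [armWeight, alphaTensor_of_forall_eq hk (spider_isUniform hk _) fun _ => rfl]
  refine mul_pos h0 (Nat.cast_pos.2 (spider_degree_pos none (a := ⟨0, hr⟩) (j := ⟨0, hd⟩)
    (none_mem_spiderEdge.2 rfl) ?_))
  simpa [armLen] using hx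

theorem armWeight_loop_none_lt (hk : 2 ≤ k) (h0 : 0 < α) {x : ℕ} (hr : 2 < r) (hd : 0 < d) :
    armWeight α x 0 (none : SpiderVertex k r d) (fun _ => none) <
      armWeight α x 1 (none : SpiderVertex k r d) (fun _ => none) := by
  rw [armWeight, armWeight, alphaTensor_of_forall_eq hk (spider_isUniform hk _) fun _ => rfl,
    alphaTensor_of_forall_eq hk (spider_isUniform hk _) fun _ => rfl]
  refine mul_lt_mul_of_pos_left (Nat.cast_lt.2 (spider_degree_lt none hk
    (fun a _ _ hj => hj.trans_le (armLen_mono zero_le_one a)) (a := ⟨2, hr⟩) (j := ⟨0, hd⟩)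
    (none_mem_spiderEdge.2 rfl) ?_ ?_)) h0 <;> simp [armLen]

theorem armWeight_loop_pos (hk : 2 ≤ k) (h0 : 0 < α) {ε : ℕ} (ha : a.val = 0) (hij : i < j)
    (hvi : v ∈ spiderEdge k a i) : 0 < armWeight α j ε v (fun _ => v) := by
  rw [armWeight, alphaTensor_of_forall_eq hk (spider_isUniform hk _) fun _ => rfl]
  refine mul_pos h0 (Nat.cast_pos.2 (spider_degree_pos v hvi ?_))
  simpa [armLen, ha] using hij

theorem armWeight_loop_lt (hk : 2 ≤ k) (h0 : 0 < α) {ε : ℕ} (ha : a.val = 0) (hij : i < j)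
    (hvi : v ∈ spiderEdge k a i) (hvj : v ∈ spiderEdge k a j) (hjt : j.val < t) :
    armWeight α j ε v (fun _ => v) < armWeight α t ε v (fun _ => v) := by
  rw [armWeight, armWeight, alphaTensor_of_forall_eq hk (spider_isUniform hk _) fun _ => rfl,
    alphaTensor_of_forall_eq hk (spider_isUniform hk _) fun _ => rfl]
  refine mul_lt_mul_of_pos_left (Nat.cast_lt.2 (spider_degree_lt v hk (fun b l hl hlt => ?_) hvj
    ?_ ?_)) h0
  · rcases v with _ | ⟨c, i', z⟩
    · have hj := none_mem_spiderEdge.1 hvj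
      omega
    · obtain ⟨rfl, -⟩ := some_mem_spiderEdge.1 hvj
      obtain ⟨rfl, -⟩ := some_mem_spiderEdge.1 hl
      simp only [armLen, ha, if_true] at hlt ⊢
      omega
  · simp [armLen, ha]
  · simpa [armLen, ha] using hjt

theorem offArms_loop_none : OffArms (none : SpiderVertex k r d) (fun _ => none) := by
  rintro a j z (h | ⟨q, h⟩) <;> simp at h

namespace IsArmTour

theorem isSpiderIndex (h : IsArmTour a j v u β) (s : Fin N) : IsSpiderIndex (u s) (β s) := by
  rcases h.cases s with hs | ⟨l, _, he⟩ | hs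
  · obtain ⟨hu, hβ⟩ := Prod.mk.inj hs
    exact Or.inl fun q => (congrFun hβ q).trans hu.symm
  · exact Or.inr ⟨a, l, he⟩
  · obtain ⟨hu, hβ⟩ := Prod.mk.inj hs
    exact Or.inl fun q => (congrFun hβ q).trans hu.symm

theorem offArms_iff (h : IsArmTour a j v u β) (hk : 2 ≤ k) (ha : a.val = 0) (hj : 0 < j.val)
    (hvj : v ∈ spiderEdge k a j) (s : Fin N) :
    OffArms (u s) (β s) ↔ (u s, β s) = (none, fun _ => none) := by
  refine ⟨fun hoff => (h.cases s).resolve_right ?_, fun hs => ?_⟩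
  · rintro (⟨l, _, he⟩ | hs)
    · exact absurd (hoff.two_le hk he) (by omega)
    · rcases v with _ | ⟨b, l, z⟩
      · exact hj.ne' (none_mem_spiderEdge.1 hvj)
      · obtain ⟨rfl, -⟩ := some_mem_spiderEdge.1 hvj
        have hb := hoff.two_le_of_root (Prod.mk.inj hs).1
        omega
  · obtain ⟨hu, hβ⟩ := Prod.mk.inj hs
    rw [hu, hβ]
    exact offArms_loop_none

theorem prod_onArms_lt (h : IsArmTour a j v u β) (hk : 2 ≤ k) (h0 : 0 < α) (h1 : α < 1)
    (ha : a.val = 0) (hij : i < j) (hvi : v ∈ spiderEdge k a i) (hvj : v ∈ spiderEdge k a j)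
    (hjt : j.val < t) (htd : 2 * t ≤ d) [DecidablePred fun s => ¬ OffArms (u s) (β s)] :
    ∏ s with ¬ OffArms (u s) (β s), armWeight α j 1 (u s) (β s) <
      ∏ s with ¬ OffArms (u s) (β s), armWeight α t 1 (u s) (β s) := by
  have hj : 0 < j.val := (Nat.zero_le _).trans_lt hij
  have hoff := h.offArms_iff hk ha hj hvj
  have hweight (s : Fin N) (hs : ¬ OffArms (u s) (β s)) : 0 < armWeight α j 1 (u s) (β s) ∧
      armWeight α j 1 (u s) (β s) ≤ armWeight α t 1 (u s) (β s) := by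
    rcases (h.cases s).resolve_left (mt (hoff s).2 hs) with ⟨l, hl, he⟩ | hs
    · rw [armWeight_of_onEdge hk (by omega) hl (by omega) he,
        armWeight_of_onEdge hk (by omega) (by omega) (by omega) he]
      exact ⟨mul_pos (sub_pos.2 h1) (by positivity), le_rfl⟩
    · obtain ⟨hu, hβ⟩ := Prod.mk.inj hs
      rw [hu, hβ]
      exact ⟨armWeight_loop_pos hk h0 ha hij hvi, (armWeight_loop_lt hk h0 ha hij hvi hvj hjt).le⟩
  obtain ⟨s, hs⟩ := h.exists_loop
  obtain ⟨hu, hβ⟩ := Prod.mk.inj hs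
  refine Finset.prod_lt_prod (fun s hs => (hweight s (Finset.mem_filter.1 hs).2).1)
    (fun s hs => (hweight s (Finset.mem_filter.1 hs).2).2) ⟨s, ?_, ?_⟩
  · rw [Finset.mem_filter, hoff s, hs]
    refine ⟨Finset.mem_univ _, fun hv => hj.ne' (none_mem_spiderEdge.1 ((?_ : v = none) ▸ hvj))⟩
    exact (Prod.mk.inj hv).1
  · rw [hu, hβ]
    exact armWeight_loop_lt hk h0 ha hij hvi hvj hjt

theorem prod_offArms_lt (h : IsArmTour a j v u β) (hk : 2 ≤ k) (h0 : 0 < α) (hr : 2 < r)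
    (ha : a.val = 0) (hj : 0 < j.val) (hvj : v ∈ spiderEdge k a j)
    [DecidablePred fun s => OffArms (u s) (β s)] :
    ∏ s with OffArms (u s) (β s), armWeight α j 0 (u s) (β s) <
      ∏ s with OffArms (u s) (β s), armWeight α j 1 (u s) (β s) := by
  have hoff := h.offArms_iff hk ha hj hvj
  have hd : 0 < d := hj.trans j.isLt
  have hweight (s : Fin N) (hs : OffArms (u s) (β s)) : 0 < armWeight α j 0 (u s) (β s) ∧
      armWeight α j 0 (u s) (β s) < armWeight α j 1 (u s) (β s) := by
    obtain ⟨hu, hβ⟩ := Prod.mk.inj ((hoff s).1 hs)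
    rw [hu, hβ]
    exact ⟨armWeight_loop_none_pos hk h0 hj (by omega) hd, armWeight_loop_none_lt hk h0 hr hd⟩
  obtain ⟨s, hs⟩ := h.exists_loop_none
  exact Finset.prod_lt_prod (fun s hs => (hweight s (Finset.mem_filter.1 hs).2).1)
    (fun s hs => (hweight s (Finset.mem_filter.1 hs).2).2.le)
    ⟨s, Finset.mem_filter.2 ⟨Finset.mem_univ _, (hoff s).2 hs⟩, (hweight s ((hoff s).2 hs)).2⟩

theorem mixedDifference_pos (h : IsArmTour a j v u β) (hk : 2 ≤ k) (h0 : 0 < α) (h1 : α < 1)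
    (hr : 2 < r) (ha : a.val = 0) (hij : i < j) (hvi : v ∈ spiderEdge k a i)
    (hvj : v ∈ spiderEdge k a j) (hjt : j.val < t) (htd : 2 * t ≤ d) :
    0 < mixedDifference α j t u β := by
  classical
  have hj : 0 < j.val := (Nat.zero_le _).trans_lt hij
  rw [mixedDifference_eq_mul hk hj (by omega) j.isLt (by omega) h.isSpiderIndex]
  exact mul_pos (sub_pos.2 (h.prod_onArms_lt hk h0 h1 ha hij hvi hvj hjt htd))
    (sub_pos.2 (h.prod_offArms_lt hk h0 hr ha hj hvj))

end IsArmTour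

end ArmTour

/-! ### Gluing closed walks -/

theorem exists_map_univ_eq {ι : Type*} (M : Multiset ι) {n : ℕ} (h : M.card = n) :
    ∃ f : Fin n → ι, Finset.univ.val.map f = M := by
  obtain ⟨l, rfl⟩ := Quot.exists_rep M
  obtain rfl : l.length = n := h
  exact ⟨l.get, (Fin.univ_val_map l.get).trans (congrArg _ (List.ofFn_get l))⟩

section ArcWalk

variable {V : Type*}

/-- There is a walk from `x` to `y` whose multiset of arcs is `M`. -/
inductive ArcWalk : V → V → Multiset (V × V) → Prop
  | nil (x : V) : ArcWalk x x 0
  | cons {y z : V} {M : Multiset (V × V)} (x : V) (h : ArcWalk y z M) : ArcWalk x z ((x, y) ::ₘ M)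

namespace ArcWalk

variable {x y z : V} {M M' : Multiset (V × V)}

theorem append (h : ArcWalk x y M) (h' : ArcWalk y z M') : ArcWalk x z (M + M') := by
  induction h with
  | nil => rwa [zero_add]
  | cons x _ ih => rw [Multiset.cons_add]; exact (ih h').cons x

theorem single (x y : V) : ArcWalk x y {(x, y)} := (nil y).cons x

theorem insert_closed (h : ArcWalk x z M) {v w : V} (hv : (v, w) ∈ M) (h' : ArcWalk v v M') :
    ArcWalk x z (M + M') := by
  induction h with
  | nil => exact absurd hv (Multiset.notMem_zero _)
  | @cons y z N x hN ih =>
    rcases Multiset.mem_cons.1 hv with hv | hv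
    · obtain ⟨rfl, rfl⟩ := Prod.mk.inj hv
      rw [add_comm]
      exact h'.append (hN.cons _)
    · rw [Multiset.cons_add]
      exact (ih hv).cons x

theorem sum_closed {ι : Type*} (s : Finset ι) {f : ι → Multiset (V × V)}
    (h : ∀ i ∈ s, ArcWalk x x (f i)) : ArcWalk x x (∑ i ∈ s, f i) :=
  Finset.sum_induction f (ArcWalk x x) (fun _ _ => append) (nil x) h

theorem complete_closed [DecidableEq V] (b : V) (F : Finset V) (hb : b ∉ F) :
    ArcWalk b b (∑ v ∈ insert b F, ∑ w ∈ (insert b F).erase v, {(v, w)}) := by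
  induction F using Finset.induction_on with
  | empty => simpa using nil b
  | insert a F ha ih =>
    obtain ⟨hba, hbF⟩ := not_or.1 (mt Finset.mem_insert.2 hb)
    have haF : a ∉ insert b F := by simp [ha, Ne.symm hba]
    have hrow : ∀ v ∈ insert b F, ∑ w ∈ (insert a (insert b F)).erase v,
        ({(v, w)} : Multiset (V × V)) = {(v, a)} + ∑ w ∈ (insert b F).erase v, {(v, w)} := by
      intro v hv
      rw [Finset.erase_insert_of_ne (ne_of_mem_of_not_mem hv haF).symm,
        Finset.sum_insert (mt Finset.mem_of_mem_erase haF)]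
    have hsplit : ∑ v ∈ insert b (insert a F), ∑ w ∈ (insert b (insert a F)).erase v,
        ({(v, w)} : Multiset (V × V)) =
        (∑ v ∈ insert b F, ∑ w ∈ (insert b F).erase v, {(v, w)}) +
          ({(b, a)} + ((∑ w ∈ F, ({(a, w)} + {(w, a)})) + {(a, b)})) := by
      rw [Finset.insert_comm b a F, Finset.sum_insert haF, Finset.erase_insert haF,
        Finset.sum_congr rfl hrow, Finset.sum_add_distrib, Finset.sum_insert hbF,
        Finset.sum_insert hbF, Finset.sum_add_distrib]
      abel
    rw [hsplit]
    exact (ih hbF).append ((single b a).append ((sum_closed F fun w _ =>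
      (single a w).append (single w a)).append (single a b)))

theorem exists_fun (h : ArcWalk x z M) : ∃ w : ℕ → V, w 0 = x ∧ w M.card = z ∧
    M = ∑ t ∈ Finset.range M.card, {(w t, w (t + 1))} := by
  induction h with
  | nil x => exact ⟨fun _ => x, rfl, rfl, rfl⟩
  | @cons y z N x hN ih =>
    obtain ⟨w, rfl, rfl, hw⟩ := ih
    refine ⟨fun t => Nat.casesOn t x w, rfl, by rw [Multiset.card_cons], ?_⟩
    rw [Multiset.card_cons, Finset.sum_range_succ', add_comm, Multiset.singleton_add]
    exact congrArg _ hw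

end ArcWalk

theorem comp_finRotate_of_eq {w : ℕ → V} {n : ℕ} (hw : w 0 = w n) (t : Fin n) :
    w (finRotate n t) = w (t + 1) := by
  obtain _ | n := n
  · exact t.elim0
  · rcases Fin.eq_castSucc_or_eq_last t with ⟨t, rfl⟩ | rfl
    · rw [finRotate_apply, Fin.val_add_one_of_lt (Fin.castSucc_lt_last t)]
    · rw [finRotate_last, Fin.val_zero, Fin.val_last, hw]

/-- The arcs `i → β q` of a tensor index `(i, β)`. -/
def indexArcs {κ : ℕ} (x : V × (Fin κ → V)) : Multiset (V × V) :=
  ∑ q, {(x.1, x.2 q)}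

theorem exists_isCircuit_of_arcWalk {d κ : ℕ} {u : Fin d → V} {β : Fin d → Fin κ → V} {v : V}
    (h : ArcWalk v v (∑ s, indexArcs (u s, β s))) : ∃ σ, IsCircuit u β σ := by
  classical
  have hcard : (∑ s, indexArcs (u s, β s)).card = d * κ := by simp [indexArcs]
  obtain ⟨w, hw0, hwN, hw⟩ := h.exists_fun
  rw [hcard] at hwN hw
  have hlabels : ∑ t : Fin (d * κ), Finsupp.single (w t, w (t + 1)) 1 =
      ∑ x : Fin d × Fin κ, Finsupp.single (u x.1, β x.1 x.2) 1 := by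
    have htoFinsupp := congrArg Multiset.toFinsupp hw
    simp only [indexArcs, map_sum, Multiset.toFinsupp_singleton] at htoFinsupp
    rw [Finset.sum_range fun t => Finsupp.single (w t, w (t + 1)) 1] at htoFinsupp
    rw [Fintype.sum_prod_type]
    exact htoFinsupp.symm
  obtain ⟨σ, hσ⟩ := exists_equiv_of_sum_single_eq hlabels
  refine ⟨σ, fun t => ?_⟩
  rw [← (Prod.mk.inj (hσ t)).2, ← (Prod.mk.inj (hσ (finRotate _ t))).1,
    comp_finRotate_of_eq (hw0.trans hwN.symm)]

theorem arcWalk_indexArcs_loop {κ : ℕ} (v : V) :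
    ArcWalk v v (indexArcs (v, fun _ : Fin κ => v)) :=
  ArcWalk.sum_closed _ fun _ _ => ArcWalk.single v v

theorem exists_arc_of_mem {κ : ℕ} (hκ : 0 < κ) {I : Multiset (V × (Fin κ → V))} {v : V}
    {β : Fin κ → V} (h : (v, β) ∈ I) : ∃ w, (v, w) ∈ (I.map indexArcs).sum :=
  ⟨β ⟨0, hκ⟩, Multiset.mem_of_le
    (Multiset.single_le_sum (fun _ _ => Multiset.zero_le _) _ (Multiset.mem_map_of_mem indexArcs h))
    (Multiset.mem_sum.2 ⟨⟨0, hκ⟩, Finset.mem_univ _, Multiset.mem_singleton_self _⟩)⟩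

/-- One index for each choice of the root in `E`: their arcs form the complete digraph on `E`. -/
theorem exists_indices_of_ncard_eq {k : ℕ} (hk : 2 ≤ k) {E : Set V} (hE : E.ncard = k) {b : V}
    (hb : b ∈ E) :
    ∃ I : Multiset (V × (Fin (k - 1) → V)), I.card = k ∧
      (∀ x ∈ I, insert x.1 (Set.range x.2) = E) ∧ (∀ v ∈ E, ∃ β, (v, β) ∈ I) ∧
      ArcWalk b b (I.map indexArcs).sum := by
  classical
  have : Nonempty V := ⟨b⟩
  obtain ⟨F, rfl⟩ := (Set.finite_of_ncard_pos (s := E) (by omega)).exists_finset_coe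
  rw [Set.ncard_coe_finset] at hE
  choose! others hothers using fun v (hv : v ∈ F) => exists_map_univ_eq (F.erase v).val
    (n := k - 1) (by rw [Finset.card_val, Finset.card_erase_of_mem hv, hE])
  have hrange : ∀ v ∈ F, Set.range (others v) = F.erase v := fun v hv => by
    ext w
    rw [Finset.mem_coe, ← Finset.mem_val, ← hothers v hv]
    simp
  have harcs : ∀ v ∈ F, indexArcs (v, others v) = ∑ w ∈ F.erase v, {(v, w)} := fun v hv => by
    rw [Finset.sum, ← hothers v hv, Multiset.map_map]
    rfl
  refine ⟨F.val.map fun v => (v, others v), by simpa using hE, ?_, fun v hv => ⟨others v, ?_⟩, ?_⟩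
  · intro x hx
    obtain ⟨v, hv, rfl⟩ := Multiset.mem_map.1 hx
    rw [hrange v hv, ← Finset.coe_insert, Finset.insert_erase hv]
  · exact Multiset.mem_map_of_mem (fun v => (v, others v)) hv
  · have hsum : ((F.val.map fun v => (v, others v)).map indexArcs).sum =
        ∑ v ∈ F, ∑ w ∈ F.erase v, {(v, w)} := by
      rw [Multiset.map_map]
      exact Finset.sum_congr rfl harcs
    rw [hsum, ← Finset.insert_erase (Finset.mem_coe.1 hb)]
    exact ArcWalk.complete_closed b _ (Finset.notMem_erase _ _)

end ArcWalk

section ArmTour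

variable {k r D : ℕ}

theorem exists_arm_indices (hk : 2 ≤ k) (a : Fin r) (p : ℕ) (hp : p ≤ D) :
    ∃ I : Multiset (SpiderVertex k r D × (Fin (k - 1) → SpiderVertex k r D)),
      I.card = k * p + 1 ∧ (none, fun _ => none) ∈ I ∧
      (∀ x ∈ I, x = (none, fun _ => none) ∨ ∃ i : Fin D, i.val < p ∧ OnEdge x.1 x.2 a i) ∧
      (∀ i : Fin D, i.val < p → ∀ v ∈ spiderEdge k a i, ∃ β, (v, β) ∈ I) ∧
      ArcWalk none none (I.map indexArcs).sum := by
  induction p with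
  | zero =>
    refine ⟨{(none, fun _ => none)}, by simp, Multiset.mem_singleton_self _, ?_, by simp, ?_⟩
    · exact fun x hx => Or.inl (Multiset.mem_singleton.1 hx)
    · simpa using arcWalk_indexArcs_loop none
  | succ p ih =>
    obtain ⟨I, hcard, hnone, hI, hroot, hwalk⟩ := ih (by omega)
    obtain ⟨b, hb, β, hbI⟩ : ∃ b ∈ spiderEdge k a ⟨p, hp⟩, ∃ β, (b, β) ∈ I := by
      obtain _ | p := p
      · exact ⟨none, none_mem_spiderEdge.2 rfl, _, hnone⟩
      · obtain ⟨b, hb, hb'⟩ := exists_mem_spiderEdge_of_succ_eq hk a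
          (i := ⟨p, by omega⟩) (j := ⟨p + 1, hp⟩) rfl
        exact ⟨b, hb', hroot _ (Nat.lt_succ_self p) b hb⟩
    obtain ⟨w, hw⟩ := exists_arc_of_mem (by omega) hbI
    obtain ⟨J, hJcard, hJ, hJroot, hJwalk⟩ :=
      exists_indices_of_ncard_eq hk (ncard_spiderEdge hk a ⟨p, hp⟩) hb
    refine ⟨I + J, ?_, Multiset.mem_add.2 (Or.inl hnone), fun x hx => ?_, fun i hi v hv => ?_, ?_⟩
    · rw [Multiset.card_add, hcard, hJcard]
      ring
    · rcases Multiset.mem_add.1 hx with hx | hx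
      · exact (hI x hx).imp_right fun ⟨i, hi, he⟩ => ⟨i, by omega, he⟩
      · exact Or.inr ⟨⟨p, hp⟩, Nat.lt_succ_self p, hJ x hx⟩
    · rcases Nat.lt_succ_iff_lt_or_eq.1 hi with hi | rfl
      · exact (hroot i hi v hv).imp fun β hβ => Multiset.mem_add.2 (Or.inl hβ)
      · exact (hJroot v hv).imp fun β hβ => Multiset.mem_add.2 (Or.inr hβ)
    · rw [Multiset.map_add, Multiset.sum_add]
      exact hwalk.insert_closed hw hJwalk

theorem exists_isArmTour (hk : 2 ≤ k) {a : Fin r} {i j : Fin D} (hij : i < j)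
    {v : SpiderVertex k r D} (hv : v ∈ spiderEdge k a i) :
    ∃ (u : Fin (k * j + 2) → SpiderVertex k r D)
      (β : Fin (k * j + 2) → Fin (k - 1) → SpiderVertex k r D),
      (∃ σ, IsCircuit u β σ) ∧ IsArmTour a j v u β := by
  obtain ⟨I, hcard, hnone, hI, hroot, hwalk⟩ := exists_arm_indices hk a j.val j.isLt.le
  obtain ⟨γ, hγ⟩ := hroot i hij v hv
  obtain ⟨w, hw⟩ := exists_arc_of_mem (by omega) hγ
  have hwalk' : ArcWalk none none (((v, fun _ => v) ::ₘ I).map indexArcs).sum := by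
    rw [Multiset.map_cons, Multiset.sum_cons, add_comm]
    exact hwalk.insert_closed hw (arcWalk_indexArcs_loop v)
  obtain ⟨f, hf⟩ := exists_map_univ_eq ((v, fun _ => v) ::ₘ I) (n := k * j + 2)
    (by rw [Multiset.card_cons, hcard])
  have hmem (x : SpiderVertex k r D × (Fin (k - 1) → SpiderVertex k r D)) :
      (∃ s, f s = x) ↔ x = (v, fun _ => v) ∨ x ∈ I := by
    simp only [← Multiset.mem_cons, ← hf, Multiset.mem_map, Finset.mem_val, Finset.mem_univ,
      true_and]
  refine ⟨fun s => (f s).1, fun s => (f s).2, exists_isCircuit_of_arcWalk (v := none) ?_,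
    fun s => ?_, (hmem _).2 (Or.inr hnone), (hmem _).2 (Or.inl rfl)⟩
  · rwa [← hf, Multiset.map_map] at hwalk'
  · rcases (hmem _).1 ⟨s, rfl⟩ with hs | hs
    · exact Or.inr (Or.inr hs)
    · exact (hI _ hs).imp_right Or.inl

end ArmTour

section SpiderCircuitSum

variable {k r d N : ℕ} {α : ℝ} {p t : ℕ}

/-- The circuit sum of the spider with arm lengths `x, d - x, ε, …, ε`. -/
noncomputable def spiderCircuitSum (k r d : ℕ) (α : ℝ) (x ε N : ℕ) : ℝ :=
  circuitSum ((spider k (armLen x (d - x) ε) : Hypergraph (SpiderVertex k r d)).alphaTensor k α) N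

theorem sum_circuitCoeff_mul_mixedDifference (k r d : ℕ) (α : ℝ) (p t N : ℕ) :
    ∑ u : Fin N → SpiderVertex k r d, ∑ β : Fin N → Fin (k - 1) → SpiderVertex k r d,
      circuitCoeff ℝ u β * mixedDifference α p t u β =
    (spiderCircuitSum k r d α t 1 N - spiderCircuitSum k r d α t 0 N) -
      (spiderCircuitSum k r d α p 1 N - spiderCircuitSum k r d α p 0 N) := by
  simp only [spiderCircuitSum, circuitSum, mixedDifference, armWeight, mul_sub,
    Finset.sum_sub_distrib]

theorem circuitCoeff_mul_mixedDifference_nonneg (hk : 2 ≤ k) (h0 : 0 ≤ α) (h1 : α ≤ 1)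
    (hp : 0 < p) (hpt : p < t) (htd : 2 * t ≤ d) (hN : N ≤ k * p + 2)
    (u : Fin N → SpiderVertex k r d) (β : Fin N → Fin (k - 1) → SpiderVertex k r d) :
    0 ≤ circuitCoeff ℝ u β * mixedDifference α p t u β := by
  by_cases hcoeff : circuitCoeff ℝ u β = 0
  · rw [hcoeff, zero_mul]
  · obtain ⟨σ, hσ⟩ := exists_isCircuit_of_circuitCoeff_ne_zero hcoeff
    exact mul_nonneg (circuitCoeff_nonneg u β)
      (hσ.mixedDifference_nonneg hk h0 h1 hp hpt htd hN)

theorem circuitCoeff_mul_mixedDifference_eq_zero (hk : 2 ≤ k) (hp : 0 < p) (hpt : p < t)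
    (htd : 2 * t ≤ d) (hN : N < k * p + 2) (u : Fin N → SpiderVertex k r d)
    (β : Fin N → Fin (k - 1) → SpiderVertex k r d) :
    circuitCoeff ℝ u β * mixedDifference α p t u β = 0 := by
  by_cases hcoeff : circuitCoeff ℝ u β = 0
  · rw [hcoeff, zero_mul]
  · obtain ⟨σ, hσ⟩ := exists_isCircuit_of_circuitCoeff_ne_zero hcoeff
    rw [hσ.mixedDifference_eq_zero hk hp hpt htd hN, mul_zero]

theorem spiderCircuitSum_eq (hk : 2 ≤ k) (hp : 0 < p) (hpt : p < t) (htd : 2 * t ≤ d)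
    (hN : N < k * p + 2)
    (hpath : spiderCircuitSum k r d α p 0 N = spiderCircuitSum k r d α t 0 N) :
    spiderCircuitSum k r d α p 1 N = spiderCircuitSum k r d α t 1 N := by
  have hsum := sum_circuitCoeff_mul_mixedDifference k r d α p t N
  rw [Finset.sum_eq_zero fun u _ => Finset.sum_eq_zero fun β _ =>
    circuitCoeff_mul_mixedDifference_eq_zero hk hp hpt htd hN u β] at hsum
  linarith

/-- Strictness comes from a closed walk that runs through the first `p` hyperedges of the first arm,
with a loop at each of its two ends. -/
theorem spiderCircuitSum_lt (hk : 2 ≤ k) (h0 : 0 < α) (h1 : α < 1) (hp : 0 < p) (hpt : p < t)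
    (htd : 2 * t ≤ d) (hr : 2 < r) (hpath : spiderCircuitSum k r d α p 0 (k * p + 2) =
      spiderCircuitSum k r d α t 0 (k * p + 2)) :
    spiderCircuitSum k r d α p 1 (k * p + 2) < spiderCircuitSum k r d α t 1 (k * p + 2) := by
  let a : Fin r := ⟨0, by omega⟩
  let i : Fin d := ⟨p - 1, by omega⟩
  let j : Fin d := ⟨p, by omega⟩
  have hij : i.val + 1 = j.val := Nat.sub_add_cancel hp
  have hlt : i < j := Fin.lt_def.2 (by omega)
  obtain ⟨v, hvi, hvj⟩ := exists_mem_spiderEdge_of_succ_eq hk a hij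
  obtain ⟨u, β, ⟨σ, hσ⟩, htour⟩ := exists_isArmTour hk hlt hvi
  have hnonneg := circuitCoeff_mul_mixedDifference_nonneg (r := r) hk h0.le h1.le hp hpt htd le_rfl
  have hpos : 0 < circuitCoeff ℝ u β * mixedDifference α p t u β :=
    mul_pos hσ.circuitCoeff_pos (htour.mixedDifference_pos hk h0 h1 hr rfl hlt hvi hvj hpt htd)
  have hsum := Finset.sum_pos' (s := Finset.univ)
    (fun u _ => Finset.sum_nonneg fun β _ => hnonneg u β)
    ⟨u, Finset.mem_univ _, Finset.sum_pos' (s := Finset.univ) (fun β _ => hnonneg u β)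
      ⟨β, Finset.mem_univ _, hpos⟩⟩
  rw [sum_circuitCoeff_mul_mixedDifference] at hsum
  linarith

end SpiderCircuitSum

section StarlikeToSpider

variable {k r d : ℕ} {L : List ℕ}

/-- The inclusion of the vertices of a starlike hypertree into those of a spider. -/
def starlikeToSpider (k : ℕ) (hr : L.length ≤ r) (hD : ∀ a, L.get a ≤ d) :
    StarlikeVertex k L → SpiderVertex k r d :=
  Option.map fun x => (Fin.castLE hr x.1, Fin.castLE (hD x.1) x.2.1, x.2.2)

theorem starlikeToSpider_injective (hr : L.length ≤ r) (hD : ∀ a, L.get a ≤ d) :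
    Function.Injective (starlikeToSpider k hr hD) := by
  refine Option.map_injective ?_
  rintro ⟨a, j, x⟩ ⟨b, i, y⟩ h
  obtain ⟨hab, hji, rfl⟩ := Prod.mk.injEq .. ▸ Prod.mk.injEq .. ▸ h
  obtain rfl := Fin.castLE_injective hr hab
  obtain rfl := Fin.castLE_injective (hD a) hji
  rfl

theorem image_starlikeEdge (hr : L.length ≤ r) (hD : ∀ a, L.get a ≤ d) (a : Fin L.length)
    (j : Fin (L.get a)) :
    starlikeToSpider k hr hD '' starlikeEdge k L a j =
      spiderEdge k (Fin.castLE hr a) (Fin.castLE (hD a) j) := by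
  ext v
  constructor
  · rintro ⟨w, (⟨rfl, h⟩ | ⟨x, rfl⟩ | ⟨i, x, rfl, h⟩), rfl⟩
    · exact none_mem_spiderEdge.2 h
    · exact some_mem_spiderEdge_self _ _ x
    · exact some_mem_spiderEdge.2 ⟨rfl, Or.inr h⟩
  · rintro (⟨rfl, h⟩ | ⟨x, rfl⟩ | ⟨i, x, rfl, hij, hx⟩)
    · exact ⟨none, Or.inl ⟨rfl, h⟩, rfl⟩
    · exact ⟨some ⟨a, j, x⟩, Or.inr (Or.inl ⟨x, rfl⟩), rfl⟩
    · rw [Fin.val_castLE] at hij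
      exact ⟨some ⟨a, ⟨i, by omega⟩, x⟩, Or.inr (Or.inr ⟨_, x, rfl, hij, hx⟩), rfl⟩

theorem spider_edgeSet_eq_image (hr : L.length ≤ r) (hD : ∀ a, L.get a ≤ d) :
    (spider k (fun a : Fin r => L.getD a 0) : Hypergraph (SpiderVertex k r d)).edgeSet =
      Set.image (starlikeToSpider k hr hD) '' (starlike k L).edgeSet := by
  ext e
  constructor
  · rintro ⟨a, j, hj, rfl⟩
    have ha : a.val < L.length := by
      by_contra! ha
      simp [ha] at hj
    replace hj : j.val < L.getD a.val 0 := hj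
    rw [List.getD_eq_getElem _ _ ha] at hj
    exact ⟨_, ⟨⟨a, ha⟩, ⟨j, hj⟩, rfl⟩, image_starlikeEdge hr hD _ _⟩
  · rintro ⟨_, ⟨a, j, rfl⟩, rfl⟩
    refine ⟨Fin.castLE hr a, Fin.castLE (hD a) j, ?_, image_starlikeEdge hr hD a j⟩
    change j.val < L.getD a.val 0
    rw [List.getD_eq_getElem _ _ a.isLt]
    exact j.isLt

theorem circuitSum_starlike (hr : L.length ≤ r) (hD : ∀ a, L.get a ≤ d) {len : Fin r → ℕ}
    (hlen : ∀ a : Fin r, L.getD a 0 = len a) (k : ℕ) (α : ℝ) (N : ℕ) :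
    circuitSum ((starlike k L).alphaTensor k α) N =
      circuitSum ((spider k len : Hypergraph (SpiderVertex k r d)).alphaTensor k α) N := by
  obtain rfl : (fun a : Fin r => L.getD a 0) = len := funext hlen
  exact circuitSum_alphaTensor_eq_of_injective (starlikeToSpider_injective hr hD)
    (spider_edgeSet_eq_image hr hD) k α N

end StarlikeToSpider

/-! ### Paths, distances and cycles -/

section Paths

variable {V W : Type*} {H : Hypergraph V} {H' : Hypergraph W}

/-- The 2-section of a hypergraph: the graph joining distinct vertices that share a hyperedge. -/
def twoSection (H : Hypergraph V) : SimpleGraph V where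
  Adj u v := u ≠ v ∧ H.Adj u v
  symm := ⟨fun _ _ h => ⟨h.1.symm, h.2.symm⟩⟩
  loopless := ⟨fun _ h => h.1 rfl⟩

theorem edist_twoSection_le_one {e : Set V} (he : e ∈ H.edgeSet) {u v : V} (hu : u ∈ e)
    (hv : v ∈ e) : (twoSection H).edist u v ≤ 1 := by
  rw [SimpleGraph.edist_le_one_iff_adj_or_eq]
  exact (eq_or_ne u v).elim Or.inr fun huv => Or.inl ⟨huv, e, he, hu, hv⟩

theorem injective_of_length_eq_dist {u v : V} {w : (twoSection H).Walk u v}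
    (hw : w.length = (twoSection H).dist u v) {e : Fin w.length → Set V}
    (he : ∀ i, e i ∈ H.edgeSet ∧ w.getVert i ∈ e i ∧ w.getVert (i + 1) ∈ e i) :
    Function.Injective e := by
  refine Function.Injective.of_lt_imp_ne fun i j hij hee => ?_
  -- Otherwise the common hyperedge is a shortcut from the `i`-th to the `(j + 1)`-st vertex.
  have hstart := SimpleGraph.edist_le (w.take i)
  have hstep := edist_twoSection_le_one (he i).1 (he i).2.1 (hee ▸ (he j).2.2)
  have hend := SimpleGraph.edist_le (w.drop (j + 1))
  have htriangle : (twoSection H).edist u v ≤ (i + 1 + (w.length - (j + 1)) : ℕ) := by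
    refine SimpleGraph.edist_triangle.trans
      ((add_le_add (SimpleGraph.edist_triangle.trans (add_le_add hstart hstep)) hend).trans ?_)
    rw [SimpleGraph.Walk.take_length, SimpleGraph.Walk.drop_length]
    exact_mod_cast Nat.add_le_add_right (Nat.add_le_add_right (min_le_left _ _) 1) _
  rw [← w.reachable.coe_dist_eq_edist, Nat.cast_le, ← hw] at htriangle
  have := j.isLt
  have : i.val < j.val := hij
  omega

theorem hasPath_of_reachable (hV : H.vertexSet = Set.univ) {u v : V}
    (h : (twoSection H).Reachable u v) : H.HasPath u v ((twoSection H).dist u v) := by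
  obtain ⟨w, hw, hlen⟩ := h.exists_path_of_dist
  choose e he using fun i : Fin w.length => (w.adj_getVert_succ i.isLt).2
  rw [← hlen]
  refine ⟨fun i => w.getVert i, e, fun i j hij => ?_, injective_of_length_eq_dist hlen he, by simp,
    by simp, by simp [hV], he⟩
  exact Fin.ext (hw.getVert_injOn (Nat.le_of_lt_succ i.isLt) (Nat.le_of_lt_succ j.isLt) hij)

theorem dist_le_of_edist_twoSection_le (hV : H.vertexSet = Set.univ) {n : ℕ} {u v : V}
    (h : (twoSection H).edist u v ≤ n) : H.dist u v ≤ n := by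
  have hreach : (twoSection H).Reachable u v :=
    SimpleGraph.reachable_of_edist_ne_top (ne_top_of_le_ne_top (ENat.natCast_ne_top n) h)
  rw [← hreach.coe_dist_eq_edist, Nat.cast_le] at h
  exact (Nat.sInf_le (hasPath_of_reachable hV hreach)).trans h

theorem sub_le_of_hasPath {f : V → ℤ}
    (hf : ∀ e ∈ H.edgeSet, ∀ u ∈ e, ∀ v ∈ e, f v - f u ≤ 1) {u v : V} {l : ℕ}
    (h : H.HasPath u v l) : f v - f u ≤ l := by
  obtain ⟨x, e, _, _, rfl, rfl, _, he⟩ := h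
  suffices hbound : ∀ i : Fin (l + 1), f (x i) - f (x 0) ≤ i by simpa using hbound (Fin.last l)
  intro i
  induction i using Fin.induction with
  | zero => simp
  | succ i ih =>
    have hstep := hf _ (he i).1 _ (he i).2.1 _ (he i).2.2
    rw [Fin.val_castSucc] at ih
    push_cast [Fin.val_succ]
    linarith

theorem hasCycle_of_image {φ : V → W} (hφ : Function.Injective φ)
    (hE : H'.edgeSet = Set.image φ '' H.edgeSet) (h : H.HasCycle) : H'.HasCycle := by
  obtain ⟨p, x, e, hx, he, h⟩ := h
  exact ⟨p, φ ∘ x, fun i => φ '' e i, hφ.comp hx, hφ.image_injective.comp he, fun i =>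
    ⟨hE ▸ ⟨_, (h i).1, rfl⟩, ⟨_, (h i).2.1, rfl⟩, ⟨_, (h i).2.2, rfl⟩⟩⟩

end Paths

theorem spider_not_hasCycle {k r D : ℕ} (hk : 2 ≤ k) (len : Fin r → ℕ) :
    ¬ (spider k len : Hypergraph (SpiderVertex k r D)).HasCycle := by
  rintro ⟨p, x, e, hx, he, h⟩
  choose a j _ hj using fun i => (h i).1
  -- Among the hyperedges of the cycle, the `i`-th is one of those farthest from the centre; it
  -- meets the others only in its vertex `b` nearest to the centre.
  obtain ⟨i, hi⟩ := Finite.exists_max j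
  obtain ⟨b, _, hE⟩ := exists_spiderEdge_eq_insert hk (a i) (j i)
  have hbase : ∀ y i', i' ≠ i → x y ∈ e i → x y ∈ e i' → x y = b := by
    intro y i' hi' hyi hyi'
    rw [hj i, hE] at hyi
    refine hyi.resolve_right ?_
    rintro ⟨z, hz⟩
    rw [← hz, hj i', some_mem_spiderEdge] at hyi'
    obtain ⟨ha, hjj | ⟨hjj, -⟩⟩ := hyi'
    · exact hi' (he (by rw [hj i', hj i, ha, hjj]))
    · have : (j i').val ≤ (j i).val := hi i'
      omega
  have hne : (i + 1 : Fin (p + 2)) ≠ i := by simp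
  have hne' : (i - 1 : Fin (p + 2)) ≠ i := by simp
  have hleft : x i = b := by
    refine hbase i (i - 1) hne' (h i).2.1 ?_
    simpa only [sub_add_cancel] using (h (i - 1)).2.2
  have hright : x (i + 1) = b := hbase (i + 1) (i + 1) hne (h i).2.2 (h (i + 1)).2.1
  exact hne (hx (hright.trans hleft.symm))

/-! ### Starlike hypertrees -/

section Starlike

variable {k d : ℕ} {L : List ℕ}

theorem get_le_sum (L : List ℕ) (a : Fin L.length) : L.get a ≤ L.sum :=
  List.le_sum_of_mem (List.get_mem L a)

theorem starlike_isUniform (hk : 2 ≤ k) (L : List ℕ) : (starlike k L).IsUniform k := by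
  rintro _ ⟨a, j, rfl⟩
  rw [← Set.ncard_image_of_injective _ (starlikeToSpider_injective le_rfl (get_le_sum L)),
    image_starlikeEdge, ncard_spiderEdge hk]

theorem starlikeEdge_injective (hk : 2 ≤ k) (L : List ℕ) : Function.Injective
    fun x : Σ a : Fin L.length, Fin (L.get a) => starlikeEdge k L x.1 x.2 := by
  rintro ⟨a, j⟩ ⟨b, i⟩ h
  have himage := congrArg (Set.image (starlikeToSpider k le_rfl (get_le_sum L))) h
  simp only [image_starlikeEdge, spiderEdge_inj hk] at himage
  obtain rfl := Fin.castLE_injective _ himage.1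
  obtain rfl := Fin.castLE_injective _ himage.2
  rfl

theorem starlike_edgeSet_ncard (hk : 2 ≤ k) (L : List ℕ) :
    (starlike k L).edgeSet.ncard = L.sum := by
  have hrange : (starlike k L).edgeSet = Set.range
      fun x : Σ a : Fin L.length, Fin (L.get a) => starlikeEdge k L x.1 x.2 := by
    ext e
    constructor
    · rintro ⟨a, j, rfl⟩; exact ⟨⟨a, j⟩, rfl⟩
    · rintro ⟨⟨a, j⟩, rfl⟩; exact ⟨a, j, rfl⟩
  rw [hrange, ← Set.image_univ, Set.ncard_image_of_injective _ (starlikeEdge_injective hk L),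
    Set.ncard_univ, Nat.card_eq_fintype_card, Fintype.card_sigma]
  simp

theorem card_starlikeVertex (k : ℕ) (L : List ℕ) :
    Fintype.card (StarlikeVertex k L) = L.sum * (k - 1) + 1 := by
  rw [Fintype.card_option, Fintype.card_sigma]
  simp [← Finset.sum_mul]

theorem starlike_not_hasCycle (hk : 2 ≤ k) (L : List ℕ) : ¬ (starlike k L).HasCycle := fun h =>
  spider_not_hasCycle hk _ (hasCycle_of_image (starlikeToSpider_injective le_rfl (get_le_sum L))
    (spider_edgeSet_eq_image le_rfl (get_le_sum L)) h)

theorem starlikeEdge_mem_edgeSet (a : Fin L.length) (j : Fin (L.get a)) :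
    starlikeEdge k L a j ∈ (starlike k L).edgeSet :=
  ⟨a, j, rfl⟩

theorem some_mem_starlikeEdge (a : Fin L.length) (j : Fin (L.get a)) (y : Fin (k - 1)) :
    (some ⟨a, j, y⟩ : StarlikeVertex k L) ∈ starlikeEdge k L a j :=
  Or.inr (Or.inl ⟨y, rfl⟩)

theorem last_mem_starlikeEdge (hk : 2 ≤ k) (a : Fin L.length) {i j : Fin (L.get a)}
    (hij : i.val + 1 = j.val) :
    (some ⟨a, i, ⟨k - 2, by omega⟩⟩ : StarlikeVertex k L) ∈ starlikeEdge k L a j :=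
  Or.inr (Or.inr ⟨i, ⟨k - 2, by omega⟩, rfl, hij, Nat.sub_add_cancel hk⟩)

theorem edist_none_some_le (hk : 2 ≤ k) (a : Fin L.length) (j : ℕ) (hj : j < L.get a)
    (y : Fin (k - 1)) :
    (twoSection (starlike k L)).edist none (some ⟨a, ⟨j, hj⟩, y⟩) ≤ (j + 1 : ℕ) := by
  induction j generalizing y with
  | zero =>
    exact edist_twoSection_le_one (starlikeEdge_mem_edgeSet a ⟨0, hj⟩) (Or.inl ⟨rfl, rfl⟩)
      (some_mem_starlikeEdge _ _ y)
  | succ j ih =>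
    exact SimpleGraph.edist_triangle.trans (add_le_add (ih (Nat.lt_of_succ_lt hj) ⟨k - 2, by omega⟩)
      (edist_twoSection_le_one (starlikeEdge_mem_edgeSet a ⟨j + 1, hj⟩)
        (last_mem_starlikeEdge hk a rfl) (some_mem_starlikeEdge _ _ y)))

theorem edist_some_some_le (hk : 2 ≤ k) (a : Fin L.length) {i j : Fin (L.get a)} (hij : i ≤ j)
    (y z : Fin (k - 1)) :
    (twoSection (starlike k L)).edist (some ⟨a, i, y⟩) (some ⟨a, j, z⟩) ≤ (j + 1 : ℕ) := by
  obtain ⟨j, hj⟩ := j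
  induction j generalizing z with
  | zero =>
    obtain rfl : i = ⟨0, hj⟩ := Fin.ext (Nat.le_zero.1 hij)
    exact edist_twoSection_le_one (starlikeEdge_mem_edgeSet a _) (some_mem_starlikeEdge _ _ y)
      (some_mem_starlikeEdge _ _ z)
  | succ j ih =>
    rcases hij.eq_or_lt with rfl | hij
    · exact (edist_twoSection_le_one (starlikeEdge_mem_edgeSet a _) (some_mem_starlikeEdge _ _ y)
        (some_mem_starlikeEdge _ _ z)).trans (by norm_cast; omega)
    · exact SimpleGraph.edist_triangle.trans
        (add_le_add (ih ⟨k - 2, by omega⟩ (Nat.lt_of_succ_lt hj) (Nat.le_of_lt_succ hij))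
          (edist_twoSection_le_one (starlikeEdge_mem_edgeSet a ⟨j + 1, hj⟩)
            (last_mem_starlikeEdge hk a rfl) (some_mem_starlikeEdge _ _ z)))

theorem edist_starlike_le (hk : 2 ≤ k) (hle : ∀ a, L.get a ≤ d)
    (hadd : ∀ a b, a ≠ b → L.get a + L.get b ≤ d) (u v : StarlikeVertex k L) :
    (twoSection (starlike k L)).edist u v ≤ d := by
  have hnone : ∀ b (j : Fin (L.get b)) (z : Fin (k - 1)),
      (twoSection (starlike k L)).edist none (some ⟨b, j, z⟩) ≤ (L.get b : ℕ) :=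
    fun b j z => (edist_none_some_le hk b j j.isLt z).trans (Nat.cast_le.2 j.isLt)
  have hsame : ∀ a {i j : Fin (L.get a)} (y z : Fin (k - 1)), i ≤ j →
      (twoSection (starlike k L)).edist (some ⟨a, i, y⟩) (some ⟨a, j, z⟩) ≤ d :=
    fun a i j y z hij => (edist_some_some_le hk a hij y z).trans
      (Nat.cast_le.2 (j.isLt.trans_le (hle a)))
  rcases u with _ | ⟨a, i, y⟩ <;> rcases v with _ | ⟨b, j, z⟩
  · simp
  · exact (hnone b j z).trans (Nat.cast_le.2 (hle b))
  · exact SimpleGraph.edist_comm.le.trans ((hnone a i y).trans (Nat.cast_le.2 (hle a)))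
  rcases eq_or_ne a b with rfl | hab
  · rcases le_total i j with hij | hij
    · exact hsame a y z hij
    · exact SimpleGraph.edist_comm.le.trans (hsame a z y hij)
  · refine (SimpleGraph.edist_triangle (v := none)).trans ((add_le_add
      (SimpleGraph.edist_comm.le.trans (hnone a i y)) (hnone b j z)).trans ?_)
    exact_mod_cast hadd a b hab

theorem starlike_isHypertree (hk : 2 ≤ k) (L : List ℕ) : (starlike k L).IsHypertree k := by
  refine ⟨starlike_isUniform hk L, ⟨⟨none, trivial⟩, fun u _ v _ => ?_⟩,
    starlike_not_hasCycle hk L⟩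
  have hle := edist_starlike_le hk (d := L.sum + L.sum)
    (fun a => (get_le_sum L a).trans (Nat.le_add_left _ _))
    (fun a b _ => Nat.add_le_add (get_le_sum L a) (get_le_sum L b)) u v
  exact ⟨_, hasPath_of_reachable rfl (SimpleGraph.reachable_of_edist_ne_top
    (ne_top_of_le_ne_top (ENat.natCast_ne_top _) hle))⟩

/-- The distance from the centre, counted negatively on arm `a`, positively on arm `b`, and as `0`
on the remaining arms: the potential that bounds from below the lengths of the paths joining the
ends of these two arms. -/
def signedDepth (a b : Fin L.length) : StarlikeVertex k L → ℤ
  | none => 0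
  | some ⟨c, j, _⟩ => if c = a then -(j.val + 1) else if c = b then j.val + 1 else 0

theorem signedDepth_sub_le (a b : Fin L.length) (e : Set (StarlikeVertex k L))
    (he : e ∈ (starlike k L).edgeSet) (u : StarlikeVertex k L) (hu : u ∈ e)
    (v : StarlikeVertex k L) (hv : v ∈ e) :
    signedDepth a b v - signedDepth a b u ≤ 1 := by
  obtain ⟨c, j, rfl⟩ := he
  rcases hu with ⟨rfl, hu⟩ | ⟨y, rfl⟩ | ⟨i, y, rfl, hu, _⟩ <;>
  rcases hv with ⟨rfl, hv⟩ | ⟨z, rfl⟩ | ⟨i', z, rfl, hv, _⟩ <;>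
  simp only [signedDepth] <;> (try split_ifs) <;> omega

theorem starlike_hasDiameter (hk : 2 ≤ k) (hle : ∀ a, L.get a ≤ d)
    (hadd : ∀ a b, a ≠ b → L.get a + L.get b ≤ d) {a b : Fin L.length} (hab : a ≠ b)
    (ha : 0 < L.get a) (hb : 0 < L.get b) (hd : L.get a + L.get b = d) :
    (starlike k L).HasDiameter d := by
  have hdist : ∀ u v, (starlike k L).dist u v ≤ d := fun u v =>
    dist_le_of_edist_twoSection_le rfl (edist_starlike_le hk hle hadd u v)
  refine ⟨?_, by rintro _ ⟨u, -, v, -, rfl⟩; exact hdist u v⟩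
  let u : StarlikeVertex k L := some ⟨a, ⟨L.get a - 1, by omega⟩, ⟨0, by omega⟩⟩
  let v : StarlikeVertex k L := some ⟨b, ⟨L.get b - 1, by omega⟩, ⟨0, by omega⟩⟩
  refine ⟨u, trivial, v, trivial, le_antisymm (hdist u v) ?_⟩
  have hpath : (starlike k L).HasPath u v ((starlike k L).dist u v) :=
    Nat.sInf_mem ((starlike_isHypertree hk L).2.1.2 u trivial v trivial)
  have hpotential : signedDepth a b v - signedDepth a b u = L.get a + L.get b := by
    simp only [signedDepth, u, v, if_true, if_neg hab.symm]
    omega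
  have := sub_le_of_hasPath (signedDepth_sub_le a b) hpath
  omega

/-- The arm lengths `p, q, 1, …, 1` with `s` ones. -/
abbrev armList (p q s : ℕ) : List ℕ := p :: q :: List.replicate s 1

theorem armList_get (p q s : ℕ) (a : Fin (armList p q s).length) :
    (armList p q s).get a = if a.val = 0 then p else if a.val = 1 then q else 1 := by
  obtain ⟨_ | _ | n, hn⟩ := a <;> simp

theorem armList_sum (p q s : ℕ) : (armList p q s).sum = p + q + s := by
  simp [add_assoc]

theorem starlike_armList_hasDiameter (hk : 2 ≤ k) {p q : ℕ} (s : ℕ) (hp : 0 < p) (hq : 0 < q) :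
    (starlike k (armList p q s)).HasDiameter (p + q) := by
  refine starlike_hasDiameter hk (fun a => ?_) (fun a b hab => ?_) (a := ⟨0, by simp⟩)
    (b := ⟨1, by simp⟩) (by simp) hp hq rfl
  · rw [armList_get]; split_ifs <;> omega
  · have : a.val ≠ b.val := fun h => hab (Fin.ext h)
    rw [armList_get, armList_get]; split_ifs <;> omega

end Starlike

/-! ### The number of vertices of a hypertree -/

section IncidenceGraph

variable {V : Type*} {H : Hypergraph V} {k : ℕ}

/-- The bipartite graph joining each vertex of a hypergraph to the hyperedges containing it. -/
def incidenceGraph (H : Hypergraph V) : SimpleGraph (V ⊕ H.edgeSet) where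
  Adj
    | .inl v, .inr e => v ∈ e.1
    | .inr e, .inl v => v ∈ e.1
    | _, _ => False
  symm := ⟨by rintro (_ | _) (_ | _) h <;> exact h⟩
  loopless := ⟨by rintro (_ | _) h <;> exact h⟩

theorem incidenceGraph_adj_inl_inr {v : V} {e : H.edgeSet} :
    (incidenceGraph H).Adj (.inl v) (.inr e) ↔ v ∈ e.1 :=
  Iff.rfl

theorem incidenceGraph_adj_inr_inl {v : V} {e : H.edgeSet} :
    (incidenceGraph H).Adj (.inr e) (.inl v) ↔ v ∈ e.1 :=
  Iff.rfl

theorem incidenceGraph_isBipartiteWith (H : Hypergraph V) :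
    (incidenceGraph H).IsBipartiteWith (Set.range Sum.inl) (Set.range Sum.inr) where
  disjoint := Set.isCompl_range_inl_range_inr.disjoint
  mem_of_adj := by rintro (v | e) (w | f) h <;> first | exact h.elim | simp

theorem reachable_of_hasPath {u v : V} {l : ℕ} (h : H.HasPath u v l) :
    (incidenceGraph H).Reachable (.inl u) (.inl v) := by
  obtain ⟨x, e, _, _, rfl, rfl, _, he⟩ := h
  suffices hreach : ∀ i, (incidenceGraph H).Reachable (.inl (x 0)) (.inl (x i)) from
    hreach (Fin.last l)
  intro i
  induction i using Fin.induction with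
  | zero => exact .rfl
  | succ i ih =>
    obtain ⟨hi, hleft, hright⟩ := he i
    have hadj : (incidenceGraph H).Adj (.inl (x i.castSucc)) (.inr ⟨e i, hi⟩) := hleft
    have hadj' : (incidenceGraph H).Adj (.inr ⟨e i, hi⟩) (.inl (x i.succ)) := hright
    exact ih.trans (hadj.reachable.trans hadj'.reachable)

theorem incidenceGraph_connected (hV : H.vertexSet = Set.univ) (hH : H.IsConnected)
    (hne : ∀ e ∈ H.edgeSet, e.Nonempty) : (incidenceGraph H).Connected := by
  obtain ⟨⟨u, hu⟩, hpath⟩ := hH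
  rw [SimpleGraph.connected_iff_exists_forall_reachable]
  have hreach : ∀ v, (incidenceGraph H).Reachable (.inl u) (.inl v) := fun v =>
    reachable_of_hasPath (hpath u hu v (hV ▸ Set.mem_univ v)).choose_spec
  refine ⟨.inl u, ?_⟩
  rintro (v | ⟨e, he⟩)
  · exact hreach v
  · obtain ⟨v, hv⟩ := hne e he
    have hadj : (incidenceGraph H).Adj (.inl v) (.inr ⟨e, he⟩) := hv
    exact (hreach v).trans hadj.reachable

theorem isLeft_getVert_iff {v : V} {b : V ⊕ H.edgeSet} (w : (incidenceGraph H).Walk (.inl v) b)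
    {i : ℕ} (hi : i ≤ w.length) : (w.getVert i).isLeft ↔ Even i := by
  let c : (incidenceGraph H).Coloring Bool :=
    .mk Sum.isLeft (by rintro (_ | _) (_ | _) h <;> first | exact h.elim | simp)
  have hcolor : Even (w.take i).length ↔ (true ↔ (w.getVert i).isLeft) :=
    c.even_length_iff_congr (w.take i)
  rw [SimpleGraph.Walk.take_length, min_eq_left hi] at hcolor
  simpa using hcolor.symm

theorem hasCycle_of_isCycle {v : V} {w : (incidenceGraph H).Walk (.inl v) (.inl v)}
    (hw : w.IsCycle) : H.HasCycle := by
  obtain ⟨p, hp⟩ : ∃ p, w.length = 2 * (p + 2) := by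
    obtain ⟨c, hc⟩ := (isLeft_getVert_iff w le_rfl).1 (by simp)
    have := hw.three_le_length
    exact ⟨c - 2, by omega⟩
  have heven : ∀ i : Fin (p + 2), ∃ x, w.getVert (2 * i) = .inl x := fun i =>
    Sum.isLeft_iff.1 ((isLeft_getVert_iff w (by omega)).2 (by simp))
  have hodd : ∀ i : Fin (p + 2), ∃ e, w.getVert (2 * i + 1) = .inr e := fun i =>
    Sum.isRight_iff.1 (Sum.not_isLeft.1 ((isLeft_getVert_iff w (by omega)).not.2 (by simp)))
  choose x hx using heven
  choose e he using hodd
  have hnext : ∀ i, w.getVert (2 * i.val + 1 + 1) = .inl (x (i + 1)) := by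
    intro i
    rcases eq_or_ne i (Fin.last (p + 1)) with rfl | hi
    · rw [show 2 * (Fin.last (p + 1)).val + 1 + 1 = w.length by rw [Fin.val_last]; omega,
        w.getVert_length, ← hx]
      simp
    · rw [← hx, Fin.val_add_one_of_lt (Fin.lt_last_iff_ne_last.2 hi), mul_add, mul_one]
  refine ⟨p, x, fun i => (e i).1, fun i j hij => ?_, fun i j hij => ?_, fun i => ⟨(e i).2, ?_, ?_⟩⟩
  · have := hw.getVert_injOn' (x₁ := 2 * i.val) (x₂ := 2 * j.val) (by simp; omega)
      (by simp; omega) (by rw [hx, hx, hij])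
    exact Fin.ext (by omega)
  · have := hw.getVert_injOn (x₁ := 2 * i.val + 1) (x₂ := 2 * j.val + 1) (by simp; omega)
      (by simp; omega) (by rw [he, he, Subtype.ext hij])
    exact Fin.ext (by omega)
  · have hadj := w.adj_getVert_succ (i := 2 * i.val) (by omega)
    rwa [hx, he, incidenceGraph_adj_inl_inr] at hadj
  · have hadj := w.adj_getVert_succ (i := 2 * i.val + 1) (by omega)
    rwa [hnext, he, incidenceGraph_adj_inr_inl] at hadj

theorem incidenceGraph_isAcyclic (h : ¬ H.HasCycle) : (incidenceGraph H).IsAcyclic := by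
  classical
  rintro (v | e) c hc
  · exact h (hasCycle_of_isCycle hc)
  · have hadj := c.adj_getVert_succ (i := 0) (by have := hc.three_le_length; omega)
    rw [c.getVert_zero] at hadj
    rcases hsnd : c.getVert (0 + 1) with v | f
    · exact h (hasCycle_of_isCycle (hc.rotate (hsnd ▸ c.getVert_mem_support _)))
    · rw [hsnd] at hadj
      exact hadj

theorem degree_incidenceGraph_inr (e : H.edgeSet)
    [Fintype ((incidenceGraph H).neighborSet (.inr e))] :
    (incidenceGraph H).degree (.inr e) = e.1.ncard := by
  have hneighbor : (incidenceGraph H).neighborSet (.inr e) = Sum.inl '' e.1 := by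
    ext (v | f)
    · simp [incidenceGraph_adj_inr_inl]
    · simp [incidenceGraph]
  rw [← SimpleGraph.card_neighborSet_eq_degree, ← Nat.card_eq_fintype_card, Nat.card_coe_set_eq,
    hneighbor, Set.ncard_image_of_injective _ Sum.inl_injective]

theorem card_eq_of_isHypertree [Fintype V] (hk : 1 ≤ k) (hV : H.vertexSet = Set.univ)
    (hH : H.IsHypertree k) : Fintype.card V = H.edgeSet.ncard * (k - 1) + 1 := by
  classical
  obtain ⟨huniform, hconnected, hcycle⟩ := hH
  have : Fintype H.edgeSet := Fintype.ofFinite _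
  have htree : (incidenceGraph H).IsTree :=
    ⟨incidenceGraph_connected hV hconnected fun e he =>
      Set.nonempty_of_ncard_ne_zero (by rw [huniform e he]; omega), incidenceGraph_isAcyclic hcycle⟩
  have hedges : (incidenceGraph H).edgeFinset.card = H.edgeSet.ncard * k := by
    rw [← SimpleGraph.isBipartiteWith_sum_degrees_eq_card_edges'
      (s := Finset.univ.map .inl) (t := Finset.univ.map .inr)
      (by simpa using incidenceGraph_isBipartiteWith H), Finset.sum_map]
    refine (Finset.sum_congr rfl fun e _ =>
      (degree_incidenceGraph_inr e).trans (huniform _ e.2)).trans ?_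
    rw [Finset.sum_const, Finset.card_univ, smul_eq_mul, ← Nat.card_eq_fintype_card,
      Nat.card_coe_set_eq]
  have hcard := htree.card_edgeFinset
  rw [hedges, Fintype.card_sum, ← Nat.card_eq_fintype_card (α := H.edgeSet),
    Nat.card_coe_set_eq] at hcard
  obtain ⟨k, rfl⟩ := Nat.exists_eq_add_of_le' hk
  rw [Nat.add_sub_cancel]
  linarith

end IncidenceGraph

/-! ### Recognising starlike hypertrees -/

section Paths

variable {V : Type*} {H : Hypergraph V} {x : ℕ → V} {e : ℕ → Set V} {d : ℕ}

/-- `x 0, …, x d` and `e 0, …, e (d - 1)` are the vertices and hyperedges of a path of `H`. Indexing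
by natural numbers, with arbitrary values beyond `d`, makes it easy to shift and reverse paths. -/
structure IsPath (H : Hypergraph V) (x : ℕ → V) (e : ℕ → Set V) (d : ℕ) : Prop where
  vertex_inj : ∀ i ≤ d, ∀ j ≤ d, x i = x j → i = j
  edge_inj : ∀ i < d, ∀ j < d, e i = e j → i = j
  edge_mem : ∀ i < d, e i ∈ H.edgeSet
  left_mem : ∀ i < d, x i ∈ e i
  right_mem : ∀ i < d, x (i + 1) ∈ e i

theorem exists_isPath_of_hasPath {u v : V} (h : H.HasPath u v d) : ∃ x e, IsPath H x e d := by
  obtain ⟨x, e, hx, he, _, _, _, h⟩ := h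
  refine ⟨fun i => x (Fin.ofNat (d + 1) i), fun i => if hi : i < d then e ⟨i, hi⟩ else ∅,
    fun i hi j hj hij => ?_, fun i hi j hj hij => ?_, fun i hi => ?_, fun i hi => ?_,
    fun i hi => ?_⟩
  · have hmod := congrArg Fin.val (hx hij)
    rwa [Fin.val_ofNat, Fin.val_ofNat, Nat.mod_eq_of_lt (Nat.lt_succ_of_le hi),
      Nat.mod_eq_of_lt (Nat.lt_succ_of_le hj)] at hmod
  · simp only [hi, hj, dif_pos] at hij
    exact congrArg Fin.val (he hij)
  · simpa only [hi, dif_pos] using (h ⟨i, hi⟩).1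
  · have hcast : Fin.ofNat (d + 1) i = Fin.castSucc ⟨i, hi⟩ :=
      Fin.ext (Nat.mod_eq_of_lt (by omega))
    simpa only [hi, dif_pos, hcast] using (h ⟨i, hi⟩).2.1
  · have hsucc : Fin.ofNat (d + 1) (i + 1) = Fin.succ ⟨i, hi⟩ :=
      Fin.ext (Nat.mod_eq_of_lt (by omega))
    simpa only [hi, dif_pos, hsucc] using (h ⟨i, hi⟩).2.2

theorem exists_isPath_of_hasDiameter (hC : H.IsConnected) (h : H.HasDiameter d) :
    ∃ x e, IsPath H x e d := by
  obtain ⟨⟨u, hu, v, hv, rfl⟩, _⟩ := h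
  exact exists_isPath_of_hasPath (Nat.sInf_mem (s := {l | H.HasPath u v l}) (hC.2 u hu v hv))

theorem isPath_one {f : Set V} {u v : V} (hf : f ∈ H.edgeSet) (hu : u ∈ f) (hv : v ∈ f)
    (huv : u ≠ v) : IsPath H (fun i => if i = 0 then u else v) (fun _ => f) 1 where
  vertex_inj i hi j hj hij := by
    interval_cases i <;> interval_cases j <;> simp_all
  edge_inj i _ j _ _ := by omega
  edge_mem _ _ := hf
  left_mem i hi := by simpa [Nat.lt_one_iff.1 hi] using hu
  right_mem _ _ := by simpa using hv

namespace IsPath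

theorem reverse (h : IsPath H x e d) :
    IsPath H (fun i => x (d - i)) (fun i => e (d - 1 - i)) d where
  vertex_inj i hi j hj hij := by
    have hsub := h.vertex_inj _ (Nat.sub_le d i) _ (Nat.sub_le d j) hij
    omega
  edge_inj i hi j hj hij := by
    have hsub := h.edge_inj _ (by omega) _ (by omega) hij
    omega
  edge_mem i hi := h.edge_mem _ (by omega)
  left_mem i hi := by
    have hright := h.right_mem (d - 1 - i) (by omega)
    rwa [show d - 1 - i + 1 = d - i by omega] at hright
  right_mem i hi := by
    have hleft := h.left_mem (d - 1 - i) (by omega)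
    rwa [show d - 1 - i = d - (i + 1) by omega] at hleft ⊢

theorem take (h : IsPath H x e d) {q : ℕ} (hq : q ≤ d) : IsPath H x e q where
  vertex_inj i hi j hj := h.vertex_inj i (hi.trans hq) j (hj.trans hq)
  edge_inj i hi j hj := h.edge_inj i (hi.trans_le hq) j (hj.trans_le hq)
  edge_mem i hi := h.edge_mem i (hi.trans_le hq)
  left_mem i hi := h.left_mem i (hi.trans_le hq)
  right_mem i hi := h.right_mem i (hi.trans_le hq)

theorem drop (h : IsPath H x e d) (q : ℕ) :
    IsPath H (fun i => x (q + i)) (fun i => e (q + i)) (d - q) where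
  vertex_inj i hi j hj hij := by
    rcases le_or_gt q d with hq | hq
    · exact Nat.add_left_cancel (h.vertex_inj _ (by omega) _ (by omega) hij)
    · omega
  edge_inj i hi j hj hij := Nat.add_left_cancel (h.edge_inj _ (by omega) _ (by omega) hij)
  edge_mem i hi := h.edge_mem _ (by omega)
  left_mem i hi := h.left_mem _ (by omega)
  right_mem i hi := h.right_mem _ (by omega)

theorem right_mem_pred (h : IsPath H x e d) {i : ℕ} (hi : 0 < i) (hid : i ≤ d) :
    x i ∈ e (i - 1) := by
  have hright := h.right_mem (i - 1) (by omega)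
  rwa [Nat.sub_add_cancel hi] at hright

theorem edge_pred_ne (h : IsPath H x e d) {i : ℕ} (hi : 0 < i) (hid : i < d) : e (i - 1) ≠ e i :=
  fun heq => by
    have hpred := h.edge_inj _ (by omega) _ hid heq
    omega

theorem hasCycle_of_mem (h : IsPath H x e d) {i j : ℕ} (hij : i < j) (hj : j < d)
    (hmem : x i ∈ e j) : H.HasCycle := by
  refine ⟨j - i - 1, fun a => x (i + a), fun a => e (i + a), fun a b hab => ?_, fun a b hab => ?_,
    fun a => ⟨h.edge_mem _ (by omega), h.left_mem _ (by omega), ?_⟩⟩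
  · exact Fin.ext (Nat.add_left_cancel (h.vertex_inj _ (by omega) _ (by omega) hab))
  · exact Fin.ext (Nat.add_left_cancel (h.edge_inj _ (by omega) _ (by omega) hab))
  · by_cases ha : a = Fin.last (j - i - 1 + 1)
    · subst ha
      simp only [Fin.last_add_one, Fin.val_zero, add_zero, Fin.val_last]
      rwa [show i + (j - i - 1 + 1) = j by omega]
    · simp only [Fin.val_add_one_of_lt (Fin.lt_last_iff_ne_last.2 ha)]
      exact h.right_mem _ (by omega)

theorem eq_or_eq_of_mem (h : IsPath H x e d) (hA : ¬ H.HasCycle) {i j : ℕ} (hi : i ≤ d)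
    (hj : j < d) (hmem : x i ∈ e j) : j = i ∨ j = i - 1 := by
  rcases lt_trichotomy i j with hij | hij | hij
  · exact absurd (h.hasCycle_of_mem hij hj hmem) hA
  · exact Or.inl hij.symm
  · by_contra hne
    refine hA (h.reverse.hasCycle_of_mem (i := d - i) (j := d - 1 - j) (by omega) (by omega) ?_)
    rwa [show d - (d - i) = i by omega, show d - 1 - (d - 1 - j) = j by omega]

end IsPath

end Paths

section StarOfPaths

variable {V : Type*} {k : ℕ} {H : Hypergraph V} {c : V} {L : List ℕ}
  {y : Fin L.length → ℕ → V} {F : Fin L.length → ℕ → Set V}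

/-- A family of paths of `H` with lengths `L`, all starting at `c` and without common hyperedges:
the `a`-th path has the vertices `y a j` and the hyperedges `F a j`. -/
structure IsStarOfPaths (H : Hypergraph V) (c : V) (L : List ℕ) (y : Fin L.length → ℕ → V)
    (F : Fin L.length → ℕ → Set V) : Prop where
  isPath : ∀ a, IsPath H (y a) (F a) (L.get a)
  zero_eq : ∀ a, y a 0 = c
  edge_ne : ∀ a b, a < b → ∀ i < L.get a, ∀ j < L.get b, F a i ≠ F b j

theorem exists_range_eq_and_apply_eq {S : Set V} {N : ℕ} (hN : S.ncard = N) {z : V} (hz : z ∈ S)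
    (i : Fin N) : ∃ ν : Fin N → V, Set.range ν = S ∧ ν i = z := by
  classical
  have hfin : Finite S := Set.finite_of_ncard_ne_zero (hN ▸ (Fin.pos i).ne')
  let f : Fin N ≃ S := (Finite.equivFinOfCardEq (by rw [Nat.card_coe_set_eq, hN])).symm
  refine ⟨fun j => f.setValue i ⟨z, hz⟩ j, ?_, by simp⟩
  exact ((f.setValue i ⟨z, hz⟩).surjective.range_comp _).trans Subtype.range_coe

namespace IsStarOfPaths

theorem injective (h : IsStarOfPaths H c L y F) :
    Function.Injective fun s : Σ a, Fin (L.get a) => F s.1 s.2 := by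
  rintro ⟨a, i⟩ ⟨b, j⟩ hij
  rcases lt_trichotomy a b with hab | rfl | hab
  · exact absurd hij (h.edge_ne a b hab i i.isLt j j.isLt)
  · rw [Fin.ext ((h.isPath a).edge_inj i i.isLt j j.isLt hij)]
  · exact absurd hij.symm (h.edge_ne b a hab j j.isLt i i.isLt)

theorem range_eq_edgeSet (h : IsStarOfPaths H c L y F) (hE : H.edgeSet.Finite)
    (hcard : H.edgeSet.ncard = L.sum) :
    Set.range (fun s : Σ a, Fin (L.get a) => F s.1 s.2) = H.edgeSet := by
  refine Set.eq_of_subset_of_ncard_le ?_ (le_of_eq ?_) hE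
  · rintro _ ⟨s, rfl⟩
    exact (h.isPath s.1).edge_mem _ s.2.isLt
  · rw [← Set.image_univ, Set.ncard_image_of_injective _ h.injective, Set.ncard_univ,
      Nat.card_eq_fintype_card, Fintype.card_sigma, hcard]
    simp

theorem exists_image_starlikeEdge_eq (hk : 2 ≤ k) (hU : H.IsUniform k)
    (h : IsStarOfPaths H c L y F) :
    ∃ ψ : StarlikeVertex k L → V, ∀ a j, ψ '' starlikeEdge k L a j = F a j := by
  have hν : ∀ a, ∀ j : Fin (L.get a), ∃ ν : Fin (k - 1) → V,
      Set.range ν = F a j \ {y a j} ∧ ν ⟨k - 2, by omega⟩ = y a (j + 1) := fun a j => by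
    have hne : y a (j + 1) ≠ y a j := fun heq => by
      have hsucc := (h.isPath a).vertex_inj _ j.isLt _ j.isLt.le heq
      omega
    have hmem : y a (j + 1) ∈ F a j \ {y a j} := ⟨(h.isPath a).right_mem j j.isLt, hne⟩
    refine exists_range_eq_and_apply_eq ?_ hmem _
    rw [Set.ncard_sdiff_singleton_of_mem ((h.isPath a).left_mem j j.isLt),
      hU _ ((h.isPath a).edge_mem j j.isLt)]
  choose ν hrange hlast using hν
  refine ⟨fun v => v.elim c fun s => ν s.1 s.2.1 s.2.2, fun a j => ?_⟩
  rw [← Set.insert_sdiff_self_of_mem ((h.isPath a).left_mem j j.isLt), ← hrange]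
  ext v
  constructor
  · rintro ⟨_, ⟨rfl, hj⟩ | ⟨r, rfl⟩ | ⟨i, r, rfl, hij, hr⟩, rfl⟩
    · exact Or.inl (by rw [hj, h.zero_eq]; rfl)
    · exact Or.inr ⟨r, rfl⟩
    · have hr : r = ⟨k - 2, by omega⟩ := Fin.ext (Nat.eq_sub_of_add_eq hr)
      exact Or.inl (by rw [← hij, ← hlast, hr]; rfl)
  · rintro (rfl | ⟨r, rfl⟩)
    · rcases hj : j.val with _ | i
      · exact ⟨none, Or.inl ⟨rfl, hj⟩, (h.zero_eq a).symm⟩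
      · exact ⟨_, last_mem_starlikeEdge hk a (i := ⟨i, by omega⟩) hj.symm, hlast a ⟨i, by omega⟩⟩
    · exact ⟨_, some_mem_starlikeEdge a j r, rfl⟩

end IsStarOfPaths

theorem iso_of_bijective {W : Type*} {H' : Hypergraph W} {ψ : W → V} (hψ : Function.Bijective ψ)
    (hV : H.vertexSet = Set.univ) (hW : H'.vertexSet = Set.univ)
    (hE : Set.image ψ '' H'.edgeSet = H.edgeSet) : H.Iso H' := by
  let φ := Equiv.ofBijective ψ hψ
  have hinv : ∀ v, φ.symm (ψ v) = v := φ.symm_apply_apply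
  refine ⟨φ.symm, Hypergraph.ext ?_ ?_⟩
  · change φ.symm '' H.vertexSet = H'.vertexSet
    rw [hV, hW, Set.image_univ, φ.symm.surjective.range_eq]
  · change Set.image φ.symm '' H.edgeSet = H'.edgeSet
    simp only [← hE, Set.image_image, hinv, Set.image_id']

theorem IsStarOfPaths.iso_starlike [Fintype V] (hk : 2 ≤ k) (hV : H.vertexSet = Set.univ)
    (hU : H.IsUniform k) (hcov : ∀ v, ∃ f ∈ H.edgeSet, v ∈ f) (hE : H.edgeSet.ncard = L.sum)
    (hcard : Fintype.card V = L.sum * (k - 1) + 1) (h : IsStarOfPaths H c L y F) :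
    H.Iso (starlike k L) := by
  obtain ⟨ψ, hψ⟩ := h.exists_image_starlikeEdge_eq hk hU
  have hrange := h.range_eq_edgeSet (Set.toFinite _) hE
  have himage : Set.image ψ '' (starlike k L).edgeSet = H.edgeSet := by
    rw [← hrange]
    ext f
    constructor
    · rintro ⟨_, ⟨a, j, rfl⟩, rfl⟩
      exact ⟨⟨a, j⟩, (hψ a j).symm⟩
    · rintro ⟨⟨a, j⟩, rfl⟩
      exact ⟨_, starlikeEdge_mem_edgeSet a j, hψ a j⟩
  have hsurj : Function.Surjective ψ := fun v => by
    obtain ⟨f, hf, hv⟩ := hcov v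
    obtain ⟨g, -, rfl⟩ := himage ▸ hf
    exact Set.mem_range_of_mem_image ψ g hv
  exact iso_of_bijective ((Fintype.bijective_iff_surjective_and_card ψ).2
    ⟨hsurj, by rw [card_starlikeVertex, hcard]⟩) hV rfl himage

end StarOfPaths

section BranchingPath

variable {V : Type*} {k : ℕ} {H : Hypergraph V}

theorem exists_mem_of_isHypertree (hk : 2 ≤ k) (hV : H.vertexSet = Set.univ)
    (hH : H.IsHypertree k) (hE : H.edgeSet.Nonempty) (v : V) : ∃ f ∈ H.edgeSet, v ∈ f := by
  obtain ⟨f, hf⟩ := hE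
  obtain ⟨z, -, hzv⟩ := Set.exists_ne_of_one_lt_ncard (by rw [hH.1 f hf]; omega : 1 < f.ncard) v
  obtain ⟨l, x, g, -, -, rfl, rfl, -, h⟩ := hH.2.1.2 v (hV ▸ trivial) z (hV ▸ trivial)
  rcases l with _ | l
  · exact absurd rfl hzv
  · exact ⟨g 0, (h 0).1, (h 0).2.1⟩

variable {x : ℕ → V} {e : ℕ → Set V} {d q s : ℕ}

theorem IsPath.exists_pendant_edges [Finite V] (h : IsPath H x e d) (hA : ¬ H.HasCycle)
    (hq : 0 < q) (hqd : q < d) (hdeg : H.degree (x q) = s + 2) :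
    ∃ g : Fin s → Set V, Function.Injective g ∧
      ∀ i, g i ∈ H.edgeSet ∧ x q ∈ g i ∧ ∀ j < d, g i ≠ e j := by
  let S : Set (Set V) := {f ∈ H.edgeSet | x q ∈ f} \ {e (q - 1), e q}
  have hpair : {e (q - 1), e q} ⊆ {f ∈ H.edgeSet | x q ∈ f} := by
    rintro f (rfl | rfl)
    · exact ⟨h.edge_mem _ (by omega), h.right_mem_pred hq hqd.le⟩
    · exact ⟨h.edge_mem _ hqd, h.left_mem _ hqd⟩
  have hcard : Nat.card S = s := by
    rw [Nat.card_coe_set_eq, Set.ncard_sdiff hpair (Set.toFinite _),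
      Set.ncard_pair (h.edge_pred_ne hq hqd)]
    exact congrArg (· - 2) hdeg
  let f : S ≃ Fin s := Finite.equivFinOfCardEq hcard
  refine ⟨fun i => f.symm i, Subtype.val_injective.comp f.symm.injective, fun i => ?_⟩
  obtain ⟨⟨hmem, hxq⟩, hne⟩ := (f.symm i).2
  refine ⟨hmem, hxq, fun j hj heq => hne ?_⟩
  rcases h.eq_or_eq_of_mem hA hqd.le hj (heq ▸ hxq) with rfl | rfl
  · exact Or.inr heq
  · exact Or.inl heq

theorem IsPath.exists_isStarOfPaths [Finite V] (hk : 2 ≤ k) (hU : H.IsUniform k)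
    (hA : ¬ H.HasCycle) (h : IsPath H x e d) (hq : 0 < q) (hqd : q < d)
    (hdeg : H.degree (x q) = s + 2) :
    ∃ y F, IsStarOfPaths H (x q) (armList q (d - q) s) y F := by
  obtain ⟨g, hinj, hg⟩ := h.exists_pendant_edges hA hq hqd hdeg
  choose z hz hzq using fun i => Set.exists_ne_of_one_lt_ncard
    (by rw [hU _ (hg i).1]; omega : 1 < (g i).ncard) (x q)
  have hlen : ∀ {i}, i + 2 < (armList q (d - q) s).length → i < s := fun hi => by simpa using hi
  let y : Fin (armList q (d - q) s).length → ℕ → V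
    | ⟨0, _⟩ => fun j => x (q - j)
    | ⟨1, _⟩ => fun j => x (q + j)
    | ⟨i + 2, hi⟩ => fun j => if j = 0 then x q else z ⟨i, hlen hi⟩
  let F : Fin (armList q (d - q) s).length → ℕ → Set V
    | ⟨0, _⟩ => fun j => e (q - 1 - j)
    | ⟨1, _⟩ => fun j => e (q + j)
    | ⟨i + 2, hi⟩ => fun _ => g ⟨i, hlen hi⟩
  refine ⟨y, F, ?_, ?_, ?_⟩
  · rintro ⟨_ | _ | i, hi⟩
    · exact (h.take hqd.le).reverse
    · exact h.drop q
    · rw [armList_get, if_neg (by simp), if_neg (by simp)]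
      exact isPath_one (hg _).1 (hg _).2.1 (hz _) (hzq _).symm
  · rintro ⟨_ | _ | i, hi⟩ <;> rfl
  · rintro ⟨_ | _ | a, ha⟩ ⟨_ | _ | b, hb⟩ hab i hi j hj heq
    all_goals simp only [armList_get, Fin.mk_lt_mk] at hi hj hab
    all_goals try omega
    · have hij := h.edge_inj _ (by omega) _ (by simp at hj; omega) heq
      simp at hi
      omega
    · exact (hg _).2.2 _ (by omega) heq.symm
    · exact (hg _).2.2 _ (by simp at hi; omega) heq.symm
    · have hab' := congrArg Fin.val (hinj heq)
      simp only at hab'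
      omega

theorem IsPath.iso_starlike [Finite V] (hk : 2 ≤ k) (hV : H.vertexSet = Set.univ)
    (hH : H.IsHypertree k) (hE : H.edgeSet.ncard = d + s) (h : IsPath H x e d) (hq : 0 < q)
    (hqd : q < d) (hdeg : H.degree (x q) = s + 2) : H.Iso (starlike k (armList q (d - q) s)) := by
  have := Fintype.ofFinite V
  obtain ⟨y, F, hstar⟩ := h.exists_isStarOfPaths hk hH.1 hH.2.2 hq hqd hdeg
  have hsum : H.edgeSet.ncard = (armList q (d - q) s).sum := by
    rw [hE, armList_sum]
    omega
  exact hstar.iso_starlike hk hV hH.1 (exists_mem_of_isHypertree hk hV hH ⟨e q, h.edge_mem q hqd⟩)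
    hsum (hsum ▸ card_eq_of_isHypertree (by omega) hV hH)

end BranchingPath

/-! ### Sums of squares of degrees -/

section SumOfSquares

variable {V : Type*} [Fintype V]

theorem sum_indicator_one_eq_ncard (I : Set V) : ∑ v, I.indicator (1 : V → ℕ) v = I.ncard := by
  classical
  simp only [Set.indicator_apply, Pi.one_apply, Finset.sum_boole, Nat.cast_id,
    Set.ncard_eq_toFinset_card', Set.filter_mem_univ_eq_toFinset]

theorem sum_one_add_indicator_add_sq (I : Set V) (b : V → ℕ) :
    ∑ v, (1 + I.indicator 1 v + b v) ^ 2 +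
        ∑ v, b v * (2 * (1 - I.indicator 1 v) + (∑ w, b w - b v)) =
      Fintype.card V + 3 * I.ncard + 4 * ∑ v, b v + (∑ v, b v) ^ 2 := by
  classical
  have hle : ∀ v, b v ≤ ∑ w, b w := fun v => Finset.single_le_sum_of_canonicallyOrdered (by simp)
  rw [← sum_indicator_one_eq_ncard, sq (∑ v, b v), Finset.sum_mul, ← Finset.card_univ,
    Finset.card_eq_sum_ones, Finset.mul_sum, Finset.mul_sum, ← Finset.sum_add_distrib,
    ← Finset.sum_add_distrib, ← Finset.sum_add_distrib, ← Finset.sum_add_distrib]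
  refine Finset.sum_congr rfl fun v _ => ?_
  obtain ⟨t, ht⟩ := Nat.exists_eq_add_of_le (hle v)
  rw [ht, Nat.add_sub_cancel_left, Set.indicator_apply]
  split_ifs
  · simp only [Pi.one_apply, Nat.sub_self]
    ring
  · simp only [Nat.sub_zero]
    ring

theorem sum_one_add_indicator_add_sq_le (I : Set V) (b : V → ℕ) :
    ∑ v, (1 + I.indicator 1 v + b v) ^ 2 ≤
      Fintype.card V + 3 * I.ncard + 4 * ∑ v, b v + (∑ v, b v) ^ 2 :=
  Nat.le.intro (sum_one_add_indicator_add_sq I b)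

theorem sum_one_add_indicator_add_sq_eq_iff {I : Set V} (hI : I.Nonempty) (b : V → ℕ) :
    ∑ v, (1 + I.indicator 1 v + b v) ^ 2 =
        Fintype.card V + 3 * I.ncard + 4 * ∑ v, b v + (∑ v, b v) ^ 2 ↔
      ∃ v ∈ I, b v = ∑ w, b w := by
  classical
  have hle : ∀ v, b v ≤ ∑ w, b w := fun v => Finset.single_le_sum_of_canonicallyOrdered (by simp)
  rw [← sum_one_add_indicator_add_sq, left_eq_add, Finset.sum_eq_zero_iff]
  constructor
  · intro hzero
    rcases eq_or_ne (∑ w, b w) 0 with hsum | hsum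
    · obtain ⟨v, hv⟩ := hI
      exact ⟨v, hv, by have := hle v; omega⟩
    · obtain ⟨v, hv, hbv⟩ := Finset.exists_ne_zero_of_sum_ne_zero hsum
      have hfactor := (mul_eq_zero.1 (hzero v hv)).resolve_left hbv
      have hvI : v ∈ I := by
        by_contra hvI
        simp [hvI] at hfactor
      exact ⟨v, hvI, (hle v).antisymm (by omega)⟩
  · rintro ⟨v, hvI, hv⟩ w -
    rcases eq_or_ne w v with rfl | hwv
    · simp [hvI, hv]
    · have hpair := Finset.add_le_sum (f := b) (s := Finset.univ) (fun _ _ => Nat.zero_le _)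
        (Finset.mem_univ w) (Finset.mem_univ v) hwv
      rw [show b w = 0 by omega, zero_mul]

end SumOfSquares

section DegreesAlongPath

variable {V : Type*} {k d s : ℕ} {H : Hypergraph V} {x : ℕ → V} {e : ℕ → Set V}

theorem one_le_degree [Finite V] {v : V} (h : ∃ f ∈ H.edgeSet, v ∈ f) : 1 ≤ H.degree v :=
  (Set.ncard_pos (Set.toFinite _)).2 h

theorem IsPath.two_le_degree [Finite V] (h : IsPath H x e d) {i : ℕ} (hi : 0 < i) (hid : i < d) :
    2 ≤ H.degree (x i) :=
  (Set.one_lt_ncard (Set.toFinite _)).2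
    ⟨e (i - 1), ⟨h.edge_mem _ (by omega), h.right_mem_pred hi hid.le⟩,
      e i, ⟨h.edge_mem _ hid, h.left_mem _ hid⟩, h.edge_pred_ne hi hid⟩

theorem IsPath.ncard_interior (h : IsPath H x e d) : (x '' Set.Ioo 0 d).ncard = d - 1 := by
  have hinj : Set.InjOn x (Set.Ioo 0 d) := fun i hi j hj hij =>
    h.vertex_inj i hi.2.le j hj.2.le hij
  rw [hinj.ncard_image, ← Finset.coe_Ioo, Set.ncard_coe_finset, Nat.card_Ioo, Nat.sub_zero]

/-- The largest sum of squares of the degrees of a `k`-uniform hypertree with `d + s` hyperedges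
that contains a path of length `d`. -/
def maxSumDegreeSq (k d s : ℕ) : ℕ :=
  (d + s) * (k - 1) + 1 + 3 * (d - 1) + 4 * s + s ^ 2

theorem IsPath.exists_degree_eq [Fintype V] (hk : 2 ≤ k) (hV : H.vertexSet = Set.univ)
    (hH : H.IsHypertree k) (hE : H.edgeSet.ncard = d + s) (hd : 0 < d) (h : IsPath H x e d) :
    ∃ b : V → ℕ, (∀ v, H.degree v = 1 + (x '' Set.Ioo 0 d).indicator 1 v + b v) ∧
      ∑ v, b v = s := by
  classical
  have hle : ∀ v, 1 + (x '' Set.Ioo 0 d).indicator 1 v ≤ H.degree v := fun v => by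
    by_cases hv : v ∈ x '' Set.Ioo 0 d
    · obtain ⟨i, hi, rfl⟩ := hv
      rw [Set.indicator_of_mem (Set.mem_image_of_mem x hi)]
      exact h.two_le_degree hi.1 hi.2
    · rw [Set.indicator_of_notMem hv]
      exact one_le_degree (exists_mem_of_isHypertree hk hV hH ⟨e 0, h.edge_mem 0 hd⟩ v)
  choose b hb using fun v => Nat.exists_eq_add_of_le (hle v)
  refine ⟨b, hb, ?_⟩
  have hsum := sum_degree hH.1
  obtain ⟨j, rfl⟩ : ∃ j, k = j + 1 := ⟨k - 1, by omega⟩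
  rw [Finset.sum_congr rfl fun v _ => hb v, Finset.sum_add_distrib, Finset.sum_add_distrib,
    sum_indicator_one_eq_ncard, h.ncard_interior, Finset.sum_const, Finset.card_univ,
    card_eq_of_isHypertree (by omega) hV hH, hE, smul_eq_mul, mul_one, Nat.add_sub_cancel,
    Nat.add_one_mul, mul_comm j] at hsum
  omega

theorem maxSumDegreeSq_eq [Fintype V] (hk : 1 ≤ k) (hV : H.vertexSet = Set.univ)
    (hH : H.IsHypertree k) (hE : H.edgeSet.ncard = d + s) (h : IsPath H x e d) :
    maxSumDegreeSq k d s =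
      Fintype.card V + 3 * (x '' Set.Ioo 0 d).ncard + 4 * s + s ^ 2 := by
  rw [maxSumDegreeSq, h.ncard_interior, card_eq_of_isHypertree hk hV hH, hE]

theorem IsPath.sum_degree_sq_le [Fintype V] (hk : 2 ≤ k) (hV : H.vertexSet = Set.univ)
    (hH : H.IsHypertree k) (hE : H.edgeSet.ncard = d + s) (hd : 0 < d) (h : IsPath H x e d) :
    ∑ v, H.degree v ^ 2 ≤ maxSumDegreeSq k d s := by
  obtain ⟨b, hb, rfl⟩ := h.exists_degree_eq hk hV hH hE hd
  rw [maxSumDegreeSq_eq (by omega) hV hH hE h, Finset.sum_congr rfl fun v _ => by rw [hb v]]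
  exact sum_one_add_indicator_add_sq_le _ b

theorem IsPath.sum_degree_sq_eq_iff [Fintype V] (hk : 2 ≤ k) (hV : H.vertexSet = Set.univ)
    (hH : H.IsHypertree k) (hE : H.edgeSet.ncard = d + s) (hd : 2 ≤ d) (h : IsPath H x e d) :
    ∑ v, H.degree v ^ 2 = maxSumDegreeSq k d s ↔ ∃ v ∈ x '' Set.Ioo 0 d, H.degree v = s + 2 := by
  obtain ⟨b, hb, rfl⟩ := h.exists_degree_eq hk hV hH hE (by omega)
  have hne : (x '' Set.Ioo 0 d).Nonempty := ⟨x 1, 1, ⟨one_pos, hd⟩, rfl⟩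
  rw [maxSumDegreeSq_eq (by omega) hV hH hE h, Finset.sum_congr rfl fun v _ => by rw [hb v],
    sum_one_add_indicator_add_sq_eq_iff hne]
  refine exists_congr fun v => and_congr_right fun hv => ?_
  rw [hb, Set.indicator_of_mem hv, Pi.one_apply]
  omega

theorem IsPath.mem_interior_of_degree_eq [Finite V] (hk : 2 ≤ k) (hV : H.vertexSet = Set.univ)
    (hH : H.IsHypertree k) (hE : H.edgeSet.ncard = d + s) (hd : 0 < d) (h : IsPath H x e d) {v : V}
    (hv : H.degree v = s + 2) : v ∈ x '' Set.Ioo 0 d := by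
  have := Fintype.ofFinite V
  obtain ⟨b, hb, rfl⟩ := h.exists_degree_eq hk hV hH hE hd
  by_contra hmem
  have hle : b v ≤ ∑ w, b w := Finset.single_le_sum_of_canonicallyOrdered (Finset.mem_univ v)
  rw [hb, Set.indicator_of_notMem hmem] at hv
  omega

theorem IsPath.degree_eq_two [Finite V] (hk : 2 ≤ k) (hV : H.vertexSet = Set.univ)
    (hH : H.IsHypertree k) (hE : H.edgeSet.ncard = d) (h : IsPath H x e d) {q : ℕ} (hq : 0 < q)
    (hqd : q < d) : H.degree (x q) = 2 := by
  have := Fintype.ofFinite V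
  obtain ⟨b, hb, hsum⟩ := h.exists_degree_eq (s := 0) hk hV hH hE (by omega)
  rw [hb, Set.indicator_of_mem (Set.mem_image_of_mem x (Set.mem_Ioo.2 ⟨hq, hqd⟩)),
    Finset.sum_eq_zero_iff.1 hsum _ (Finset.mem_univ _)]
  rfl

theorem IsPath.exists_iso_starlike [Fintype V] (hk : 2 ≤ k) (hV : H.vertexSet = Set.univ)
    (hH : H.IsHypertree k) (hE : H.edgeSet.ncard = d + s) (hd : 2 ≤ d) (h : IsPath H x e d)
    (hmax : ∑ v, H.degree v ^ 2 = maxSumDegreeSq k d s) :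
    ∃ p, 0 < p ∧ p ≤ d / 2 ∧ H.Iso (starlike k (armList p (d - p) s)) := by
  obtain ⟨_, ⟨q, ⟨hq, hqd⟩, rfl⟩, hdeg⟩ := (h.sum_degree_sq_eq_iff hk hV hH hE hd).1 hmax
  by_cases hmid : q ≤ d / 2
  · exact ⟨q, hq, hmid, h.iso_starlike hk hV hH hE hq hqd hdeg⟩
  · refine ⟨d - q, by omega, by omega, h.reverse.iso_starlike hk hV hH hE (by omega) (by omega) ?_⟩
    rwa [Nat.sub_sub_self hqd.le]

end DegreesAlongPath

section StarlikeDegrees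

variable {k d s p : ℕ}

theorem starlike_degree_none (hk : 2 ≤ k) {L : List ℕ} (hL : ∀ a, 0 < L.get a) :
    (starlike k L).degree none = L.length := by
  have hset : {e ∈ (starlike k L).edgeSet | none ∈ e} =
      Set.range fun a => starlikeEdge k L a ⟨0, hL a⟩ := by
    ext e
    constructor
    · rintro ⟨⟨a, j, rfl⟩, ⟨-, hj⟩ | ⟨_, hr⟩ | ⟨_, _, hr, -⟩⟩
      · exact ⟨a, congrArg _ (Fin.ext hj.symm)⟩
      · exact absurd hr (Option.some_ne_none _).symm
      · exact absurd hr (Option.some_ne_none _).symm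
    · rintro ⟨a, rfl⟩
      exact ⟨starlikeEdge_mem_edgeSet a _, Or.inl ⟨rfl, rfl⟩⟩
  have hinj : Function.Injective fun a => starlikeEdge k L a ⟨0, hL a⟩ := fun a b hab =>
    congrArg Sigma.fst (starlikeEdge_injective hk L (a₁ := ⟨a, 0, hL a⟩) (a₂ := ⟨b, 0, hL b⟩) hab)
  rw [degree, hset, ← Set.image_univ, Set.ncard_image_of_injective _ hinj, Set.ncard_univ,
    Nat.card_eq_fintype_card, Fintype.card_fin]

theorem exists_isPath_starlike (hk : 2 ≤ k) (hp : 0 < p) (hpd : p < d) (s : ℕ) :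
    ∃ x e, IsPath (starlike k (armList p (d - p) s)) x e d := by
  have hdiam := starlike_armList_hasDiameter hk s hp (Nat.sub_pos_of_lt hpd)
  rw [Nat.add_sub_of_le hpd.le] at hdiam
  exact exists_isPath_of_hasDiameter (starlike_isHypertree hk _).2.1 hdiam

theorem starlike_armList_edgeSet_ncard (hk : 2 ≤ k) (hpd : p ≤ d) (s : ℕ) :
    (starlike k (armList p (d - p) s)).edgeSet.ncard = d + s := by
  rw [starlike_edgeSet_ncard hk, armList_sum, Nat.add_sub_of_le hpd]

theorem starlike_sum_degree_sq (hk : 2 ≤ k) (hp : 0 < p) (hpd : p < d) (s : ℕ) :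
    ∑ v, (starlike k (armList p (d - p) s)).degree v ^ 2 = maxSumDegreeSq k d s := by
  obtain ⟨x, e, h⟩ := exists_isPath_starlike hk hp hpd s
  have hH := starlike_isHypertree hk (armList p (d - p) s)
  have hE := starlike_armList_edgeSet_ncard hk hpd.le s
  have hdeg : (starlike k (armList p (d - p) s)).degree none = s + 2 := by
    rw [starlike_degree_none hk fun a => by rw [armList_get]; split_ifs <;> omega]
    simp
  exact (h.sum_degree_sq_eq_iff hk rfl hH hE (by omega)).2
    ⟨none, h.mem_interior_of_degree_eq hk rfl hH hE (by omega) hdeg, hdeg⟩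

theorem starlike_path_iso (hk : 2 ≤ k) (hp : 0 < p) (hpd : p < d) {q : ℕ} (hq : 0 < q)
    (hqd : q < d) : (starlike k (armList p (d - p) 0)).Iso (starlike k (armList q (d - q) 0)) := by
  obtain ⟨x, e, h⟩ := exists_isPath_starlike hk hp hpd 0
  have hH := starlike_isHypertree hk (armList p (d - p) 0)
  have hE := starlike_armList_edgeSet_ncard hk hpd.le 0
  exact h.iso_starlike hk rfl hH hE hq hqd (h.degree_eq_two hk rfl hH hE hq hqd)

end StarlikeDegrees

/-! ### Comparison of spectral moments -/

section Comparison

variable {U V W : Type*} {G : Hypergraph U} {H : Hypergraph V} {H' : Hypergraph W}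

theorem iso_trans (h : G.Iso H) (h' : H.Iso H') : G.Iso H' := by
  obtain ⟨φ, rfl⟩ := h
  obtain ⟨ψ, rfl⟩ := h'
  refine ⟨φ.trans ψ, Hypergraph.ext ?_ ?_⟩
  · change (ψ ∘ φ) '' G.vertexSet = ψ '' (φ '' G.vertexSet)
    rw [Set.image_comp]
  · change Set.image (ψ ∘ φ) '' G.edgeSet = Set.image ψ '' (Set.image φ '' G.edgeSet)
    rw [Set.image_comp_eq, Set.image_comp]

variable [Fintype V] [DecidableEq V] [Fintype W] [DecidableEq W] {k : ℕ} {α : ℝ}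

theorem not_momentEq_of_before (h : H.Before k α H') : ¬ H.MomentEq k α H' := fun heq => by
  obtain ⟨-, d, -, hd, -, hlt⟩ := h
  exact hlt.ne (heq.2 d hd)

theorem before_of_momentEq_of_before [Fintype U] [DecidableEq U] (h : G.MomentEq k α H)
    (h' : H.Before k α H') : G.Before k α H' := by
  obtain ⟨hGH, heq⟩ := h
  obtain ⟨hHH', d, hd, hdlt, hbelow, hlt⟩ := h'
  rw [← hGH] at hdlt
  exact ⟨hGH.trans hHH', d, hd, hdlt, fun t ht => (heq t (ht.trans hdlt)).trans (hbelow t ht),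
    (heq d hdlt).trans_lt hlt⟩

theorem before_of_circuitSum_lt (hk : 2 ≤ k) (hcard : Fintype.card V = Fintype.card W) {N : ℕ}
    (hN : 1 ≤ N) (hNV : N < Fintype.card V)
    (hbelow : ∀ i < N, 0 < i →
      circuitSum (H.alphaTensor k α) i = circuitSum (H'.alphaTensor k α) i)
    (hlt : circuitSum (H.alphaTensor k α) N < circuitSum (H'.alphaTensor k α) N) :
    H.Before k α H' := by
  have hbound : N < Fintype.card V * (k - 1) ^ (Fintype.card V - 1) :=
    hNV.trans_le (Nat.le_mul_of_pos_right _ (Nat.pow_pos (by omega)))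
  refine ⟨hcard, N, hN, hbound, fun i hi => ?_, ?_⟩
  · rcases Nat.eq_zero_or_pos i with rfl | hi0
    · rw [moment_zero, moment_zero, hcard]
    · rw [moment_eq_circuitSum hk _ _ hi0, moment_eq_circuitSum hk _ _ hi0, hbelow i hi hi0, hcard]
  · rw [moment_eq_circuitSum hk _ _ hN, moment_eq_circuitSum hk _ _ hN, hcard]
    have hpos : 0 < ((k - 1 : ℕ) : ℝ) := Nat.cast_pos.2 (by omega)
    exact mul_lt_mul_of_pos_left hlt (by positivity)

theorem before_of_sum_degree_sq_lt (hk : 2 ≤ k) (hα : 0 < α) (hH : H.IsUniform k)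
    (hH' : H'.IsUniform k) (hcard : Fintype.card V = Fintype.card W) (hV : 2 < Fintype.card V)
    (hE : H.edgeSet.ncard = H'.edgeSet.ncard)
    (hlt : ∑ v, H.degree v ^ 2 < ∑ v, H'.degree v ^ 2) : H.Before k α H' := by
  refine before_of_circuitSum_lt hk hcard one_le_two hV (fun i hi hi0 => ?_) ?_
  · obtain rfl : i = 1 := by omega
    rw [circuitSum_alphaTensor_one hk α hH, circuitSum_alphaTensor_one hk α hH', hE]
  · rw [circuitSum_alphaTensor_two hk α hH, circuitSum_alphaTensor_two hk α hH', hE]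
    have hcast : ((∑ v, H.degree v ^ 2 : ℕ) : ℝ) < (∑ v, H'.degree v ^ 2 : ℕ) := Nat.cast_lt.2 hlt
    gcongr

end Comparison

section StarlikeComparison

variable {k d p t s : ℕ} {α : ℝ}

theorem armList_getD (p q s a : ℕ) :
    (armList p q s).getD a 0 =
      if a = 0 then p else if a = 1 then q else if a < s + 2 then 1 else 0 := by
  rcases a with _ | _ | a
  · simp
  · simp
  · by_cases h : a < s <;> simp [h]

theorem circuitSum_armList (k : ℕ) (α : ℝ) (hpd : p ≤ d) (hd : 0 < d) (s N : ℕ) :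
    circuitSum ((starlike k (armList p (d - p) s)).alphaTensor k α) N =
      spiderCircuitSum k (s + 2) d α p 1 N := by
  refine circuitSum_starlike (by simp) (fun a => ?_) (fun a => ?_) k α N
  · rw [armList_get]
    split_ifs <;> omega
  · rw [armList_getD, armLen, if_pos a.isLt]

theorem circuitSum_armList_zero (k : ℕ) (α : ℝ) (hpd : p ≤ d) (s N : ℕ) :
    circuitSum ((starlike k (armList p (d - p) 0)).alphaTensor k α) N =
      spiderCircuitSum k (s + 2) d α p 0 N := by
  refine circuitSum_starlike (by simp) (fun a => ?_) (fun a => ?_) k α N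
  · have ha : a.val < 2 := a.isLt
    rw [armList_get]
    split_ifs <;> omega
  · rw [armList_getD, armLen]
    split_ifs <;> first | rfl | omega

theorem spiderCircuitSum_zero_eq (hk : 2 ≤ k) (hp : 0 < p) (hpd : p < d) (ht : 0 < t) (htd : t < d)
    (α : ℝ) (s N : ℕ) :
    spiderCircuitSum k (s + 2) d α p 0 N = spiderCircuitSum k (s + 2) d α t 0 N := by
  rw [← circuitSum_armList_zero k α hpd.le, ← circuitSum_armList_zero k α htd.le]
  obtain ⟨φ, hφ⟩ := starlike_path_iso hk hp hpd ht htd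
  rw [← hφ]
  exact circuitSum_alphaTensor_eq_of_injective φ.injective rfl k α N

theorem card_starlikeVertex_armList (k : ℕ) (hpd : p ≤ d) (s : ℕ) :
    Fintype.card (StarlikeVertex k (armList p (d - p) s)) = (d + s) * (k - 1) + 1 := by
  rw [card_starlikeVertex, armList_sum, Nat.add_sub_of_le hpd]

theorem starlike_before (hk : 2 ≤ k) (hα0 : 0 < α) (hα1 : α < 1) (hp : 0 < p) (hpt : p < t)
    (htd : 2 * t ≤ d) (hs : 0 < s) :
    (starlike k (armList p (d - p) s)).Before k α (starlike k (armList t (d - t) s)) := by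
  have hcard : ∀ q ≤ d, Fintype.card (StarlikeVertex k (armList q (d - q) s)) =
      (d + s) * (k - 1) + 1 := fun q hq => card_starlikeVertex_armList k hq s
  have hpath := fun N =>
    spiderCircuitSum_zero_eq hk hp (by omega : p < d) (by omega : 0 < t) (by omega) α s N
  have hbound : k * p + 2 < (d + s) * (k - 1) + 1 := by
    obtain ⟨j, rfl⟩ : ∃ j, k = j + 2 := ⟨k - 2, by omega⟩
    have hlen : (2 * p + 3) * (j + 1) ≤ (d + s) * (j + 1) := Nat.mul_le_mul_right _ (by omega)
    simp only [show j + 2 - 1 = j + 1 by omega]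
    nlinarith
  refine before_of_circuitSum_lt (N := k * p + 2) hk
    ((hcard p (by omega)).trans (hcard t (by omega)).symm) (by omega)
    (hbound.trans_eq (hcard p (by omega)).symm) (fun i hi _ => ?_) ?_
  · rw [circuitSum_armList k α (by omega) (by omega), circuitSum_armList k α (by omega) (by omega)]
    exact spiderCircuitSum_eq hk hp hpt htd hi (hpath i)
  · rw [circuitSum_armList k α (by omega) (by omega), circuitSum_armList k α (by omega) (by omega)]
    exact spiderCircuitSum_lt hk hα0 hα1 hp hpt htd (by omega) (hpath _)

theorem before_or_iso {V : Type*} [Fintype V] [DecidableEq V] {T : Hypergraph V} {m : ℕ}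
    (hk : 2 ≤ k) (hα0 : 0 < α) (hα1 : α < 1) (hd : 2 ≤ d) (hdm : d ≤ m)
    (hV : T.vertexSet = Set.univ) (hT : T.IsHypertree k) (hE : T.edgeSet.ncard = m)
    (hdiam : T.HasDiameter d) :
    T.Before k α (starlike k (armLengths m d)) ∨ T.Iso (starlike k (armLengths m d)) := by
  obtain ⟨s, rfl⟩ := Nat.exists_eq_add_of_le hdm
  rw [armLengths, Nat.add_sub_cancel_left]
  have hhalf : 0 < d / 2 := by omega
  have hhalf_lt : d / 2 < d := by omega
  obtain ⟨x, e, hpath⟩ := exists_isPath_of_hasDiameter hT.2.1 hdiam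
  have hcardV : Fintype.card V = (d + s) * (k - 1) + 1 := by
    rw [card_eq_of_isHypertree (by omega) hV hT, hE]
  have hsum := starlike_sum_degree_sq hk hhalf hhalf_lt s
  rcases (hpath.sum_degree_sq_le hk hV hT hE (by omega)).lt_or_eq with hlt | hmax
  · have hlarge : 2 < Fintype.card V := by
      have : (d + s) * 1 ≤ (d + s) * (k - 1) := Nat.mul_le_mul_left _ (by omega)
      omega
    refine .inl (before_of_sum_degree_sq_lt hk hα0 hT.1 (starlike_isUniform hk _)
      (hcardV.trans (card_starlikeVertex_armList k hhalf_lt.le s).symm) hlarge ?_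
      (hlt.trans_eq hsum.symm))
    rw [hE, starlike_armList_edgeSet_ncard hk hhalf_lt.le]
  · obtain ⟨p, hp, hpd, hiso⟩ := hpath.exists_iso_starlike hk hV hT hE hd hmax
    rcases hpd.eq_or_lt with rfl | hpd
    · exact .inr hiso
    rcases Nat.eq_zero_or_pos s with rfl | hs
    · exact .inr (iso_trans hiso (starlike_path_iso hk hp (by omega) hhalf hhalf_lt))
    · exact .inl (before_of_momentEq_of_before (momentEq_of_iso hiso hk α)
        (starlike_before hk hα0 hα1 hp hpd (by omega) hs))

end StarlikeComparison

end HypertreeMoment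

/-- Among the `k`-uniform hypertrees with `m` hyperedges and diameter `d`, the starlike hypertree
`S_{t, d-t, 1, …, 1}` with `t = ⌊d/2⌋` (and `m - d` ones) is, up to isomorphism, the unique last
one in `S_α`-order. -/
theorem mainTheorem6 (k m d : ℕ) (hk : 2 ≤ k) (hd : 2 ≤ d) (hdm : d ≤ m)
    (α : ℝ) (hα0 : 0 < α) (hα1 : α < 1) :
    ((Hypergraph.starlike k (Hypergraph.armLengths m d)).IsHypertree k ∧
      (Hypergraph.starlike k (Hypergraph.armLengths m d)).edgeSet.ncard = m ∧
      (Hypergraph.starlike k (Hypergraph.armLengths m d)).HasDiameter d) ∧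
    ∀ (V : Type*) [Fintype V] [DecidableEq V] (T : Hypergraph V), T.vertexSet = Set.univ →
      T.IsHypertree k → T.edgeSet.ncard = m → T.HasDiameter d →
        T.BeforeEq k α (Hypergraph.starlike k (Hypergraph.armLengths m d)) ∧
        (T.MomentEq k α (Hypergraph.starlike k (Hypergraph.armLengths m d)) ↔
          T.Iso (Hypergraph.starlike k (Hypergraph.armLengths m d))) := by
  refine ⟨⟨HypertreeMoment.starlike_isHypertree hk _, ?_, ?_⟩, fun V _ _ T hV hT hE hdiam => ?_⟩
  · rw [HypertreeMoment.starlike_armList_edgeSet_ncard hk (Nat.div_le_self d 2),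
      Nat.add_sub_of_le hdm]
  · have h := HypertreeMoment.starlike_armList_hasDiameter hk (m - d)
      (by omega : 0 < d / 2) (by omega : 0 < d - d / 2)
    rwa [Nat.add_sub_of_le (Nat.div_le_self d 2)] at h
  · have hT := HypertreeMoment.before_or_iso hk hα0 hα1 hd hdm hV hT hE hdiam
    exact ⟨hT.imp_right fun h => HypertreeMoment.momentEq_of_iso h hk α,
      fun h => hT.resolve_left fun h' => HypertreeMoment.not_momentEq_of_before h' h,
      fun h => HypertreeMoment.momentEq_of_iso h hk α⟩
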